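/- Let $X$ be a real Banach space and let $A:X\supset D(A)\to X$ be a (densely defined) sectorial operator which is positive (i.e. $\operatorname{Re}\mu>0$ for $\mu\in\sigma(A)$) and has compact resolvents. Suppose that $X$ embeds into a Hilbert space $H$ by a continuous injective linear map $i$, and that there is a self-adjoint operator $\widehat A$ on $H$ with $(i\times i)(\mathrm{Gr}(A))\subset \mathrm{Gr}(\widehat A)$. Let $S_B$ denote the $C_0$ semigroup generated by $-B$. Let $\alpha\in(0,1)$, $c>0$, $\lambda\in\mathbb R$; let $X^\alpha=D(A^\alpha)$ be the range of $A^{-\alpha}=\Gamma(\alpha)^{-1}\int_0^\infty t^{\alpha-1}S_A(t)\,dt$, with norm $\|x\|_\alpha=\|A^\alpha x\|$, let $\mathbf E=X^\alpha\times X$ with norm $\|x\|_\alpha+\|y\|$, and let $$\mathbf A(x,y)=(-y,\;A(x+cy)-\lambda x),\qquad D(\mathbf A)=\{(x,y)\in\mathbf E: x+cy\in D(A)\}.$$ For $F:X^\alpha\to X$, a mild solution on an interval $J\subset\mathbb R$ of $$\ddot u=-Au-cA\dot u+\lambda u+F(u)\qquad(\ast)$$ is a continuous map $w=(w_1,w_2):J\to\mathbf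 E$ with $w(t)=S_{\mathbf A}(t-t')w(t')+\int_{t'}^tS_{\mathbf A}(t-\tau)(0,F(w_1(\tau)))\,d\tau$ for all $t'<t$ in $J$; a bounded orbit is a mild solution on $\mathbb R$ with bounded range in $\mathbf E$. Assume that $y_0\in\ker(\lambda I-A)$ and $y_0\ne0$, and let $F\equiv y_0$. Then: 1. $F$ is locally Lipschitz, maps bounded sets to relatively compact sets, and is bounded (so $(\ast)$ is at resonance at infinity), and for every $z\in\mathbf E$ there is a mild solution $w$ of $(\ast)$ on $[0,\infty)$ with $w(0)=z$. 2. $(\ast)$ has no bounded orbit. 3. Let $P:X\to X$ be the spectral projection of $A$ onto $\ker(\lambda I-A)$, that is, the continuous projection along an $A$-invariant complement $V$ with $\sigma(A|_V)=\sigma(A)\setminus\{\lambda\}$ (such a projection exists), and let $\mathbf P(x,y)=(Px,Py)$, which maps $\mathbf E$ onto $\mathbf E_0=\ker(\lambda I-A)\times\ker(\lambda I-A)$. Equip $\mathbf E_0$ with the inner product $\langle(x,y),(x',y')\rangle_{\mathbf E_0}=\langle ix,ix'\rangle_H+\langle iy,iy'\rangle_H$. Then every mild solution $w$ of $(\ast)$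 on $[0,\infty)$ satisfies $$\langle\mathbf Pw(t),(c\lambda y_0,y_0)\rangle_{\mathbf E_0}=\langle\mathbf Pw(0),(c\lambda y_0,y_0)\rangle_{\mathbf E_0}+t\,\|iy_0\|_H^2\qquad(t\ge0),$$ and $\mathbf Pw$ grows linearly in time: there are $a>0$ and $b,C\in\mathbb R$ (depending on $w$) such that $at-b\le\|\mathbf Pw(t)\|_{\mathbf E_0}\le Ct+b$ for all $t\ge0$. -/

import Mathlib

open Set Filter Topology MeasureTheory

noncomputable section

namespace DampedWave

universe u v

/-! ### Resolvent, spectrum, sectorial operators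

For an operator `B` on a real Banach space `X` the complexification `X_ℂ = X ⊕ iX` is written as
`X × X` (the pair `(x, y)` stands for `x + i y`), with the maximum norm, which is equivalent to
every complexification norm. -/

section Resolvent

variable {X : Type u} [NormedAddCommGroup X] [NormedSpace ℝ X]

/-- `R` is the bounded two-sided inverse of `μ I - B_ℂ`, where `B_ℂ (x + i y) = B x + i B y` on
`D(B) + i D(B)`. -/
def IsResolventAt (B : X →ₗ.[ℝ] X) (μ : ℂ) (R : X × X →L[ℝ] X × X) : Prop :=
  ∀ p q : X × X, R p = q ↔
    ∃ (h₁ : q.1 ∈ B.domain) (h₂ : q.2 ∈ B.domain),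
      (μ.re • q.1 - μ.im • q.2 - B ⟨q.1, h₁⟩, μ.im • q.1 + μ.re • q.2 - B ⟨q.2, h₂⟩) = p

/-- The spectrum `σ(B) ⊆ ℂ` of (the complexification of) `B`. -/
def spec (B : X →ₗ.[ℝ] X) : Set ℂ :=
  {μ | ¬ ∃ R : X × X →L[ℝ] X × X, IsResolventAt B μ R}

/-- Sectorial operators: densely defined, with a sector
`{μ ≠ a : φ ≤ |arg (μ - a)| ≤ π}`, `φ ∈ (0, π/2)`, in the resolvent set on which
`‖(μ I - B)⁻¹‖ ≤ M / |μ - a|`. -/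
def IsSectorial (B : X →ₗ.[ℝ] X) : Prop :=
  Dense (B.domain : Set X) ∧
    ∃ φ ∈ Ioo (0 : ℝ) (Real.pi / 2), ∃ M : ℝ, 1 ≤ M ∧ ∃ a : ℝ,
      ∀ μ : ℂ, μ ≠ (a : ℂ) → φ ≤ |Complex.arg (μ - (a : ℂ))| →
        ∃ R : X × X →L[ℝ] X × X, IsResolventAt B μ R ∧ ‖R‖ ≤ M / ‖μ - (a : ℂ)‖

/-- `B` is positive: `Re μ > 0` for all `μ ∈ σ(B)`. -/
def IsPositiveOp (B : X →ₗ.[ℝ] X) : Prop :=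
  ∀ μ ∈ spec B, 0 < μ.re

/-- `B` has compact resolvents. -/
def HasCompactResolvents (B : X →ₗ.[ℝ] X) : Prop :=
  ∀ (μ : ℂ) (R : X × X →L[ℝ] X × X), IsResolventAt B μ R → IsCompactOperator R

/-- The real subspace `ker (lam I - B)`. -/
def eigenKer (B : X →ₗ.[ℝ] X) (lam : ℝ) : Submodule ℝ X where
  carrier := {x | ∃ h : x ∈ B.domain, B ⟨x, h⟩ = lam • x}
  zero_mem' := ⟨B.domain.zero_mem, by
    rw [smul_zero]; exact B.map_zero⟩
  add_mem' := by
    rintro x y ⟨hx, ex⟩ ⟨hy, ey⟩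
    refine ⟨B.domain.add_mem hx hy, ?_⟩
    rw [smul_add, ← ex, ← ey]
    exact B.map_add ⟨x, hx⟩ ⟨y, hy⟩
  smul_mem' := by
    rintro r x ⟨hx, ex⟩
    refine ⟨B.domain.smul_mem r hx, ?_⟩
    rw [smul_comm, ← ex]
    exact B.map_smul r ⟨x, hx⟩

/-- The part of `B` in the subspace `V`: `D(B_V) = {v ∈ V ∩ D(B) : B v ∈ V}`, `B_V v = B v`. -/
def partIn (B : X →ₗ.[ℝ] X) (V : Submodule ℝ X) : V →ₗ.[ℝ] V where
  domain :=
    { carrier := {v | ∃ h : (v : X) ∈ B.domain, B ⟨v, h⟩ ∈ V}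
      zero_mem' := ⟨B.domain.zero_mem, by
        have h : B ⟨((0 : V) : X), B.domain.zero_mem⟩ = 0 := B.map_zero
        rw [h]; exact V.zero_mem⟩
      add_mem' := by
        rintro x y ⟨hx, ex⟩ ⟨hy, ey⟩
        refine ⟨B.domain.add_mem hx hy, ?_⟩
        have h : B ⟨((x + y : V) : X), B.domain.add_mem hx hy⟩ = B ⟨x, hx⟩ + B ⟨y, hy⟩ :=
          B.map_add ⟨x, hx⟩ ⟨y, hy⟩
        rw [h]; exact V.add_mem ex ey
      smul_mem' := by
        rintro r x ⟨hx, ex⟩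
        refine ⟨B.domain.smul_mem r hx, ?_⟩
        have h : B ⟨((r • x : V) : X), B.domain.smul_mem r hx⟩ = r • B ⟨x, hx⟩ :=
          B.map_smul r ⟨x, hx⟩
        rw [h]; exact V.smul_mem r ex }
  toFun :=
    { toFun := fun v => ⟨B ⟨((v : V) : X), v.2.1⟩, v.2.2⟩
      map_add' := fun x y => Subtype.ext (B.map_add ⟨((x : V) : X), x.2.1⟩ ⟨((y : V) : X), y.2.1⟩)
      map_smul' := fun r x => Subtype.ext (B.map_smul r ⟨((x : V) : X), x.2.1⟩) }

/-- `P` is the spectral projection of `B` for the eigenvalue `lam`: the continuous projection onto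
`X₀ = ker (lam I - B)` along a closed `B`-invariant complement `V` such that the part of `B` in `V`
has spectrum `σ(B) \ {lam}`. (`V = X₋ ⊕ X₊` when `V` is split further into the parts below and
above `lam`.) -/
structure IsSpectralProjection (B : X →ₗ.[ℝ] X) (lam : ℝ) (P : X →L[ℝ] X) : Prop where
  mem_ker : ∀ x, P x ∈ eigenKer B lam
  apply_of_mem : ∀ x ∈ eigenKer B lam, P x = x
  invariant : ∀ v : B.domain, P v = 0 → P (B v) = 0
  spec_part : spec (partIn B (LinearMap.ker (P : X →ₗ[ℝ] X))) = spec B \ {(lam : ℂ)}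

end Resolvent

/-! ### Strongly continuous semigroups -/

/-- A `C₀` semigroup `{S(t)}_{t ≥ 0}` of bounded operators (the values at `t < 0` are irrelevant). -/
structure C0Semigroup (X : Type u) [NormedAddCommGroup X] [NormedSpace ℝ X] where
  toFun : ℝ → X →L[ℝ] X
  map_zero' : toFun 0 = ContinuousLinearMap.id ℝ X
  map_add' : ∀ s t : ℝ, 0 ≤ s → 0 ≤ t → toFun (s + t) = (toFun s).comp (toFun t)
  continuousOn' : ∀ x : X, ContinuousOn (fun t => toFun t x) (Ici 0)

section Semigroup

variable {X : Type u} [NormedAddCommGroup X] [NormedSpace ℝ X]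

/-- `B` is the infinitesimal generator of `S`: `x ∈ D(B)` and `B x = y` if and only if
`(S(h) x - x) / h → y` as `h → 0+`. -/
def C0Semigroup.IsGeneratedBy (S : C0Semigroup X) (B : X →ₗ.[ℝ] X) : Prop :=
  ∀ x y : X, (x, y) ∈ B.graph ↔
    Tendsto (fun h : ℝ => h⁻¹ • (S.toFun h x - x)) (𝓝[>] 0) (𝓝 y)

/-- The constant semigroup. -/
def C0Semigroup.const (X : Type u) [NormedAddCommGroup X] [NormedSpace ℝ X] : C0Semigroup X where
  toFun := fun _ => ContinuousLinearMap.id ℝ X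
  map_zero' := rfl
  map_add' := fun _ _ _ _ => rfl
  continuousOn' := fun _ => continuousOn_const

open Classical in
/-- The `C₀` semigroup generated by `B`. (A semigroup is determined on `[0, ∞)` by its generator;
the constant semigroup is the default value for operators that generate no semigroup.) -/
def semigroupOf (B : X →ₗ.[ℝ] X) : C0Semigroup X :=
  if h : ∃ S : C0Semigroup X, S.IsGeneratedBy B then h.choose else C0Semigroup.const X

/-- `A^{-α} = Γ(α)⁻¹ ∫₀^∞ t^{α-1} S_A(t) dt`, where `S_A` is the semigroup generated by `-A`. -/
def negPow (A : X →ₗ.[ℝ] X) (α : ℝ) : X →L[ℝ] X :=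
  (Real.Gamma α)⁻¹ • ∫ t in Ioi (0 : ℝ), t ^ (α - 1) • (semigroupOf (-A)).toFun t

end Semigroup

/-! ### Fractional spaces -/

section Fractional

variable {X : Type u} [NormedAddCommGroup X] [NormedSpace ℝ X]

/-- The fractional space `X^α = D(A^α)`, that is, the range of `A^{-α}`. -/
def FracSpace (A : X →ₗ.[ℝ] X) (α : ℝ) : Type u :=
  ↥(LinearMap.range (negPow A α : X →ₗ[ℝ] X))

variable (A : X →ₗ.[ℝ] X) (α : ℝ)

instance : AddCommGroup (FracSpace A α) :=
  inferInstanceAs (AddCommGroup ↥(LinearMap.range (negPow A α : X →ₗ[ℝ] X)))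

instance : Module ℝ (FracSpace A α) :=
  inferInstanceAs (Module ℝ ↥(LinearMap.range (negPow A α : X →ₗ[ℝ] X)))

/-- The inclusion `X^α ⊆ X`. -/
def FracSpace.incl : FracSpace A α →ₗ[ℝ] X :=
  (LinearMap.range (negPow A α : X →ₗ[ℝ] X)).subtype

instance isClosed_ker_negPow :
    IsClosed ((LinearMap.ker (negPow A α : X →ₗ[ℝ] X) : Submodule ℝ X) : Set X) :=
  (negPow A α).isClosed_ker

/-- `A^α`, as a linear bijection of `X^α` onto `X ⧸ ker A^{-α}` (which is `X`, because `A^{-α}` is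
injective for a positive sectorial operator `A`). -/
def FracSpace.pow : FracSpace A α ≃ₗ[ℝ] (X ⧸ LinearMap.ker (negPow A α : X →ₗ[ℝ] X)) :=
  (negPow A α : X →ₗ[ℝ] X).quotKerEquivRange.symm

/-- The norm `‖x‖_α = ‖A^α x‖` of `X^α`. -/
instance : NormedAddCommGroup (FracSpace A α) :=
  NormedAddCommGroup.induced (FracSpace A α)
    (X ⧸ LinearMap.ker (negPow A α : X →ₗ[ℝ] X))
    (FracSpace.pow A α) (FracSpace.pow A α).injective

instance : NormedSpace ℝ (FracSpace A α) :=
  NormedSpace.induced ℝ (FracSpace A α)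
    (X ⧸ LinearMap.ker (negPow A α : X →ₗ[ℝ] X)) (FracSpace.pow A α).toLinearMap

instance [CompleteSpace X] : CompleteSpace (FracSpace A α) := by
  have hiso : Isometry (FracSpace.pow A α) := Isometry.of_dist_eq fun x y => rfl
  have e : IsUniformInducing (FracSpace.pow A α) := hiso.isUniformInducing
  rw [completeSpace_iff_isComplete_range e, (FracSpace.pow A α).surjective.range_eq]
  exact isComplete_univ

/-- If `A^{-α}` is injective, then `‖x‖_α = ‖v‖` for `x = A^{-α} v`. -/
theorem FracSpace.norm_eq (hinj : Function.Injective (negPow A α)) (x : FracSpace A α) (v : X)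
    (h : negPow A α v = FracSpace.incl A α x) : ‖x‖ = ‖v‖ := by
  have hx : FracSpace.pow A α x =
      Submodule.Quotient.mk (p := LinearMap.ker (negPow A α : X →ₗ[ℝ] X)) v := by
    have e : x = (FracSpace.pow A α).symm (Submodule.Quotient.mk v) := Subtype.ext h.symm
    rw [e]
    exact (FracSpace.pow A α).apply_symm_apply _
  have hker : LinearMap.ker (negPow A α : X →ₗ[ℝ] X) = ⊥ := LinearMap.ker_eq_bot.2 hinj
  change ‖FracSpace.pow A α x‖ = ‖v‖
  rw [hx]
  refine (QuotientAddGroup.norm_mk v).trans ?_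
  rw [hker]
  simp

/-- The phase space `E = X^α × X`; its maximum norm is equivalent to `‖x‖_α + ‖y‖`. -/
abbrev Phase : Type u := FracSpace A α × X

/-- The domain `{(x, y) ∈ E : x + c y ∈ D(A)}` of `𝐀`. (The requirement `y ∈ X^α`, which is needed
for `𝐀 (x, y) ∈ E`, is automatic for `c > 0` since `D(A) ⊆ X^α`.) -/
def waveDomain (c : ℝ) : Submodule ℝ (Phase A α) :=
  (LinearMap.range (negPow A α : X →ₗ[ℝ] X)).comap (LinearMap.snd ℝ (FracSpace A α) X) ⊓
    A.domain.comap ((FracSpace.incl A α).comp (LinearMap.fst ℝ (FracSpace A α) X) +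
      c • LinearMap.snd ℝ (FracSpace A α) X)

/-- `(x, y) ↦ y` as a map `D(𝐀) → X^α`. -/
def waveSnd (c : ℝ) : waveDomain A α c →ₗ[ℝ] FracSpace A α :=
  ((LinearMap.snd ℝ (FracSpace A α) X).comp (waveDomain A α c).subtype).codRestrict
    (LinearMap.range (negPow A α : X →ₗ[ℝ] X)) fun z => z.2.1

/-- `(x, y) ↦ x + c y` as a map `D(𝐀) → D(A)`. -/
def waveSum (c : ℝ) : waveDomain A α c →ₗ[ℝ] A.domain :=
  (((FracSpace.incl A α).comp (LinearMap.fst ℝ (FracSpace A α) X) +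
    c • LinearMap.snd ℝ (FracSpace A α) X).comp (waveDomain A α c).subtype).codRestrict
      A.domain fun z => z.2.2

/-- The operator `𝐀 (x, y) = (-y, A (x + c y) - lam x)` on `E`. -/
def waveOp (c lam : ℝ) : Phase A α →ₗ.[ℝ] Phase A α where
  domain := waveDomain A α c
  toFun := LinearMap.prod (-(waveSnd A α c))
    (A.toFun.comp (waveSum A α c) -
      lam • ((FracSpace.incl A α).comp (LinearMap.fst ℝ (FracSpace A α) X)).comp
        (waveDomain A α c).subtype)

theorem incl_waveSnd (c : ℝ) (z : waveDomain A α c) :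
    FracSpace.incl A α (waveSnd A α c z) = (z : Phase A α).2 := rfl

theorem coe_waveSum (c : ℝ) (z : waveDomain A α c) :
    (waveSum A α c z : X) = FracSpace.incl A α (z : Phase A α).1 + c • (z : Phase A α).2 := rfl

theorem waveOp_apply (c lam : ℝ) (z : waveDomain A α c) :
    waveOp A α c lam z =
      (-(waveSnd A α c z), A (waveSum A α c z) - lam • FracSpace.incl A α (z : Phase A α).1) := rfl

variable {A α}

/-- The nonlinearities `F : X^α → X` of the equation: locally Lipschitz, mapping bounded sets to
relatively compact sets, and bounded. -/
structure IsAdmissibleNonlinearity (F : FracSpace A α → X) : Prop where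
  locallyLipschitz : ∀ x : FracSpace A α, ∃ V : Set (FracSpace A α), IsOpen V ∧ x ∈ V ∧
    ∃ L : ℝ, 0 < L ∧ ∀ x₁ ∈ V, ∀ x₂ ∈ V, ‖F x₁ - F x₂‖ ≤ L * ‖x₁ - x₂‖
  compact : ∀ V : Set (FracSpace A α), Bornology.IsBounded V → IsCompact (closure (F '' V))
  bounded : ∃ m : ℝ, 0 < m ∧ ∀ x, ‖F x‖ ≤ m

/-- `w` is a mild solution on the interval `J` of `w' = -𝐀 w + (0, F(w₁))`, the first order form of
`u'' = -A u - c A u' + lam u + F(u)`. -/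
structure IsMildSolution (c lam : ℝ) (F : FracSpace A α → X) (J : Set ℝ) (w : ℝ → Phase A α) :
    Prop where
  continuousOn : ContinuousOn w J
  variation_of_constants : ∀ t' ∈ J, ∀ t ∈ J, t' < t →
    w t = (semigroupOf (-(waveOp A α c lam))).toFun (t - t') (w t') +
      ∫ τ in t'..t, (semigroupOf (-(waveOp A α c lam))).toFun (t - τ)
        ((0, F (w τ).1) : Phase A α)

/-- A bounded orbit: a mild solution `w : ℝ → E` on the whole line with bounded range. -/
def IsBoundedOrbit (c lam : ℝ) (F : FracSpace A α → X) (w : ℝ → Phase A α) : Prop :=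
  IsMildSolution c lam F univ w ∧ Bornology.IsBounded (range w)

end Fractional

/-! ### The Hilbert space structure of `E₀ = ker (lam I - A) × ker (lam I - A)` -/

section Hilbert

variable {X : Type u} [NormedAddCommGroup X] [NormedSpace ℝ X]
  {H : Type v} [NormedAddCommGroup H] [InnerProductSpace ℝ H]

/-- `𝐏 (x, y) = (P x, P y)`. -/
def phaseProj (A : X →ₗ.[ℝ] X) (α : ℝ) (P : X →L[ℝ] X) (z : Phase A α) : X × X :=
  (P (FracSpace.incl A α z.1), P z.2)

/-- `⟨(x, y), (x', y')⟩ = ⟨x, x'⟩_H + ⟨y, y'⟩_H`, where `i` embeds `X` into `H`. -/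
def pairInner (i : X →L[ℝ] H) (p q : X × X) : ℝ :=
  inner ℝ (i p.1) (i q.1) + inner ℝ (i p.2) (i q.2)

/-- `‖(x, y)‖_{E₀} = (‖x‖_H² + ‖y‖_H²)^{1/2}`. -/
def pairNorm (i : X →L[ℝ] H) (p : X × X) : ℝ :=
  Real.sqrt (‖i p.1‖ ^ 2 + ‖i p.2‖ ^ 2)

end Hilbert

end DampedWave

end

/-! On the eigenspace of `lam` the operator `A` is multiplication by `lam`, so the projected
equation reads u'' = -c lam u' + y₀: the restoring force is cancelled by the resonant term. Hence c
lam P u + P u' has constant derivative y₀ (`conservedProj_mildSolution`), while P u' relaxes at rate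
c lam > 0 and stays bounded (`norm_velocityProj_mildSolution_le`). The first quantity is a bounded
linear function of the state that grows without bound, so no orbit on the whole line is bounded. Its
H-inner product with y₀ equals the pairing of 𝐏 w with (c lam y₀, y₀), which gives the exact formula
and, by Cauchy-Schwarz, the lower growth bound. Solving for P u gives the upper one. Here lam > 0
because `A` is positive and has the eigenvector y₀.

For mild solutions this needs only the generator G of the semigroup S: if φ G = -κ φ on its domain,
then φ S(t) = exp (-κ t) φ (`C0Semigroup.apply_eq_exp_smul`), and φ can be applied to Duhamel's
formula. Since `semigroupOf` has a default value, it must be proved that -𝐀 generates a semigroup.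
Positivity gives K = A⁻¹, and with sectoriality the bound ‖(μ - A)⁻¹‖ ≤ M / (1 + |μ|) for Re μ ≤ 0.
The inverse Laplace integral (2π)⁻¹ ∫ exp ν (ν + tA)⁻² ds over ν = 1 + is, absolutely convergent
thanks to the square, yields the semigroup of -A. A Beta integral then gives A^{-α} A^{-(1-α)} =
A⁻¹, so A⁻¹ is bounded from X to X^α. In the coordinates (x + c⁻² A⁻¹(x + c y), x + c y) the
operator -𝐀 is diag(0, -cA) plus a bounded operator, and bounded perturbation theory applies
(`exists_isGeneratedBy_neg_waveOp`).

The projection P is the H-orthogonal one onto the eigenspace, which is finite-dimensional by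
compactness. Self-adjointness of the extension makes K symmetric for the H-inner product, so P
commutes with K; the Fredholm alternative identifies the spectrum on ker P
(`IsReducing.spec_partIn`). -/

namespace DampedWave

/-! ### Generators and orbits of strongly continuous semigroups -/

section SemigroupGeneral

variable {E : Type*} [NormedAddCommGroup E] [NormedSpace ℝ E]

/-- `(x, y)` belongs to the graph of the infinitesimal generator of `S`. -/
def C0Semigroup.HasGen (S : C0Semigroup E) (x y : E) : Prop :=
  Tendsto (fun h : ℝ => h⁻¹ • (S.toFun h x - x)) (𝓝[>] 0) (𝓝 y)

/-- Clamping the time at 0 replaces the meaningless values at negative times, so that integrands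
become continuous on all of ℝ. -/
theorem C0Semigroup.continuous_max (S : C0Semigroup E) (x : E) :
    Continuous fun t : ℝ => S.toFun (max t 0) x :=
  (S.continuousOn' x).comp_continuous (by fun_prop) fun t => le_max_right t 0

theorem C0Semigroup.apply_zero (S : C0Semigroup E) (x : E) : S.toFun 0 x = x := by
  rw [S.map_zero']; rfl

theorem C0Semigroup.apply_add (S : C0Semigroup E) {s t : ℝ} (hs : 0 ≤ s) (ht : 0 ≤ t) (x : E) :
    S.toFun (s + t) x = S.toFun s (S.toFun t x) := by
  rw [S.map_add' s t hs ht]; rfl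

theorem C0Semigroup.exists_bound [CompleteSpace E] (S : C0Semigroup E) (T : ℝ) :
    ∃ M, 0 ≤ M ∧ ∀ t ≤ T, ‖S.toFun (max t 0)‖ ≤ M := by
  have h : ∀ x : E, ∃ C, ∀ t : Icc 0 (max T 0), ‖S.toFun t x‖ ≤ C := by
    intro x
    obtain ⟨C, hC⟩ := isCompact_Icc.exists_bound_of_continuousOn
      ((S.continuousOn' x).mono fun t (ht : t ∈ Icc 0 (max T 0)) => ht.1)
    exact ⟨C, fun t => hC t t.2⟩
  obtain ⟨M, hM⟩ := banach_steinhaus h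
  refine ⟨max M 0, le_max_right _ _, fun t ht => le_max_of_le_left ?_⟩
  exact hM ⟨max t 0, le_max_right _ _, max_le_max_right 0 ht⟩

/-- Strong continuity and the Banach-Steinhaus bound on bounded time intervals together give joint
continuity; the Duhamel integrands need it. -/
theorem C0Semigroup.continuous_max_prod [CompleteSpace E] (S : C0Semigroup E) :
    Continuous fun p : ℝ × E => S.toFun (max p.1 0) p.2 := by
  rw [continuous_iff_continuousAt]
  rintro ⟨t, x⟩
  obtain ⟨M, hM0, hM⟩ := S.exists_bound (t + 1)
  have h1 : Tendsto (fun p : ℝ × E => M * ‖p.2 - x‖ +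
      ‖S.toFun (max p.1 0) x - S.toFun (max t 0) x‖) (𝓝 (t, x)) (𝓝 0) := by
    have hc : Continuous (fun p : ℝ × E => M * ‖p.2 - x‖ +
        ‖S.toFun (max p.1 0) x - S.toFun (max t 0) x‖) := by
      have := (S.continuous_max x).comp (continuous_fst (X := ℝ) (Y := E))
      have h2 : Continuous fun p : ℝ × E => S.toFun (max p.1 0) x := this
      fun_prop
    have := hc.tendsto (t, x)
    simpa using this
  refine tendsto_iff_norm_sub_tendsto_zero.2 (squeeze_zero' (Eventually.of_forall fun _ =>
    norm_nonneg _) ?_ h1)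
  have hev : ∀ᶠ p : ℝ × E in 𝓝 (t, x), p.1 < t + 1 :=
    (continuous_fst.tendsto (t, x)).eventually (gt_mem_nhds (by simp))
  filter_upwards [hev] with p hp
  have e : S.toFun (max p.1 0) p.2 - S.toFun (max t 0) x =
      S.toFun (max p.1 0) (p.2 - x) + (S.toFun (max p.1 0) x - S.toFun (max t 0) x) := by
    rw [map_sub]; abel
  rw [e]
  refine (norm_add_le _ _).trans (add_le_add ?_ le_rfl)
  exact (S.toFun (max p.1 0)).le_of_opNorm_le (hM p.1 hp.le) _

theorem C0Semigroup.intervalIntegrable (S : C0Semigroup E) (z : E) {a b : ℝ} (ha : 0 ≤ a)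
    (hb : 0 ≤ b) : IntervalIntegrable (fun s => S.toFun s z) volume a b :=
  ((S.continuousOn' z).mono fun _ hs => (le_inf ha hb).trans hs.1).intervalIntegrable

theorem C0Semigroup.integral_max (S : C0Semigroup E) (z : E) {a b : ℝ} (ha : 0 ≤ a)
    (hb : 0 ≤ b) : ∫ s in a..b, S.toFun (max s 0) z = ∫ s in a..b, S.toFun s z := by
  refine intervalIntegral.integral_congr fun s hs => ?_
  have : 0 ≤ s := (le_inf ha hb).trans hs.1
  simp only [max_eq_left this]

theorem tendsto_inv_smul_integral [CompleteSpace E] {f : ℝ → E} (hf : Continuous f) (a : ℝ) :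
    Tendsto (fun h : ℝ => h⁻¹ • ∫ s in a..a + h, f s) (𝓝[>] 0) (𝓝 (f a)) := by
  have h := (hf.integral_hasStrictDerivAt a a).hasDerivAt
  have h2 := h.tendsto_slope_zero_right
  simpa using h2

theorem C0Semigroup.apply_integral [CompleteSpace E] (S : C0Semigroup E) (z : E) {h t : ℝ}
    (hh : 0 ≤ h) (ht : 0 ≤ t) : S.toFun h (∫ s in (0 : ℝ)..t, S.toFun s z) =
      ∫ s in h..t + h, S.toFun s z := by
  rw [← ContinuousLinearMap.intervalIntegral_comp_comm _ (S.intervalIntegrable z le_rfl ht)]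
  have e2 : ∀ s ∈ uIcc 0 t, S.toFun h (S.toFun s z) = S.toFun (s + h) z := by
    intro s hs
    rw [uIcc_of_le ht] at hs
    rw [add_comm, S.apply_add hh hs.1]
  rw [intervalIntegral.integral_congr e2,
    intervalIntegral.integral_comp_add_right (fun s => S.toFun s z) h, zero_add]

/-- `∫₀ᵗ S(s) z ds` belongs to the domain of the generator, which maps it to `S(t) z - z`. -/
theorem C0Semigroup.hasGen_integral [CompleteSpace E] (S : C0Semigroup E) (z : E) {t : ℝ}
    (ht : 0 ≤ t) : S.HasGen (∫ s in (0 : ℝ)..t, S.toFun s z) (S.toFun t z - z) := by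
  have hc := S.continuous_max z
  have h1 := (tendsto_inv_smul_integral hc t).sub (tendsto_inv_smul_integral hc 0)
  simp only [max_self, max_eq_left ht, S.apply_zero, zero_add] at h1
  refine h1.congr' ?_
  filter_upwards [self_mem_nhdsWithin] with h hh
  have hh : 0 < h := hh
  rw [S.apply_integral z hh.le ht, S.integral_max z ht (by linarith), S.integral_max z le_rfl hh.le,
    ← smul_sub]
  congr 1
  have i1 := S.intervalIntegrable z (le_refl (0 : ℝ)) ht
  have i2 := S.intervalIntegrable z ht (by linarith : 0 ≤ t + h)
  have i3 := S.intervalIntegrable z (le_refl (0 : ℝ)) hh.le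
  have i4 := S.intervalIntegrable z hh.le (by linarith : 0 ≤ t + h)
  have a1 := intervalIntegral.integral_add_adjacent_intervals i1 i2
  have a2 := intervalIntegral.integral_add_adjacent_intervals i3 i4
  have a3 : (∫ s in (0 : ℝ)..t, S.toFun s z) + (∫ s in t..t + h, S.toFun s z) =
    (∫ s in (0 : ℝ)..h, S.toFun s z) + ∫ s in h..t + h, S.toFun s z := a1.trans a2.symm
  rw [sub_eq_sub_iff_add_eq_add, add_comm, a3, add_comm]

/-- The generator commutes with the semigroup. -/
theorem C0Semigroup.HasGen.apply {S : C0Semigroup E} {x y : E} (h : S.HasGen x y) {t : ℝ}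
    (ht : 0 ≤ t) : S.HasGen (S.toFun t x) (S.toFun t y) := by
  refine (((S.toFun t).continuous.tendsto y).comp h).congr' ?_
  filter_upwards [self_mem_nhdsWithin] with s hs
  have hs : 0 < s := hs
  simp only [Function.comp, map_smul, map_sub]
  rw [← S.apply_add ht hs.le, ← S.apply_add hs.le ht, add_comm]

theorem C0Semigroup.HasGen.hasDerivWithinAt {S : C0Semigroup E} {x y : E} (h : S.HasGen x y)
    {t : ℝ} (ht : 0 ≤ t) :
    HasDerivWithinAt (fun s => S.toFun s x) (S.toFun t y) (Ici t) t := by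
  rw [← hasDerivWithinAt_Ioi_iff_Ici, hasDerivWithinAt_iff_tendsto_slope'
    (by simp : t ∉ Ioi t)]
  have h1 := ((S.toFun t).continuous.tendsto y).comp h
  have h2 : Tendsto (fun s : ℝ => s - t) (𝓝[>] t) (𝓝[>] 0) := by
    refine tendsto_nhdsWithin_iff.2 ⟨?_, ?_⟩
    · have : Tendsto (fun s : ℝ => s - t) (𝓝 t) (𝓝 (t - t)) :=
        (continuous_id.sub continuous_const).tendsto t
      rw [sub_self] at this
      exact this.mono_left nhdsWithin_le_nhds
    · filter_upwards [self_mem_nhdsWithin] with s hs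
      exact mem_Ioi.2 (sub_pos.2 (mem_Ioi.1 hs))
  refine (h1.comp h2).congr' ?_
  filter_upwards [self_mem_nhdsWithin] with s hs
  have hs : t < s := hs
  simp only [Function.comp, map_smul, map_sub, slope, vsub_eq_sub]
  rw [← S.apply_add ht (sub_pos.2 hs).le, add_sub_cancel]

/-- Existence of some generated semigroup excludes the default value in `semigroupOf`. This is how
the chosen semigroup is related to its generator. -/
theorem semigroupOf_hasGen_iff {B : E →ₗ.[ℝ] E} (h : ∃ S : C0Semigroup E, S.IsGeneratedBy B)
    (x y : E) : (semigroupOf B).HasGen x y ↔ (x, y) ∈ B.graph := by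
  have : (semigroupOf B).IsGeneratedBy B := by
    rw [semigroupOf, dif_pos h]
    exact h.choose_spec
  exact (this x y).symm

end SemigroupGeneral

/-! ### Bounded perturbations of bounded semigroups -/

section Perturbation

open scoped BoundedContinuousFunction

variable {E : Type*} [NormedAddCommGroup E] [NormedSpace ℝ E]

/-- `f ↦ ∫₀ᵗ exp (-ω (t - s)) S(t - s) B f(s) ds`, extended to `t < 0` by its value at `0`. -/
noncomputable def C0Semigroup.duhamelFun (S : C0Semigroup E) (B : E →L[ℝ] E) (ω : ℝ) (f : ℝ → E)
    (t : ℝ) : E :=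
  ∫ s in (0 : ℝ)..max t 0, Real.exp (-ω * (max t 0 - s)) • S.toFun (max (max t 0 - s) 0) (B (f s))

variable (S : C0Semigroup E) (B : E →L[ℝ] E)

/-- The exponential weight integrates to at most 1 / ω, so a large ω makes the Duhamel operator a
contraction on the whole half-line at once. -/
theorem C0Semigroup.norm_duhamelFun_le {M : ℝ} (hM : ∀ t, 0 ≤ t → ‖S.toFun t‖ ≤ M) {ω : ℝ}
    (hω : 0 < ω) {f : ℝ → E} {C : ℝ} (hC : ∀ s, ‖f s‖ ≤ C) (t : ℝ) :
    ‖S.duhamelFun B ω f t‖ ≤ M * ‖B‖ / ω * C := by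
  have hM0 : 0 ≤ M := (norm_nonneg _).trans (hM 0 le_rfl)
  have hC0 : 0 ≤ C := (norm_nonneg _).trans (hC 0)
  set m := max t 0 with hm
  have hm0 : 0 ≤ m := le_max_right _ _
  have hint : ∫ s in (0 : ℝ)..m, Real.exp (-ω * (m - s)) = (1 - Real.exp (-ω * m)) / ω := by
    have hd : ∀ s ∈ uIcc 0 m, HasDerivAt (fun s => Real.exp (-ω * (m - s)) / ω)
        (Real.exp (-ω * (m - s))) s := by
      intro s _
      have h1 : HasDerivAt (fun s => -ω * (m - s)) ω s := by
        have := ((hasDerivAt_id s).const_sub m).const_mul (-ω)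
        simpa using this
      have := (h1.exp).div_const ω
      rwa [mul_div_assoc, div_self hω.ne', mul_one] at this
    rw [intervalIntegral.integral_eq_sub_of_hasDerivAt hd
      (Continuous.intervalIntegrable (by fun_prop) _ _)]
    simp [sub_div]
  have h1 : ‖S.duhamelFun B ω f t‖ ≤
      ∫ s in (0 : ℝ)..m, M * ‖B‖ * C * Real.exp (-ω * (m - s)) := by
    refine intervalIntegral.norm_integral_le_of_norm_le hm0 ?_
      (Continuous.intervalIntegrable (by fun_prop) _ _)
    refine Eventually.of_forall fun s _ => ?_
    rw [norm_smul, Real.norm_eq_abs, abs_of_pos (Real.exp_pos _), mul_comm]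
    refine mul_le_mul_of_nonneg_right ?_ (Real.exp_pos _).le
    calc ‖S.toFun (max (m - s) 0) (B (f s))‖ ≤ M * ‖B (f s)‖ :=
          (S.toFun _).le_of_opNorm_le (hM _ (le_max_right _ _)) _
      _ ≤ M * (‖B‖ * C) := by
          gcongr
          exact B.le_opNorm_of_le (hC s)
      _ = _ := by ring
  refine h1.trans ?_
  rw [intervalIntegral.integral_const_mul, hint]
  have : (1 - Real.exp (-ω * m)) / ω ≤ 1 / ω := by
    gcongr
    linarith [Real.exp_pos (-ω * m)]
  calc M * ‖B‖ * C * ((1 - Real.exp (-ω * m)) / ω) ≤ M * ‖B‖ * C * (1 / ω) := by gcongr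
    _ = _ := by ring

variable [CompleteSpace E]

theorem C0Semigroup.continuous_duhamel_integrand (ω : ℝ) {f : ℝ → E} (hf : Continuous f) :
    Continuous fun p : ℝ × ℝ =>
      Real.exp (-ω * (max p.1 0 - p.2)) • S.toFun (max (max p.1 0 - p.2) 0) (B (f p.2)) := by
  have h : Continuous fun p : ℝ × ℝ => ((max p.1 0 - p.2, B (f p.2)) : ℝ × E) := by fun_prop
  have h2 : Continuous fun p : ℝ × ℝ => S.toFun (max (max p.1 0 - p.2) 0) (B (f p.2)) :=
    S.continuous_max_prod.comp h
  exact Continuous.smul (by fun_prop) h2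

theorem C0Semigroup.continuous_duhamelFun (ω : ℝ) {f : ℝ → E} (hf : Continuous f) :
    Continuous (S.duhamelFun B ω f) :=
  intervalIntegral.continuous_parametric_intervalIntegral_of_continuous
    (f := fun t s => Real.exp (-ω * (max t 0 - s)) • S.toFun (max (max t 0 - s) 0) (B (f s)))
    (S.continuous_duhamel_integrand B ω hf) (by fun_prop)

theorem C0Semigroup.intervalIntegrable_duhamel (ω : ℝ) {f : ℝ → E} (hf : Continuous f)
    (t a b : ℝ) : IntervalIntegrable (fun s =>
      Real.exp (-ω * (max t 0 - s)) • S.toFun (max (max t 0 - s) 0) (B (f s))) volume a b := by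
  refine Continuous.intervalIntegrable ?_ _ _
  exact (S.continuous_duhamel_integrand B ω hf).comp (by fun_prop : Continuous fun s : ℝ => (t, s))

variable {M : ℝ} (hM : ∀ t, 0 ≤ t → ‖S.toFun t‖ ≤ M)

/-- The Duhamel operator on bounded continuous functions. -/
noncomputable def C0Semigroup.duhamel {ω : ℝ} (hω : 0 < ω) : (ℝ →ᵇ E) →L[ℝ] (ℝ →ᵇ E) :=
  LinearMap.mkContinuous
    { toFun := fun f => BoundedContinuousFunction.ofNormedAddCommGroup (S.duhamelFun B ω f)
        (S.continuous_duhamelFun B ω f.continuous) _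
        (S.norm_duhamelFun_le B hM hω f.norm_coe_le_norm)
      map_add' := fun f g => by
        ext t
        simp only [BoundedContinuousFunction.coe_ofNormedAddCommGroup,
          BoundedContinuousFunction.coe_add, Pi.add_apply, duhamelFun, map_add, smul_add]
        exact intervalIntegral.integral_add
          (S.intervalIntegrable_duhamel B ω f.continuous t _ _)
          (S.intervalIntegrable_duhamel B ω g.continuous t _ _)
      map_smul' := fun r f => by
        ext t
        simp only [BoundedContinuousFunction.coe_ofNormedAddCommGroup,
          BoundedContinuousFunction.coe_smul, duhamelFun, map_smul, RingHom.id_apply]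
        rw [← intervalIntegral.integral_smul]
        simp only [smul_comm r] }
    (M * ‖B‖ / ω) (fun f => by
      have hM0 : 0 ≤ M := (norm_nonneg _).trans (hM 0 le_rfl)
      exact BoundedContinuousFunction.norm_ofNormedAddCommGroup_le _ (by positivity)
        (S.norm_duhamelFun_le B hM hω f.norm_coe_le_norm))

theorem C0Semigroup.duhamel_apply {ω : ℝ} (hω : 0 < ω) (f : ℝ →ᵇ E) (t : ℝ) :
    S.duhamel B hM hω f t = S.duhamelFun B ω f t := rfl

theorem C0Semigroup.norm_duhamel_le {ω : ℝ} (hω : 0 < ω) :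
    ‖S.duhamel B hM hω‖ ≤ M * ‖B‖ / ω := by
  have hM0 : 0 ≤ M := (norm_nonneg _).trans (hM 0 le_rfl)
  exact LinearMap.mkContinuous_norm_le _ (by positivity) _

/-- The orbit `t ↦ exp (-ω t) S(t) z`, extended to `t < 0` by `z`. -/
noncomputable def C0Semigroup.orbit {ω : ℝ} (hω : 0 < ω) : E →L[ℝ] (ℝ →ᵇ E) :=
  have hb : ∀ z t, ‖Real.exp (-ω * max t 0) • S.toFun (max t 0) z‖ ≤ M * ‖z‖ := fun z t => by
    have hM0 : 0 ≤ M := (norm_nonneg _).trans (hM 0 le_rfl)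
    rw [norm_smul, Real.norm_eq_abs, abs_of_pos (Real.exp_pos _)]
    have h1 : Real.exp (-ω * max t 0) ≤ 1 := by
      rw [Real.exp_le_one_iff]
      have := le_max_right t 0
      nlinarith
    calc _ ≤ 1 * (M * ‖z‖) := by
          gcongr
          exact (S.toFun _).le_of_opNorm_le (hM _ (le_max_right _ _)) _
      _ = _ := one_mul _
  LinearMap.mkContinuous
    { toFun := fun z => BoundedContinuousFunction.ofNormedAddCommGroup
        (fun t => Real.exp (-ω * max t 0) • S.toFun (max t 0) z)
        (by have := S.continuous_max z; fun_prop) _ (hb z)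
      map_add' := fun x y => by ext t; simp
      map_smul' := fun r x => by ext t; simp [smul_comm r] }
    M (fun z => by
      have hM0 : 0 ≤ M := (norm_nonneg _).trans (hM 0 le_rfl)
      exact BoundedContinuousFunction.norm_ofNormedAddCommGroup_le _ (by positivity) (hb z))

theorem C0Semigroup.orbit_apply {ω : ℝ} (hω : 0 < ω) (z : E) (t : ℝ) :
    S.orbit hM hω z t = Real.exp (-ω * max t 0) • S.toFun (max t 0) z := rfl

/-- The mild form of `V' = (G + B) V` is uniquely solvable, with bounded dependence on the data:
there are `V(t)` such that `V(·) z` is the only exponentially bounded solution. -/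
theorem C0Semigroup.exists_mild (S : C0Semigroup E) (B : E →L[ℝ] E) {M : ℝ}
    (hM : ∀ t, 0 ≤ t → ‖S.toFun t‖ ≤ M) :
    ∃ (V : ℝ → E →L[ℝ] E) (ω : ℝ), 0 < ω ∧ (∀ z, Continuous fun t => V t z) ∧
      (∀ z, ∃ C, ∀ t, 0 ≤ t → ‖V t z‖ ≤ C * Real.exp (ω * t)) ∧
      (∀ z t, 0 ≤ t → V t z = S.toFun t z +
        ∫ s in (0 : ℝ)..t, S.toFun (max (t - s) 0) (B (V s z))) ∧
      (∀ u : ℝ → E, Continuous u → (∃ C, ∀ t, 0 ≤ t → ‖u t‖ ≤ C * Real.exp (ω * t)) →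
        (∀ t, 0 ≤ t → u t = S.toFun t (u 0) +
          ∫ s in (0 : ℝ)..t, S.toFun (max (t - s) 0) (B (u s))) →
        ∀ t, 0 ≤ t → u t = V t (u 0)) := by
  have hM0 : 0 ≤ M := (norm_nonneg _).trans (hM 0 le_rfl)
  -- With this weight M ‖B‖ / ω < 1, so 1 - Φ is invertible by a Neumann series.
  set ω := 2 * (M * ‖B‖) + 1 with hωd
  have hω : 0 < ω := by positivity
  set Φ := S.duhamel B hM hω with hΦ
  have hΦ1 : ‖Φ‖ < 1 := by
    refine (S.norm_duhamel_le B hM hω).trans_lt ?_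
    rw [div_lt_one hω]
    have : 0 ≤ M * ‖B‖ := by positivity
    linarith
  obtain ⟨W, hW⟩ := isUnit_one_sub_of_norm_lt_one hΦ1
  have hW1 : ∀ f, W.inv f - Φ (W.inv f) = f := fun f => by
    have : ((1 - Φ) * W.inv) f = f := by rw [← hW]; simp
    simpa using this
  have hW2 : ∀ f, W.inv (f - Φ f) = f := fun f => by
    have : (W.inv * (1 - Φ)) f = f := by rw [← hW]; simp
    simpa using this
  set σ := S.orbit hM hω with hσ
  let V : ℝ → E →L[ℝ] E := fun t => Real.exp (ω * t) •
    ((BoundedContinuousFunction.evalCLM ℝ t).comp (W.inv.comp σ))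
  have hV : ∀ t z, V t z = Real.exp (ω * t) • (W.inv (σ z)) t := fun t z => rfl
  -- Multiplication by exp (ω t) removes the weight and turns the fixed-point equation into the
  -- unweighted mild equation.
  have hscale : ∀ (f : ℝ → E) (t : ℝ), 0 ≤ t → Real.exp (ω * t) • S.duhamelFun B ω f t =
      ∫ s in (0 : ℝ)..t, S.toFun (max (t - s) 0) (B (Real.exp (ω * s) • f s)) := by
    intro f t ht
    rw [duhamelFun, max_eq_left ht, ← intervalIntegral.integral_smul]
    refine intervalIntegral.integral_congr fun s _ => ?_
    simp only [map_smul, smul_smul, ← Real.exp_add]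
    congr 2
    ring
  refine ⟨V, ω, hω, fun z => ?_, fun z => ⟨‖W.inv (σ z)‖, fun t _ => ?_⟩, fun z t ht => ?_,
    fun u hu ⟨C, hC⟩ hmild t ht => ?_⟩
  · simp only [hV]
    exact Continuous.smul (by fun_prop) (W.inv (σ z)).continuous
  · rw [hV, norm_smul, Real.norm_eq_abs, abs_of_pos (Real.exp_pos _), mul_comm]
    gcongr
    exact BoundedContinuousFunction.norm_coe_le_norm _ t
  · have h := congrArg (fun f : ℝ →ᵇ E => f t) (sub_eq_iff_eq_add.1 (hW1 (σ z)))
    simp only [BoundedContinuousFunction.coe_add, Pi.add_apply] at h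
    have hσt : σ z t = Real.exp (-ω * t) • S.toFun t z := by
      rw [hσ, S.orbit_apply, max_eq_left ht]
    rw [hV, h, smul_add, hΦ, S.duhamel_apply, hscale _ t ht, hσt, smul_smul, ← Real.exp_add]
    simp [hV]
  · have hC0 : 0 ≤ C := by
      have := (norm_nonneg _).trans (hC 0 le_rfl)
      simpa using this
    let f : ℝ →ᵇ E := BoundedContinuousFunction.ofNormedAddCommGroup
      (fun t => Real.exp (-ω * max t 0) • u (max t 0)) (by fun_prop) C (fun t => by
        rw [norm_smul, Real.norm_eq_abs, abs_of_pos (Real.exp_pos _)]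
        calc _ ≤ Real.exp (-ω * max t 0) * (C * Real.exp (ω * max t 0)) := by
              gcongr
              exact hC _ (le_max_right _ _)
          _ = C * (Real.exp (-ω * max t 0) * Real.exp (ω * max t 0)) := by ring
          _ = C := by rw [← Real.exp_add]; simp)
    have hf : ∀ t, f t = Real.exp (-ω * max t 0) • u (max t 0) := fun t => rfl
    have hfu : ∀ t, 0 ≤ t → Real.exp (ω * t) • f t = u t := fun t ht => by
      rw [hf, max_eq_left ht, smul_smul, ← Real.exp_add]
      simp
    -- The weighted `u` is bounded and solves the same fixed-point equation, so inverting 1 - Φ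
    -- gives uniqueness. All terms are constant for t < 0, which reduces the check to `max t 0`.
    have key : f - Φ f = σ (u 0) := by
      ext t
      have hm : 0 ≤ max t 0 := le_max_right _ _
      have h0 : ∀ g : ℝ → E, S.duhamelFun B ω g t = S.duhamelFun B ω g (max t 0) := by
        intro g; simp only [duhamelFun, max_eq_left hm]
      have hft : f t = f (max t 0) := by simp only [hf, max_eq_left hm]
      have hσt : σ (u 0) t = σ (u 0) (max t 0) := by
        simp only [hσ, S.orbit_apply, max_eq_left hm]
      have hΦt : Φ f t = S.duhamelFun B ω f t := rfl
      rw [BoundedContinuousFunction.coe_sub, Pi.sub_apply, hft, hσt, hΦt, h0]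
      generalize max t 0 = r at hm
      have e1 : Real.exp (ω * r) • (f r - S.duhamelFun B ω f r) =
          Real.exp (ω * r) • σ (u 0) r := by
        rw [smul_sub, hfu r hm, hscale _ r hm, hσ, S.orbit_apply, max_eq_left hm, smul_smul,
          ← Real.exp_add, hmild r hm]
        have : ∫ s in (0 : ℝ)..r, S.toFun (max (r - s) 0) (B (Real.exp (ω * s) • f s)) =
            ∫ s in (0 : ℝ)..r, S.toFun (max (r - s) 0) (B (u s)) := by
          refine intervalIntegral.integral_congr fun s hs => ?_
          rw [uIcc_of_le hm] at hs
          simp only [hfu s hs.1]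
        rw [this]
        simp
      exact smul_right_injective _ (Real.exp_pos _).ne' e1
    rw [hV, ← key, hW2, hfu t ht]

/-- Bounded perturbations of generators of bounded `C₀` semigroups are generators. -/
theorem C0Semigroup.exists_perturbation (S : C0Semigroup E) (B : E →L[ℝ] E) {M : ℝ}
    (hM : ∀ t, 0 ≤ t → ‖S.toFun t‖ ≤ M) :
    ∃ V : C0Semigroup E, ∀ x y, V.HasGen x y ↔ S.HasGen x (y - B x) := by
  obtain ⟨V, ω, hω, hVc, hVb, hVm, hVu⟩ := S.exists_mild B hM
  have hV0 : ∀ z, V 0 z = z := fun z => by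
    have := hVm z 0 le_rfl
    simpa [S.apply_zero] using this
  have hcont : ∀ z, Continuous fun p : ℝ × ℝ => S.toFun (max (p.1 - p.2) 0) (B (V p.2 z)) := by
    intro z
    have h1 : Continuous fun p : ℝ × ℝ => ((p.1 - p.2, B (V p.2 z)) : ℝ × E) := by
      have := (hVc z).comp (continuous_snd (X := ℝ) (Y := ℝ))
      have h2 : Continuous fun p : ℝ × ℝ => V p.2 z := this
      fun_prop
    exact S.continuous_max_prod.comp h1
  have hII : ∀ z t a b, IntervalIntegrable (fun s => S.toFun (max (t - s) 0) (B (V s z)))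
      volume a b := fun z t a b =>
    ((hcont z).comp (by fun_prop : Continuous fun s : ℝ => (t, s))).intervalIntegrable _ _
  -- The semigroup law is uniqueness applied to the shifted solution t ↦ V (t + r) z, which starts
  -- at V r z.
  have hadd : ∀ t r, 0 ≤ t → 0 ≤ r → V (t + r) = (V t).comp (V r) := by
    intro t r ht hr
    ext z
    have hu := hVu (fun t => V (t + r) z) ((hVc z).comp (by fun_prop)) ?_ ?_ t ht
    · simpa using hu
    · obtain ⟨C, hC⟩ := hVb z
      refine ⟨C * Real.exp (ω * r), fun t ht => (hC _ (by linarith)).trans_eq ?_⟩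
      rw [mul_assoc, ← Real.exp_add]
      ring_nf
    · intro t ht
      simp only [zero_add]
      rw [hVm z (t + r) (by linarith), S.apply_add ht hr, hVm z r hr, map_add, add_assoc]
      congr 1
      rw [← intervalIntegral.integral_add_adjacent_intervals (hII z (t + r) 0 r)
        (hII z (t + r) r (t + r))]
      congr 1
      · rw [← ContinuousLinearMap.intervalIntegral_comp_comm _ (hII z r 0 r)]
        refine intervalIntegral.integral_congr fun s hs => ?_
        rw [uIcc_of_le hr] at hs
        rw [max_eq_left (by linarith [hs.2] : 0 ≤ r - s),
          max_eq_left (by linarith [hs.2] : 0 ≤ t + r - s), add_sub_assoc,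
          S.apply_add ht (by linarith [hs.2])]
      · have := intervalIntegral.integral_comp_add_right (a := 0) (b := t)
          (fun s => S.toFun (max (t + r - s) 0) (B (V s z))) r
        rw [zero_add] at this
        rw [← this]
        refine intervalIntegral.integral_congr fun s _ => ?_
        simp only [add_sub_add_right_eq_sub]
  refine ⟨⟨V, by ext z; simp [hV0], hadd, fun x => (hVc x).continuousOn⟩, fun x y => ?_⟩
  -- The integrand tends to B x as both times tend to 0, so the difference quotients of V and S
  -- differ by B x in the limit; the generators differ by B, with the same domain.
  have hlim : Tendsto (fun h : ℝ => h⁻¹ • ∫ s in (0 : ℝ)..h, S.toFun (max (h - s) 0) (B (V s x)))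
      (𝓝[>] 0) (𝓝 (B x)) := by
    rw [Metric.tendsto_nhdsWithin_nhds]
    intro ε hε
    have hc := (hcont x).tendsto (0, 0)
    simp only [sub_zero, max_self, S.apply_zero, hV0] at hc
    obtain ⟨δ, hδ, hδ2⟩ := Metric.tendsto_nhds_nhds.1 hc (ε / 2) (half_pos hε)
    refine ⟨δ, hδ, fun {h} hh hd => ?_⟩
    have hh : 0 < h := hh
    rw [dist_zero_right, Real.norm_eq_abs, abs_of_pos hh] at hd
    have e : h⁻¹ • (∫ s in (0 : ℝ)..h, S.toFun (max (h - s) 0) (B (V s x))) - B x =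
        h⁻¹ • ∫ s in (0 : ℝ)..h, (S.toFun (max (h - s) 0) (B (V s x)) - B x) := by
      rw [intervalIntegral.integral_sub (hII x h 0 h) intervalIntegrable_const, smul_sub]
      simp [smul_smul, hh.ne']
    rw [dist_eq_norm, e, norm_smul, norm_inv, Real.norm_eq_abs, abs_of_pos hh]
    have : ‖∫ s in (0 : ℝ)..h, (S.toFun (max (h - s) 0) (B (V s x)) - B x)‖ ≤
        ε / 2 * |h - 0| := by
      refine intervalIntegral.norm_integral_le_of_norm_le_const fun s hs => ?_
      rw [uIoc_of_le hh.le] at hs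
      rw [← dist_eq_norm]
      refine (hδ2 (x := (h, s)) ?_).le
      rw [Prod.dist_eq]
      simp only [dist_zero_right, Real.norm_eq_abs, abs_of_pos hh, abs_of_pos hs.1]
      exact max_lt hd (hs.2.trans_lt hd)
    rw [sub_zero, abs_of_pos hh] at this
    calc h⁻¹ * _ ≤ h⁻¹ * (ε / 2 * h) := by gcongr
      _ = ε / 2 := by field_simp
      _ < ε := half_lt_self hε
  have e : ∀ᶠ h : ℝ in 𝓝[>] 0, h⁻¹ • (V h x - x) = h⁻¹ • (S.toFun h x - x) +
      h⁻¹ • ∫ s in (0 : ℝ)..h, S.toFun (max (h - s) 0) (B (V s x)) := by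
    filter_upwards [self_mem_nhdsWithin] with h hh
    rw [hVm x h (le_of_lt hh), ← smul_add, add_sub_right_comm]
  unfold HasGen
  constructor
  · intro h
    refine (h.sub hlim).congr' ?_
    filter_upwards [e] with t ht
    simp only [ht, add_sub_cancel_right]
  · intro h
    have := h.add hlim
    rw [sub_add_cancel] at this
    refine this.congr' ?_
    filter_upwards [e] with t ht
    simp only [ht]

end Perturbation

/-! ### The scalar inverse Laplace integral -/

section ScalarIntegral

open FourierTransform

theorem integrableOn_mul_exp_neg_Ioi :
    IntegrableOn (fun t : ℝ => t * Real.exp (-t)) (Ioi 0) := by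
  refine (Real.GammaIntegral_convergent (s := 2) (by norm_num)).congr_fun (fun t _ => ?_)
    measurableSet_Ioi
  have e : (2 : ℝ) - 1 = 1 := by norm_num
  simp [e, mul_comm]

theorem integral_mul_exp_neg_mul_Ioi {r : ℂ} (hr : r.re = 1) :
    ∫ t : ℝ in Ioi 0, (t : ℂ) * Complex.exp (-(r * t)) = (r ^ 2)⁻¹ := by
  have hr0 : r ≠ 0 := fun h => by simp [h] at hr
  have hn : ∀ t : ℝ, ‖Complex.exp (-(r * t))‖ = Real.exp (-t) := fun t => by
    rw [Complex.norm_exp]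
    simp [hr]
  -- Explicit antiderivative, vanishing at infinity because Re r = 1.
  have hd : ∀ t ∈ Ioi (0 : ℝ), HasDerivAt
      (fun t : ℝ => -((t : ℂ) * r⁻¹ + (r ^ 2)⁻¹) * Complex.exp (-(r * t)))
      ((t : ℂ) * Complex.exp (-(r * t))) t := by
    intro t _
    have h1 : HasDerivAt (fun t : ℝ => (t : ℂ)) 1 t := Complex.ofRealCLM.hasDerivAt
    have h2 := ((h1.mul_const r⁻¹).add_const ((r ^ 2)⁻¹)).neg
    have h3 := ((h1.const_mul r).neg).cexp
    convert! h2.mul h3 using 1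
    simp only [Pi.neg_apply]
    field_simp
    ring
  have hI : IntegrableOn (fun t : ℝ => (t : ℂ) * Complex.exp (-(r * t))) (Ioi 0) := by
    refine integrableOn_mul_exp_neg_Ioi.mono' (by fun_prop) ?_
    filter_upwards [ae_restrict_mem measurableSet_Ioi] with t ht
    rw [norm_mul, hn, Complex.norm_real, Real.norm_eq_abs, abs_of_pos ht]
  have hlim : Tendsto (fun t : ℝ => -((t : ℂ) * r⁻¹ + (r ^ 2)⁻¹) * Complex.exp (-(r * t)))
      atTop (𝓝 0) := by
    have h1 := (Real.tendsto_pow_mul_exp_neg_atTop_nhds_zero 1).const_mul ‖r⁻¹‖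
    have h2 := (Real.tendsto_pow_mul_exp_neg_atTop_nhds_zero 0).const_mul ‖(r ^ 2)⁻¹‖
    have h3 := h1.add h2
    simp only [mul_zero, add_zero] at h3
    refine squeeze_zero_norm' ?_ h3
    filter_upwards [eventually_gt_atTop 0] with t ht
    rw [norm_mul, norm_neg, hn]
    have : ‖(t : ℂ) * r⁻¹ + (r ^ 2)⁻¹‖ ≤ t * ‖r⁻¹‖ + ‖(r ^ 2)⁻¹‖ := by
      refine (norm_add_le _ _).trans_eq ?_
      rw [norm_mul, Complex.norm_real, Real.norm_eq_abs, abs_of_pos ht]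
    calc _ ≤ (t * ‖r⁻¹‖ + ‖(r ^ 2)⁻¹‖) * Real.exp (-t) := by gcongr
      _ = _ := by ring
  rw [integral_Ioi_of_hasDerivAt_of_tendsto (Continuous.continuousWithinAt (by fun_prop)) hd hI
    hlim]
  simp

/-- The inverse Laplace transform of `z ↦ z⁻²` at `1`. -/
theorem integral_exp_div_sq :
    ∫ s : ℝ, Complex.exp (1 + s * Complex.I) * ((1 + s * Complex.I) ^ 2)⁻¹ = 2 * Real.pi := by
  -- The continuous function t exp (-t) on t > 0, extended by 0, has Fourier transform (1 + 2πiξ)⁻²;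
  -- the value comes from Fourier inversion at t = 1.
  let f : ℝ → ℂ := fun t => ((max t 0 : ℝ) : ℂ) * Complex.exp (-t)
  have hfc : Continuous f := by
    have : Continuous fun t : ℝ => ((max t 0 : ℝ) : ℂ) :=
      Complex.continuous_ofReal.comp (by fun_prop)
    exact this.mul (by fun_prop)
  have hf0 : ∀ g : ℝ → ℂ, ∀ t ∉ Ioi (0 : ℝ), g t * f t = 0 := fun g t ht => by
    have : max t 0 = 0 := max_eq_right (not_lt.1 ht)
    simp [f, this]
  have hint : Integrable f := by
    have h2 : IntegrableOn f (Ioi 0) := by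
      have h3 : IntegrableOn (fun t : ℝ => ((t * Real.exp (-t) : ℝ) : ℂ)) (Ioi 0) :=
        integrableOn_mul_exp_neg_Ioi.ofReal (𝕜 := ℂ)
      refine h3.congr_fun (fun t ht => ?_) measurableSet_Ioi
      have : max t 0 = t := max_eq_left (le_of_lt ht)
      simp [f, this]
    refine (integrableOn_iff_integrable_of_support_subset fun t ht => ?_).1 h2
    by_contra h
    exact ht (by simpa using hf0 1 t h)
  have hF : ∀ ξ : ℝ, 𝓕 f ξ = ((1 + ((2 * Real.pi * ξ : ℝ) : ℂ) * Complex.I) ^ 2)⁻¹ := by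
    intro ξ
    rw [Real.fourier_real_eq_integral_exp_smul,
      ← integral_mul_exp_neg_mul_Ioi (r := 1 + ((2 * Real.pi * ξ : ℝ) : ℂ) * Complex.I) (by simp),
      ← setIntegral_eq_integral_of_forall_compl_eq_zero (s := Ioi (0 : ℝ))
        (fun t ht => by simpa using hf0 (fun t =>
          Complex.exp (((-2 * Real.pi * t * ξ : ℝ) : ℂ) * Complex.I)) t ht)]
    refine setIntegral_congr_fun measurableSet_Ioi fun t ht => ?_
    have : max t 0 = t := max_eq_left (le_of_lt ht)
    simp only [f, this, smul_eq_mul]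
    rw [mul_left_comm, ← Complex.exp_add]
    congr 2
    push_cast
    ring
  have hnorm : ∀ s : ℝ, ‖((1 + (s : ℂ) * Complex.I) ^ 2)⁻¹‖ = (1 + s ^ 2)⁻¹ := by
    intro s
    rw [norm_inv, norm_pow, ← Complex.normSq_eq_norm_sq, Complex.normSq_apply]
    congr 1
    simp
    ring
  have hcont : Continuous fun s : ℝ => ((1 + (s : ℂ) * Complex.I) ^ 2)⁻¹ := by
    refine Continuous.inv₀ (by fun_prop) fun s h => ?_
    have h2 := hnorm s
    rw [h, inv_zero, norm_zero] at h2
    have : 0 < (1 + s ^ 2)⁻¹ := by positivity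
    linarith
  have hI : Integrable fun s : ℝ => ((1 + (s : ℂ) * Complex.I) ^ 2)⁻¹ := by
    refine integrable_inv_one_add_sq.mono' hcont.aestronglyMeasurable
      (Eventually.of_forall fun s => (hnorm s).le)
  have hFi : Integrable (𝓕 f) := by
    have e : 𝓕 f = fun ξ : ℝ => ((1 + ((2 * Real.pi * ξ : ℝ) : ℂ) * Complex.I) ^ 2)⁻¹ := funext hF
    rw [e]
    exact hI.comp_mul_left' (by positivity)
  have hinv := congrFun (hfc.fourierInv_fourier_eq hint hFi) 1
  rw [Real.fourierInv_eq'] at hinv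
  have e1 : ∀ v : ℝ, Complex.exp (((2 * Real.pi * inner ℝ v 1 : ℝ) : ℂ) * Complex.I) • 𝓕 f v =
      (fun s : ℝ => Complex.exp (s * Complex.I) * ((1 + (s : ℂ) * Complex.I) ^ 2)⁻¹)
        (2 * Real.pi * v) := by
    intro v
    rw [hF]
    simp
  simp_rw [e1] at hinv
  rw [Measure.integral_comp_mul_left (fun s : ℝ =>
    Complex.exp (s * Complex.I) * ((1 + (s : ℂ) * Complex.I) ^ 2)⁻¹)] at hinv
  have e2 : ∀ s : ℝ, Complex.exp (1 + s * Complex.I) * ((1 + s * Complex.I) ^ 2)⁻¹ =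
      Complex.exp 1 * (Complex.exp (s * Complex.I) * ((1 + (s : ℂ) * Complex.I) ^ 2)⁻¹) := by
    intro s
    rw [Complex.exp_add, mul_assoc]
  simp_rw [e2]
  rw [integral_const_mul]
  have hpi : 0 < 2 * Real.pi := by positivity
  rw [abs_of_pos (inv_pos.2 hpi), inv_smul_eq_iff₀ hpi.ne'] at hinv
  rw [hinv]
  have hm : max (1 : ℝ) 0 = 1 := max_eq_left zero_le_one
  simp only [f, hm]
  rw [Complex.real_smul, mul_left_comm, Complex.ofReal_one, one_mul, ← Complex.exp_add]
  simp

end ScalarIntegral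

/-! ### The inverse Laplace integral of the squared resolvent in a Banach algebra -/

section LineIntegral

variable {𝓐 : Type*} [NormedRing 𝓐] [NormedAlgebra ℝ 𝓐]

/-- The vertical line `Re z = 1`. -/
noncomputable def line (s : ℝ) : ℂ := 1 + s * Complex.I

theorem line_re (s : ℝ) : (line s).re = 1 := by simp [line]

theorem line_ne_zero (s : ℝ) : line s ≠ 0 := fun h => by
  have := line_re s
  simp [h] at this

theorem norm_line_sq (s : ℝ) : ‖line s‖ ^ 2 = 1 + s ^ 2 := by
  rw [← Complex.normSq_eq_norm_sq, Complex.normSq_apply]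
  simp [line]
  ring

theorem norm_line_pos (s : ℝ) : 0 < ‖line s‖ := norm_pos_iff.2 (line_ne_zero s)

theorem one_le_norm_line (s : ℝ) : 1 ≤ ‖line s‖ := by
  have h := norm_line_sq s
  nlinarith [norm_nonneg (line s), sq_nonneg s]

theorem hasDerivAt_line (s : ℝ) : HasDerivAt line Complex.I s := by
  have h1 : HasDerivAt (fun t : ℝ => (t : ℂ)) 1 s := Complex.ofRealCLM.hasDerivAt
  exact ((h1.mul_const Complex.I).const_add 1).congr_deriv (one_mul _)

/-- A family `ν k + t`, `Re ν = 1`, `t > 0`, of invertible elements of a real Banach algebra that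
contains the complex scalars, with the bounds that a sectorial operator with inverse `k` gives. -/
structure SectorData (φ : ℂ →ₐ[ℝ] 𝓐) (k : 𝓐) (C M : ℝ) : Prop where
  comm : ∀ z, Commute (φ z) k
  norm_scalar : ∀ z, ‖φ z‖ ≤ C * ‖z‖
  isUnit : ∀ t : ℝ, 0 < t → ∀ s, IsUnit (φ (line s) * k + algebraMap ℝ 𝓐 t)
  norm_le : ∀ t : ℝ, 0 < t → ∀ s,
    ‖k * Ring.inverse (φ (line s) * k + algebraMap ℝ 𝓐 t)‖ ≤ M / ‖line s‖
  norm_le' : ∀ t : ℝ, 0 < t → ∀ s,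
    ‖k * Ring.inverse (φ (line s) * k + algebraMap ℝ 𝓐 t)‖ ≤ M / t

variable (φ : ℂ →ₐ[ℝ] 𝓐) (k : 𝓐)

/-- `A (ν + t A)⁻¹` on the line, where `k = A⁻¹`. -/
noncomputable def lineInv (t s : ℝ) : 𝓐 := Ring.inverse (φ (line s) * k + algebraMap ℝ 𝓐 t)

/-- `(ν + t A)⁻¹` on the line, where `k = A⁻¹`. -/
noncomputable def lineRes (t s : ℝ) : 𝓐 := k * lineInv φ k t s

/-- `exp ν` on the line. -/
noncomputable def lineExp (s : ℝ) : 𝓐 := φ (Complex.exp (line s))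

/-- The semigroup `(2 π)⁻¹ ∫ exp ν (ν + t A)⁻² dν`. -/
noncomputable def lineSemigroup (t : ℝ) : 𝓐 :=
  (2 * Real.pi)⁻¹ • ∫ s, lineExp φ s * lineRes φ k t s ^ 2

variable {φ k} {C M : ℝ}

namespace SectorData

theorem C_nonneg (h : SectorData φ k C M) : 0 ≤ C := by
  have := (norm_nonneg _).trans (h.norm_scalar 1)
  simpa using this

theorem M_nonneg (h : SectorData φ k C M) : 0 ≤ M := by
  have := (norm_nonneg _).trans (h.norm_le' 1 one_pos 0)
  simpa using this

theorem denom_mul_inv (h : SectorData φ k C M) {t : ℝ} (ht : 0 < t) (s : ℝ) :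
    (φ (line s) * k + algebraMap ℝ 𝓐 t) * lineInv φ k t s = 1 :=
  Ring.mul_inverse_cancel _ (h.isUnit t ht s)

theorem commute_inv (h : SectorData φ k C M) {t : ℝ} (ht : 0 < t) (s : ℝ) {a : 𝓐}
    (ha : Commute a (φ (line s) * k + algebraMap ℝ 𝓐 t)) : Commute a (lineInv φ k t s) := by
  obtain ⟨u, hu⟩ := h.isUnit t ht s
  rw [lineInv, ← hu, Ring.inverse_unit]
  rw [← hu] at ha
  exact ha.units_inv_right

theorem commute_scalar (h : SectorData φ k C M) (z : ℂ) (t s : ℝ) :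
    Commute (φ z) (φ (line s) * k + algebraMap ℝ 𝓐 t) := by
  refine Commute.add_right (Commute.mul_right ?_ (h.comm z)) (Algebra.commutes t (φ z)).symm
  rw [Commute, SemiconjBy, ← map_mul, ← map_mul, mul_comm]

theorem commute_scalar_inv (h : SectorData φ k C M) (z : ℂ) {t : ℝ} (ht : 0 < t) (s : ℝ) :
    Commute (φ z) (lineInv φ k t s) :=
  h.commute_inv ht s (h.commute_scalar z t s)

theorem commute_k_inv (h : SectorData φ k C M) {t : ℝ} (ht : 0 < t) (s : ℝ) :
    Commute k (lineInv φ k t s) :=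
  h.commute_inv ht s (((h.comm _).symm.mul_right (Commute.refl k)).add_right
    (Algebra.commutes t k).symm)

theorem commute_scalar_res (h : SectorData φ k C M) (z : ℂ) {t : ℝ} (ht : 0 < t) (s : ℝ) :
    Commute (φ z) (lineRes φ k t s) :=
  (h.comm z).mul_right (h.commute_scalar_inv z ht s)

theorem commute_k_res (h : SectorData φ k C M) {t : ℝ} (ht : 0 < t) (s : ℝ) :
    Commute k (lineRes φ k t s) :=
  (Commute.refl k).mul_right (h.commute_k_inv ht s)

theorem commute_inv_res (h : SectorData φ k C M) {t : ℝ} (ht : 0 < t) (s : ℝ) :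
    Commute (lineInv φ k t s) (lineRes φ k t s) :=
  (h.commute_k_inv ht s).symm.mul_right (Commute.refl _)

/-- `t A (ν + t A)⁻¹ = 1 - ν (ν + t A)⁻¹`. -/
theorem smul_inv (h : SectorData φ k C M) {t : ℝ} (ht : 0 < t) (s : ℝ) :
    t • lineInv φ k t s = 1 - φ (line s) * lineRes φ k t s := by
  have := h.denom_mul_inv ht s
  rw [add_mul, mul_assoc, ← Algebra.smul_def] at this
  exact eq_sub_of_add_eq' this

theorem norm_res_le (h : SectorData φ k C M) {t : ℝ} (ht : 0 < t) (s : ℝ) :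
    ‖lineRes φ k t s‖ ≤ M / ‖line s‖ := h.norm_le t ht s

theorem norm_res_le' (h : SectorData φ k C M) {t : ℝ} (ht : 0 < t) (s : ℝ) :
    ‖lineRes φ k t s‖ ≤ M / t := h.norm_le' t ht s

theorem norm_res_le_M (h : SectorData φ k C M) {t : ℝ} (ht : 0 < t) (s : ℝ) :
    ‖lineRes φ k t s‖ ≤ M :=
  (h.norm_res_le ht s).trans (div_le_self h.M_nonneg (one_le_norm_line s))

theorem norm_inv_le (h : SectorData φ k C M) {t : ℝ} (ht : 0 < t) (s : ℝ) :
    ‖lineInv φ k t s‖ ≤ (‖(1 : 𝓐)‖ + C * M) / t := by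
  have e : t * ‖lineInv φ k t s‖ = ‖t • lineInv φ k t s‖ := by
    rw [norm_smul, Real.norm_eq_abs, abs_of_pos ht]
  rw [le_div_iff₀ ht, mul_comm, e, h.smul_inv ht s]
  refine (norm_sub_le _ _).trans (add_le_add le_rfl ?_)
  refine (norm_mul_le _ _).trans ?_
  have hp := norm_line_pos s
  calc _ ≤ (C * ‖line s‖) * (M / ‖line s‖) := by
        gcongr
        · exact mul_nonneg h.C_nonneg hp.le
        · exact h.norm_scalar _
        · exact h.norm_res_le ht s
    _ = C * M := by field_simp

theorem norm_exp_le (h : SectorData φ k C M) (s : ℝ) :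
    ‖lineExp φ s‖ ≤ C * Real.exp 1 := by
  refine (h.norm_scalar _).trans_eq ?_
  rw [Complex.norm_exp, line_re]

/-- `exp 1 C M ^ 2 (1 + s²)⁻¹` bounds the integrands. -/
theorem norm_exp_mul_res_sq_le (h : SectorData φ k C M) {t : ℝ} (ht : 0 < t) (s : ℝ) :
    ‖lineExp φ s * lineRes φ k t s ^ 2‖ ≤ C * Real.exp 1 * M ^ 2 * (1 + s ^ 2)⁻¹ := by
  have hC := h.C_nonneg
  have hp := norm_line_pos s
  calc _ ≤ ‖lineExp φ s‖ * (‖lineRes φ k t s‖ * ‖lineRes φ k t s‖) := by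
        rw [sq]
        exact (norm_mul_le _ _).trans (by gcongr; exact norm_mul_le _ _)
    _ ≤ (C * Real.exp 1) * ((M / ‖line s‖) * (M / ‖line s‖)) := by
        gcongr
        · exact h.norm_exp_le s
        · exact div_nonneg h.M_nonneg hp.le
        · exact h.norm_res_le ht s
        · exact h.norm_res_le ht s
    _ = _ := by
        rw [← norm_line_sq]
        field_simp

theorem hasDerivAt_exp (h : SectorData φ k C M) (s : ℝ) :
    HasDerivAt (lineExp φ) (φ Complex.I * lineExp φ s) s := by
  have h1 := (hasDerivAt_line s).cexp
  let L : ℂ →L[ℝ] 𝓐 := φ.toLinearMap.mkContinuous C h.norm_scalar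
  have := (L.hasFDerivAt (x := Complex.exp (line s))).comp_hasDerivAt s h1
  refine this.congr_deriv ?_
  change φ (Complex.exp (line s) * Complex.I) = _
  rw [mul_comm, map_mul, lineExp]

theorem continuous_exp (h : SectorData φ k C M) : Continuous (lineExp φ) :=
  continuous_iff_continuousAt.2 fun s => (h.hasDerivAt_exp s).continuousAt

/-- Two resolvent factors already ensure integrability in s; the third stays free to be bounded by M
or by M / t. -/
theorem norm_exp_mul_res_cube_le (h : SectorData φ k C M) {t : ℝ} (ht : 0 < t) (s : ℝ) :
    ‖lineExp φ s * lineRes φ k t s ^ 3‖ ≤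
      C * Real.exp 1 * M ^ 2 * (1 + s ^ 2)⁻¹ * ‖lineRes φ k t s‖ := by
  rw [pow_succ, ← mul_assoc]
  refine (norm_mul_le _ _).trans ?_
  gcongr
  exact h.norm_exp_mul_res_sq_le ht s

theorem norm_lineSemigroup_le (h : SectorData φ k C M) {t : ℝ} (ht : 0 < t) :
    ‖lineSemigroup φ k t‖ ≤ C * Real.exp 1 * M ^ 2 := by
  have h1 : ‖∫ s, lineExp φ s * lineRes φ k t s ^ 2‖ ≤
      ∫ s : ℝ, C * Real.exp 1 * M ^ 2 * (1 + s ^ 2)⁻¹ :=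
    norm_integral_le_of_norm_le (integrable_inv_one_add_sq.const_mul _)
      (Eventually.of_forall fun s => h.norm_exp_mul_res_sq_le ht s)
  rw [integral_const_mul, integral_univ_inv_one_add_sq] at h1
  have hC := h.C_nonneg
  rw [lineSemigroup, norm_smul, norm_inv, Real.norm_eq_abs, abs_of_pos (by positivity),
    inv_mul_le_iff₀ (by positivity)]
  refine h1.trans ?_
  nlinarith [Real.pi_pos, show 0 ≤ C * Real.exp 1 * M ^ 2 * Real.pi by positivity]

variable [CompleteSpace 𝓐]

theorem hasDerivAt_ringInverse {f : ℝ → 𝓐} {f' : 𝓐} {t : ℝ} (hf : HasDerivAt f f' t)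
    (hu : IsUnit (f t)) : HasDerivAt (fun t => Ring.inverse (f t))
      (-(Ring.inverse (f t) * f' * Ring.inverse (f t))) t := by
  obtain ⟨u, hu⟩ := hu
  have h1 := hasFDerivAt_ringInverse (𝕜 := ℝ) u
  rw [hu] at h1
  refine (h1.comp_hasDerivAt t hf).congr_deriv ?_
  rw [← hu, Ring.inverse_unit]
  simp

theorem hasDerivAt_res (h : SectorData φ k C M) {t : ℝ} (ht : 0 < t) (s : ℝ) :
    HasDerivAt (fun s => lineRes φ k t s) (-(φ Complex.I * lineRes φ k t s ^ 2)) s := by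
  let L : ℂ →L[ℝ] 𝓐 := φ.toLinearMap.mkContinuous C h.norm_scalar
  have h1 : HasDerivAt (fun s => φ (line s)) (φ Complex.I) s :=
    (L.hasFDerivAt (x := line s)).comp_hasDerivAt s (hasDerivAt_line s)
  have h2 : HasDerivAt (fun s => φ (line s) * k + algebraMap ℝ 𝓐 t) (φ Complex.I * k) s :=
    (h1.mul_const k).add_const _
  have h3 := (hasDerivAt_ringInverse h2 (h.isUnit t ht s)).const_mul k
  refine h3.congr_deriv ?_
  change k * -(lineInv φ k t s * (φ Complex.I * k) * lineInv φ k t s) = _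
  rw [mul_neg, sq]
  congr 1
  rw [← mul_assoc (lineInv φ k t s), ← (h.commute_scalar_inv Complex.I ht s).eq, mul_assoc,
    mul_assoc, ← mul_assoc k, ← (h.comm Complex.I).eq, mul_assoc, ← mul_assoc k, lineRes]

/-- Differentiation in t produces the factor A (ν + tA)⁻¹, which is bounded by the resolvent bounds,
so no domain question arises. -/
theorem hasDerivAt_res_time (h : SectorData φ k C M) {t : ℝ} (ht : 0 < t) (s : ℝ) :
    HasDerivAt (fun t => lineRes φ k t s) (-(lineRes φ k t s * lineInv φ k t s)) t := by
  have h2 : HasDerivAt (fun t => φ (line s) * k + algebraMap ℝ 𝓐 t) 1 t := by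
    have : HasDerivAt (fun t : ℝ => algebraMap ℝ 𝓐 t) 1 t := by
      simp only [Algebra.algebraMap_eq_smul_one]
      simpa using (hasDerivAt_id t).smul_const (1 : 𝓐)
    exact this.const_add _
  have h3 := (hasDerivAt_ringInverse h2 (h.isUnit t ht s)).const_mul k
  refine h3.congr_deriv ?_
  change k * -(lineInv φ k t s * 1 * lineInv φ k t s) = _
  rw [mul_neg, mul_one, lineRes, mul_assoc]

theorem continuous_res (h : SectorData φ k C M) {t : ℝ} (ht : 0 < t) :
    Continuous fun s => lineRes φ k t s :=
  continuous_iff_continuousAt.2 fun s => (h.hasDerivAt_res ht s).continuousAt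

theorem continuous_inv (h : SectorData φ k C M) {t : ℝ} (ht : 0 < t) :
    Continuous fun s => lineInv φ k t s := by
  have e : (fun s => lineInv φ k t s) = fun s => t⁻¹ • (1 - φ (line s) * lineRes φ k t s) := by
    funext s
    rw [← h.smul_inv ht s, smul_smul, inv_mul_cancel₀ ht.ne', one_smul]
  let L : ℂ →L[ℝ] 𝓐 := φ.toLinearMap.mkContinuous C h.norm_scalar
  have h1 : Continuous fun s => φ (line s) :=
    L.continuous.comp (continuous_iff_continuousAt.2 fun s => (hasDerivAt_line s).continuousAt)
  rw [e]
  exact (continuous_const.sub (h1.mul (h.continuous_res ht))).const_smul _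

theorem integrable_sq (h : SectorData φ k C M) {t : ℝ} (ht : 0 < t) :
    Integrable fun s => lineExp φ s * lineRes φ k t s ^ 2 := by
  have h1 := h.continuous_exp
  have h2 := h.continuous_res ht
  exact (integrable_inv_one_add_sq.const_mul _).mono'
    (Continuous.aestronglyMeasurable (by fun_prop))
    (Eventually.of_forall fun s => h.norm_exp_mul_res_sq_le ht s)

theorem integrable_cube (h : SectorData φ k C M) {t : ℝ} (ht : 0 < t) :
    Integrable fun s => lineExp φ s * lineRes φ k t s ^ 3 := by
  have h1 := h.continuous_exp
  have h2 := h.continuous_res ht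
  have hC := h.C_nonneg
  refine ((integrable_inv_one_add_sq.const_mul (C * Real.exp 1 * M ^ 2)).mul_const M).mono'
    (Continuous.aestronglyMeasurable (by fun_prop))
    (Eventually.of_forall fun s => (h.norm_exp_mul_res_cube_le ht s).trans ?_)
  gcongr
  exact h.norm_res_le_M ht s

/-- Integration by parts along the line. -/
theorem integral_sq_eq (h : SectorData φ k C M) {t : ℝ} (ht : 0 < t) :
    ∫ s, lineExp φ s * lineRes φ k t s ^ 2 =
      (2 : ℝ) • ∫ s, lineExp φ s * lineRes φ k t s ^ 3 := by
  have hd : ∀ s, HasDerivAt (fun s => lineExp φ s * lineRes φ k t s ^ 2)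
      (φ Complex.I * (lineExp φ s * lineRes φ k t s ^ 2 -
        (2 : ℝ) • (lineExp φ s * lineRes φ k t s ^ 3))) s := by
    intro s
    have h2 := (h.hasDerivAt_res ht s).mul (h.hasDerivAt_res ht s)
    have h3 := (h.hasDerivAt_exp s).mul h2
    have e : (fun s => lineExp φ s * lineRes φ k t s ^ 2) =
        (lineExp φ * ((fun s => lineRes φ k t s) * fun s => lineRes φ k t s)) := by
      funext s
      simp [sq]
    rw [e]
    refine h3.congr_deriv ?_
    have c1 := (h.commute_scalar_res Complex.I ht s).eq
    have c2 : lineExp φ s * φ Complex.I = φ Complex.I * lineExp φ s := by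
      rw [lineExp, ← map_mul, ← map_mul, mul_comm]
    simp only [Pi.mul_apply]
    generalize lineRes φ k t s = N at *
    generalize lineExp φ s = e at *
    generalize φ Complex.I = j at *
    have e1 : -(j * N ^ 2) * N + N * -(j * N ^ 2) = -((2 : ℝ) • (j * N ^ 3)) := by
      have : N * (j * N ^ 2) = j * N ^ 3 := by rw [← mul_assoc, ← c1, mul_assoc, ← pow_succ']
      rw [mul_neg, this, neg_mul, mul_assoc, ← pow_succ, two_smul]
      abel
    rw [e1, mul_sub, mul_neg, mul_smul_comm, mul_smul_comm, ← mul_assoc e, c2, mul_assoc,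
      mul_assoc, sq, sub_eq_add_neg]
  have hc3 : Integrable fun s => (2 : ℝ) • (lineExp φ s * lineRes φ k t s ^ 3) :=
    (h.integrable_cube ht).smul (2 : ℝ)
  have hint := (h.integrable_sq ht).sub hc3
  have hbd : Tendsto (fun s : ℝ => C * Real.exp 1 * M ^ 2 * (1 + s ^ 2)⁻¹) (atTop ⊔ atBot)
      (𝓝 0) := by
    have h1 : Tendsto (fun s : ℝ => 1 + s ^ 2) (atTop ⊔ atBot) atTop := by
      refine tendsto_atTop_add_const_left _ _ (tendsto_sup.2 ⟨?_, ?_⟩)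
      · exact tendsto_pow_atTop two_ne_zero
      · simpa [Function.comp_def] using
          (tendsto_pow_atTop (α := ℝ) two_ne_zero).comp tendsto_neg_atBot_atTop
    simpa using (tendsto_inv_atTop_zero.comp h1).const_mul (C * Real.exp 1 * M ^ 2)
  have hlim := squeeze_zero_norm (fun s => h.norm_exp_mul_res_sq_le ht s) hbd
  have h0 := integral_of_hasDerivAt_of_tendsto hd (hint.const_mul _)
    (hlim.mono_left le_sup_right) (hlim.mono_left le_sup_left)
  have h1 : ∫ s, φ Complex.I * (lineExp φ s * lineRes φ k t s ^ 2 -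
      (2 : ℝ) • (lineExp φ s * lineRes φ k t s ^ 3)) =
      φ Complex.I * ∫ s, (lineExp φ s * lineRes φ k t s ^ 2 -
        (2 : ℝ) • (lineExp φ s * lineRes φ k t s ^ 3)) :=
    integral_const_mul_of_integrable hint
  rw [h1, sub_zero] at h0
  -- The derivative along the line carries the factor i, which is invertible and is cancelled here.
  have h2 := congrArg (fun x => φ (-Complex.I) * x) h0
  simp only [mul_zero, ← mul_assoc, ← map_mul] at h2
  rw [neg_mul, Complex.I_mul_I, neg_neg, map_one, one_mul, integral_sub (h.integrable_sq ht) hc3, integral_smul, sub_eq_zero] at h2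
  exact h2

/-- After the integration by parts there is a third resolvent to spend on the factor M / t. The
decay at infinity is needed for the integrals defining A^{-α}. -/
theorem norm_lineSemigroup_le' (h : SectorData φ k C M) {t : ℝ} (ht : 0 < t) :
    ‖lineSemigroup φ k t‖ ≤ C * Real.exp 1 * M ^ 3 / t := by
  have hC := h.C_nonneg
  have hM := h.M_nonneg
  have h1 : ‖∫ s, lineExp φ s * lineRes φ k t s ^ 3‖ ≤
      ∫ s : ℝ, C * Real.exp 1 * M ^ 2 * (1 + s ^ 2)⁻¹ * (M / t) :=
    norm_integral_le_of_norm_le ((integrable_inv_one_add_sq.const_mul _).mul_const _)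
      (Eventually.of_forall fun s => (h.norm_exp_mul_res_cube_le ht s).trans (by
        gcongr
        exact h.norm_res_le' ht s))
  rw [integral_mul_const, integral_const_mul, integral_univ_inv_one_add_sq] at h1
  rw [lineSemigroup, h.integral_sq_eq ht, smul_smul, norm_smul, mul_inv, mul_right_comm,
    inv_mul_cancel₀ two_ne_zero, one_mul, norm_inv, Real.norm_eq_abs,
    abs_of_pos Real.pi_pos, inv_mul_le_iff₀ Real.pi_pos]
  exact h1.trans_eq (by ring)

theorem commute_lineSemigroup (h : SectorData φ k C M) {t : ℝ} (ht : 0 < t) :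
    Commute k (lineSemigroup φ k t) := by
  refine Commute.smul_right ?_ _
  have h1 : ∫ s, k * (lineExp φ s * lineRes φ k t s ^ 2) =
      ∫ s, (lineExp φ s * lineRes φ k t s ^ 2) * k := by
    congr 1
    funext s
    exact ((h.comm _).symm.mul_right ((h.commute_k_res ht s).pow_right 2)).eq
  rw [Commute, SemiconjBy, ← integral_const_mul_of_integrable (h.integrable_sq ht), h1,
    integral_mul_const_of_integrable (h.integrable_sq ht)]

/-- `T' = -A T`, in the form `k T' = -T`. -/
theorem exists_hasDerivAt_lineSemigroup (h : SectorData φ k C M) {t : ℝ} (ht : 0 < t) :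
    ∃ T', HasDerivAt (lineSemigroup φ k) T' t ∧ k * T' = -lineSemigroup φ k t := by
  have hC := h.C_nonneg
  have hM := h.M_nonneg
  have h1 := h.continuous_exp
  let G : ℝ → ℝ → 𝓐 := fun t s => -(lineExp φ s * (lineRes φ k t s * lineInv φ k t s *
    lineRes φ k t s + lineRes φ k t s * (lineRes φ k t s * lineInv φ k t s)))
  have hd : ∀ t, 0 < t → ∀ s, HasDerivAt (fun t => lineExp φ s * lineRes φ k t s ^ 2)
      (G t s) t := by
    intro t ht s
    have h2 := (h.hasDerivAt_res_time ht s).mul (h.hasDerivAt_res_time ht s)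
    have e : (fun t => lineExp φ s * lineRes φ k t s ^ 2) = fun t => lineExp φ s *
        ((fun t => lineRes φ k t s) * fun t => lineRes φ k t s) t := by
      funext s
      simp [sq]
    rw [e]
    refine (h2.const_mul (lineExp φ s)).congr_deriv ?_
    simp only [G, neg_mul, mul_neg, ← neg_add]
  -- Multiplication by k = A⁻¹ turns the unwanted A (ν + tA)⁻¹ into one more resolvent; the
  -- integration by parts then turns the cubes back into squares.
  have hkG : ∀ s, k * G t s = -((2 : ℝ) • (lineExp φ s * lineRes φ k t s ^ 3)) := by
    intro s
    have c1 := (h.commute_k_res ht s).eq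
    have c2 : k * lineExp φ s = lineExp φ s * k := (h.comm _).eq.symm
    have c3 : k * lineInv φ k t s = lineRes φ k t s := rfl
    simp only [G]
    generalize lineRes φ k t s = N at *
    generalize lineInv φ k t s = E at *
    generalize lineExp φ s = e at *
    have e1 : k * (N * E * N) = N ^ 3 := by
      rw [← mul_assoc, ← mul_assoc, c1, mul_assoc N, c3]; noncomm_ring
    have e2 : k * (N * (N * E)) = N ^ 3 := by
      rw [← mul_assoc, c1, mul_assoc N, ← mul_assoc k, c1, mul_assoc N, c3]; noncomm_ring
    rw [mul_neg, ← mul_assoc, c2, mul_assoc, mul_add, e1, e2, two_smul, mul_add]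
  set D := 2 * (C * Real.exp 1 * M ^ 2 * ((‖(1 : 𝓐)‖ + C * M) / (t / 2))) with hD
  -- The factor A (ν + rA)⁻¹ is only O(1/r), so domination is sought for r > t / 2, away from 0.
  have hb : ∀ r ∈ Ioi (t / 2), ∀ s, ‖G r s‖ ≤ D * (1 + s ^ 2)⁻¹ := by
    intro r hr s
    have hr' : t / 2 < r := hr
    have hr0 : 0 < r := (half_pos ht).trans hr'
    have hp := norm_line_pos s
    have hE : ‖lineInv φ k r s‖ ≤ (‖(1 : 𝓐)‖ + C * M) / (t / 2) :=
      (h.norm_inv_le hr0 s).trans (by gcongr)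
    have e1 : G r s = -((2 : ℝ) • ((lineExp φ s * lineRes φ k r s ^ 2) * lineInv φ k r s)) := by
      have c := (h.commute_inv_res hr0 s).eq
      simp only [G]
      rw [mul_assoc (lineRes φ k r s), c, two_smul]
      noncomm_ring
    rw [e1, norm_neg, norm_smul, Real.norm_eq_abs, abs_of_pos two_pos, hD]
    calc _ ≤ 2 * ((C * Real.exp 1 * M ^ 2 * (1 + s ^ 2)⁻¹) *
          ((‖(1 : 𝓐)‖ + C * M) / (t / 2))) := by
          gcongr
          refine (norm_mul_le _ _).trans ?_
          gcongr
          exact h.norm_exp_mul_res_sq_le hr0 s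
      _ = _ := by ring
  have hGm : AEStronglyMeasurable (G t) volume := by
    have h2 := h.continuous_res ht
    have h3 := h.continuous_inv ht
    exact Continuous.aestronglyMeasurable (by fun_prop)
  have key := hasDerivAt_integral_of_dominated_loc_of_deriv_le (𝕜 := ℝ) (μ := volume)
    (F := fun t s => lineExp φ s * lineRes φ k t s ^ 2) (F' := G) (x₀ := t)
    (bound := fun s => D * (1 + s ^ 2)⁻¹) (Ioi_mem_nhds (half_lt_self ht))
    (by
      filter_upwards [Ioi_mem_nhds ht] with r hr
      exact (h.integrable_sq hr).aestronglyMeasurable)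
    (h.integrable_sq ht) hGm
    (Eventually.of_forall fun s r hr => hb r hr s) (integrable_inv_one_add_sq.const_mul _)
    (Eventually.of_forall fun s r hr => hd r ((half_pos ht).trans hr) s)
  refine ⟨_, key.2.const_smul ((2 * Real.pi)⁻¹), ?_⟩
  rw [mul_smul_comm, ← integral_const_mul_of_integrable key.1]
  simp_rw [hkG]
  rw [integral_neg, integral_smul, ← h.integral_sq_eq ht, smul_neg, lineSemigroup]

end SectorData

end LineIntegral

/-! ### Strong continuity of the integral at time zero -/

section StrongContinuity

theorem clm_mul_apply {Y : Type*} [NormedAddCommGroup Y] [NormedSpace ℝ Y] (f g : Y →L[ℝ] Y)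
    (y : Y) : (f * g) y = f (g y) := rfl

/-- With k = A⁻¹, j = μ and r = (μ - A)⁻¹ one has μ - A = -(1 - j k) A, so the inverse of 1 - j k is
1 - j r. -/
theorem isUnit_and_eq_of_mul_eq_neg {R : Type*} [Ring R] {j k r : R} (c : Commute j k)
    (h1 : (1 - j * k) * r = -k) (h2 : r * (1 - j * k) = -k) :
    IsUnit (1 - j * k) ∧ r = -(k * Ring.inverse (1 - j * k)) := by
  have c2 : Commute (1 - j * k) j :=
    (Commute.one_left _).sub_left ((Commute.refl _).mul_left c.symm)
  have hu : IsUnit (1 - j * k) := by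
    refine ⟨⟨1 - j * k, 1 - j * r, ?_, ?_⟩, rfl⟩
    · rw [mul_sub, mul_one, ← mul_assoc, c2.eq, mul_assoc, h1, mul_neg]
      abel
    · rw [sub_mul, one_mul, mul_assoc, h2, mul_neg]
      abel
  refine ⟨hu, ?_⟩
  rw [← neg_mul, ← h2, mul_assoc, Ring.mul_inverse_cancel _ hu, mul_one]

/-- A uniformly bounded family of operators that converges on a dense set converges. -/
theorem tendsto_of_denseRange {Y Z ι W : Type*} [NormedAddCommGroup Y] [NormedSpace ℝ Y]
    [NormedAddCommGroup Z] [NormedSpace ℝ Z] {l : Filter ι} {F : ι → Y →L[ℝ] Z} {G : Y →L[ℝ] Z}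
    {M : ℝ} (hF : ∀ᶠ i in l, ‖F i‖ ≤ M) {d : W → Y} (hd : DenseRange d)
    (h : ∀ w, Tendsto (fun i => F i (d w)) l (𝓝 (G (d w)))) (y : Y) :
    Tendsto (fun i => F i y) l (𝓝 (G y)) := by
  rw [Metric.tendsto_nhds]
  intro ε hε
  set N := max M 0 + ‖G‖ + 1 with hN
  have hN0 : 0 < N := by positivity
  obtain ⟨w, hw⟩ := hd.exists_dist_lt y (show 0 < ε / (2 * N) by positivity)
  have h1 := Metric.tendsto_nhds.1 (h w) (ε / 2) (half_pos hε)
  filter_upwards [hF, h1] with i hi hi2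
  rw [dist_eq_norm] at *
  have e : F i y - G y = F i (y - d w) + (F i (d w) - G (d w)) - G (y - d w) := by
    simp only [map_sub]; abel
  have b1 : ‖F i (y - d w)‖ ≤ max M 0 * ‖y - d w‖ :=
    (F i).le_of_opNorm_le (hi.trans (le_max_left _ _)) _
  have b2 : ‖G (y - d w)‖ ≤ ‖G‖ * ‖y - d w‖ := G.le_opNorm _
  have b3 : (max M 0 + ‖G‖) * ‖y - d w‖ ≤ N * ‖y - d w‖ := by
    gcongr
    rw [hN]
    linarith
  have b4 : N * ‖y - d w‖ < ε / 2 := by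
    calc _ < N * (ε / (2 * N)) := by gcongr
      _ = ε / 2 := by field_simp
  rw [e]
  refine (norm_sub_le _ _).trans_lt ?_
  have := norm_add_le (F i (y - d w)) (F i (d w) - G (d w))
  nlinarith

theorem continuous_line : Continuous line :=
  continuous_iff_continuousAt.2 fun s => (hasDerivAt_line s).continuousAt

theorem integrable_exp_line :
    Integrable fun s => Complex.exp (line s) * ((line s) ^ 2)⁻¹ := by
  have hc := continuous_line
  have hc2 : Continuous fun s => ((line s) ^ 2)⁻¹ :=
    (hc.pow 2).inv₀ fun s => pow_ne_zero 2 (line_ne_zero s)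
  refine (integrable_inv_one_add_sq.const_mul (Real.exp 1)).mono'
    (Continuous.aestronglyMeasurable (by fun_prop)) (Eventually.of_forall fun s => ?_)
  rw [norm_mul, Complex.norm_exp, line_re, norm_inv, norm_pow, norm_line_sq]

variable {Y : Type*} [NormedAddCommGroup Y] [NormedSpace ℝ Y]
  {φ : ℂ →ₐ[ℝ] (Y →L[ℝ] Y)} {k : Y →L[ℝ] Y} {C M : ℝ}

/-- On the range of k the error (ν + tA)⁻¹ k q - ν⁻¹ k q equals -t ν⁻¹ (ν + tA)⁻¹ q, which is O(t).
Density and the uniform bound M extend the limit to all vectors. -/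
theorem SectorData.tendsto_res (h : SectorData φ k C M) (hk : DenseRange k) (s : ℝ) (p : Y) :
    Tendsto (fun t => lineRes φ k t s p) (𝓝[>] 0) (𝓝 (φ (line s)⁻¹ p)) := by
  refine tendsto_of_denseRange (M := M) ?_ hk (fun q => ?_) p
  · filter_upwards [self_mem_nhdsWithin] with t ht
    exact h.norm_res_le_M ht s
  have h1 : Tendsto (fun t : ℝ => ‖φ (line s)⁻¹‖ * (t * (M * ‖q‖))) (𝓝[>] 0) (𝓝 0) := by
    have : Continuous fun t : ℝ => ‖φ (line s)⁻¹‖ * (t * (M * ‖q‖)) := by fun_prop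
    have h2 := this.tendsto 0
    simp only [zero_mul, mul_zero] at h2
    exact h2.mono_left nhdsWithin_le_nhds
  refine tendsto_iff_norm_sub_tendsto_zero.2 (squeeze_zero' (Eventually.of_forall fun _ =>
    norm_nonneg _) ?_ h1)
  filter_upwards [self_mem_nhdsWithin] with t ht
  have ht : 0 < t := ht
  have e1 : φ (line s)⁻¹ * (t • lineInv φ k t s) = φ (line s)⁻¹ - lineRes φ k t s := by
    rw [h.smul_inv ht, mul_sub, mul_one, ← mul_assoc, ← map_mul,
      inv_mul_cancel₀ (line_ne_zero s), map_one, one_mul]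
  have e2 : lineRes φ k t s (k q) - φ (line s)⁻¹ (k q) =
      -(φ (line s)⁻¹ (t • lineRes φ k t s q)) := by
    have e3 := congrArg (fun f : Y →L[ℝ] Y => f (k q)) e1
    have e4 : lineInv φ k t s (k q) = lineRes φ k t s q :=
      congrArg (fun f : Y →L[ℝ] Y => f q) (h.commute_k_inv ht s).eq.symm
    simp only [clm_mul_apply, smul_apply,
      sub_apply, e4] at e3
    rw [e3, neg_sub]
  rw [e2, norm_neg]
  refine (ContinuousLinearMap.le_opNorm _ _).trans ?_
  rw [norm_smul, Real.norm_eq_abs, abs_of_pos ht]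
  gcongr
  exact (lineRes φ k t s).le_of_opNorm_le (h.norm_res_le_M ht s) q

/-- Strong continuity at `0`. -/
theorem SectorData.tendsto_lineSemigroup [CompleteSpace Y] (h : SectorData φ k C M)
    (hk : DenseRange k) (p : Y) :
    Tendsto (fun t => lineSemigroup φ k t p) (𝓝[>] 0) (𝓝 p) := by
  have hC := h.C_nonneg
  have hM := h.M_nonneg
  have hlim : Tendsto (fun t => ∫ s, (lineExp φ s * lineRes φ k t s ^ 2) p) (𝓝[>] 0)
      (𝓝 (∫ s, lineExp φ s (φ (line s)⁻¹ (φ (line s)⁻¹ p)))) := by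
    refine tendsto_integral_filter_of_dominated_convergence
      (fun s => C * Real.exp 1 * M ^ 2 * (1 + s ^ 2)⁻¹ * ‖p‖) ?_ ?_
      ((integrable_inv_one_add_sq.const_mul _).mul_const _) ?_
    · filter_upwards [self_mem_nhdsWithin] with t ht
      exact ((h.integrable_sq ht).apply_continuousLinearMap p).aestronglyMeasurable
    · filter_upwards [self_mem_nhdsWithin] with t ht
      exact Eventually.of_forall fun s =>
        ContinuousLinearMap.le_of_opNorm_le _ (h.norm_exp_mul_res_sq_le ht s) p
    · refine Eventually.of_forall fun s => ?_
      refine ((lineExp φ s).continuous.tendsto _).comp ?_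
      have h1 := h.tendsto_res hk s p
      have h2 := h.tendsto_res hk s (φ (line s)⁻¹ p)
      -- The square is handled one factor at a time: the outer resolvent is uniformly bounded on the
      -- error of the inner one.
      have h3 : Tendsto (fun t => lineRes φ k t s (lineRes φ k t s p - φ (line s)⁻¹ p))
          (𝓝[>] 0) (𝓝 0) := by
        have h4 := (tendsto_iff_norm_sub_tendsto_zero.1 h1).const_mul M
        rw [mul_zero] at h4
        refine squeeze_zero_norm' ?_ h4
        filter_upwards [self_mem_nhdsWithin] with t ht
        exact (lineRes φ k t s).le_of_opNorm_le (h.norm_res_le_M ht s) _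
      have h5 := h3.add h2
      rw [zero_add] at h5
      refine h5.congr fun t => ?_
      rw [map_sub, sub_add_cancel, sq]
      rfl
  -- The limit integrand is the scalar exp ν ν⁻² acting on p, so the integral is the scalar one, 2π.
  have hval : ∫ s, lineExp φ s (φ (line s)⁻¹ (φ (line s)⁻¹ p)) = (2 * Real.pi) • p := by
    let L : ℂ →L[ℝ] Y := LinearMap.mkContinuous
      { toFun := fun z => φ z p
        map_add' := fun z w => by simp
        map_smul' := fun r z => by simp } (C * ‖p‖) (fun z => by
          refine ((φ z).le_of_opNorm_le (h.norm_scalar z) p).trans_eq ?_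
          ring)
    have e : ∀ s, lineExp φ s (φ (line s)⁻¹ (φ (line s)⁻¹ p)) =
        L (Complex.exp (line s) * ((line s) ^ 2)⁻¹) := by
      intro s
      change _ = φ _ p
      rw [← inv_pow, sq, map_mul, map_mul, lineExp]
      rfl
    simp_rw [e]
    rw [ContinuousLinearMap.integral_comp_comm L integrable_exp_line]
    have e2 : ∫ s, Complex.exp (line s) * ((line s) ^ 2)⁻¹ = (2 * Real.pi : ℝ) := by
      push_cast
      exact integral_exp_div_sq
    rw [e2]
    change φ ((2 * Real.pi : ℝ) : ℂ) p = _
    have e3 : φ ((2 * Real.pi : ℝ) : ℂ) = algebraMap ℝ _ (2 * Real.pi) := φ.commutes (2 * Real.pi)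
    rw [e3, Algebra.algebraMap_eq_smul_one]
    rfl
  rw [hval] at hlim
  have h6 := hlim.const_smul ((2 * Real.pi)⁻¹)
  rw [smul_smul, inv_mul_cancel₀ (by positivity), one_smul] at h6
  refine h6.congr' ?_
  filter_upwards [self_mem_nhdsWithin] with t ht
  rw [lineSemigroup, smul_apply,
    ContinuousLinearMap.integral_apply (h.integrable_sq ht)]

end StrongContinuity

/-! ### Complexification and resolvents expressed through the bounded inverse -/

section Complexification

variable {X : Type*} [NormedAddCommGroup X] [NormedSpace ℝ X]

variable (X) in
/-- Multiplication by the imaginary unit on the complexification `X × X`. -/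
def imagUnit : X × X →L[ℝ] X × X :=
  (-(ContinuousLinearMap.snd ℝ X X)).prod (ContinuousLinearMap.fst ℝ X X)

theorem imagUnit_mul_self : imagUnit X * imagUnit X = -1 := by
  ext p <;> simp [imagUnit]

variable (X) in
/-- Multiplication by complex scalars on the complexification `X × X`. -/
noncomputable def cmul : ℂ →ₐ[ℝ] (X × X →L[ℝ] X × X) :=
  Complex.liftAux (imagUnit X) imagUnit_mul_self

theorem cmul_apply (z : ℂ) (p : X × X) :
    cmul X z p = (z.re • p.1 - z.im • p.2, z.im • p.1 + z.re • p.2) := by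
  rw [cmul, Complex.liftAux_apply, Algebra.algebraMap_eq_smul_one]
  ext
  · simp [imagUnit, sub_eq_add_neg]
  · simp [imagUnit, add_comm]

theorem norm_cmul_le (z : ℂ) : ‖cmul X z‖ ≤ 2 * ‖z‖ := by
  refine ContinuousLinearMap.opNorm_le_bound _ (by positivity) fun p => ?_
  rw [cmul_apply]
  have h1 := Complex.abs_re_le_norm z
  have h2 := Complex.abs_im_le_norm z
  have h3 := norm_fst_le p
  have h4 := norm_snd_le p
  have key : ∀ a b : ℝ, |a| ≤ ‖z‖ → |b| ≤ ‖z‖ → ∀ x y : X, ‖x‖ ≤ ‖p‖ → ‖y‖ ≤ ‖p‖ →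
      ‖a • x‖ + ‖b • y‖ ≤ 2 * ‖z‖ * ‖p‖ := by
    intro a b ha hb x y hx hy
    rw [norm_smul, norm_smul, Real.norm_eq_abs, Real.norm_eq_abs]
    have := mul_le_mul ha hx (norm_nonneg _) (norm_nonneg _)
    have := mul_le_mul hb hy (norm_nonneg _) (norm_nonneg _)
    linarith
  refine max_le ?_ ?_
  · exact (norm_sub_le _ _).trans (key _ _ h1 h2 _ _ h3 h4)
  · exact (norm_add_le _ _).trans (key _ _ h2 h1 _ _ h3 h4)

/-- The complexification of a bounded operator. -/
def diag (K : X →L[ℝ] X) : X × X →L[ℝ] X × X := K.prodMap K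

theorem diag_apply (K : X →L[ℝ] X) (p : X × X) : diag K p = (K p.1, K p.2) := rfl

theorem commute_cmul_diag (z : ℂ) (K : X →L[ℝ] X) : Commute (cmul X z) (diag K) := by
  refine ContinuousLinearMap.ext fun p => ?_
  simp only [clm_mul_apply, cmul_apply, diag_apply, map_add, map_sub, map_smul]

/-- `K` is the bounded inverse of `A`. -/
def HasBddInverse (A : X →ₗ.[ℝ] X) (K : X →L[ℝ] X) : Prop :=
  ∀ x y, K x = y ↔ ∃ h : y ∈ A.domain, A ⟨y, h⟩ = x

namespace HasBddInverse

variable {A : X →ₗ.[ℝ] X} {K : X →L[ℝ] X}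

theorem apply_mem (h : HasBddInverse A K) (x : X) : K x ∈ A.domain := ((h x (K x)).1 rfl).1

theorem apply_apply (h : HasBddInverse A K) (x : X) : A ⟨K x, h.apply_mem x⟩ = x :=
  ((h x (K x)).1 rfl).2

theorem inv_apply (h : HasBddInverse A K) (x : A.domain) : K (A x) = x :=
  (h (A x) x).2 ⟨x.2, rfl⟩

theorem injective (h : HasBddInverse A K) : Function.Injective K := by
  intro x y hxy
  have h1 := h.apply_apply x
  have h2 := h.apply_apply y
  rw [← h1, ← h2]
  congr 1
  exact Subtype.ext hxy

theorem mem_iff (h : HasBddInverse A K) (x : X) : x ∈ A.domain ↔ ∃ y, K y = x :=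
  ⟨fun hx => ⟨A ⟨x, hx⟩, h.inv_apply _⟩, fun ⟨y, hy⟩ => hy ▸ h.apply_mem y⟩

/-- Applying K to (μ - A) q = p removes the unbounded operator: (1 - μK) q = -K p. Conversely, this
equation puts both components of q in the range of K, which is the domain. -/
theorem isResolventAt_iff (h : HasBddInverse A K) (μ : ℂ) (R : X × X →L[ℝ] X × X) :
    IsResolventAt A μ R ↔ ∀ p q, R p = q ↔ (1 - cmul X μ * diag K) q = -diag K p := by
  refine forall₂_congr fun p q => iff_congr Iff.rfl ?_
  rw [(commute_cmul_diag μ K).eq]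
  simp only [sub_apply, one_apply_eq_self,
    clm_mul_apply, cmul_apply, diag_apply]
  have e : ∀ a b c : X, a - K b = -K c ↔ K (b - c) = a := by
    intro a b c
    rw [map_sub, sub_eq_iff_eq_add, neg_add_eq_sub, eq_comm]
  rw [Prod.ext_iff]
  simp only [Prod.fst_sub, Prod.snd_sub, Prod.fst_neg, Prod.snd_neg, e, h _ _]
  constructor
  · rintro ⟨h1, h2, h3⟩
    rw [Prod.ext_iff] at h3
    exact ⟨⟨h1, by rw [← h3.1]; simp⟩, ⟨h2, by rw [← h3.2]; simp⟩⟩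
  · rintro ⟨⟨h1, e1⟩, ⟨h2, e2⟩⟩
    refine ⟨h1, h2, ?_⟩
    rw [e1, e2]
    simp

theorem mul_diag_of_isResolventAt (h : HasBddInverse A K) {μ : ℂ} {R : X × X →L[ℝ] X × X}
    (hR : IsResolventAt A μ R) : (1 - cmul X μ * diag K) * R = -diag K ∧
      R * (1 - cmul X μ * diag K) = -diag K := by
  rw [h.isResolventAt_iff] at hR
  constructor
  · refine ContinuousLinearMap.ext fun p => ?_
    exact (hR p _).1 rfl
  · refine ContinuousLinearMap.ext fun p => ?_
    refine (hR _ _).2 ?_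
    have c : Commute (1 - cmul X μ * diag K) (diag K) :=
      (Commute.one_left _).sub_left ((commute_cmul_diag μ K).mul_left (Commute.refl _))
    have := congrArg (fun f : X × X →L[ℝ] X × X => f p) c.eq
    simp only [clm_mul_apply] at this
    simp only [neg_apply, map_neg, this]
    rfl

theorem isUnit_of_isResolventAt (h : HasBddInverse A K) {μ : ℂ} {R : X × X →L[ℝ] X × X}
    (hR : IsResolventAt A μ R) : IsUnit (1 - cmul X μ * diag K) ∧
      R = -(diag K * Ring.inverse (1 - cmul X μ * diag K)) := by
  obtain ⟨h1, h2⟩ := h.mul_diag_of_isResolventAt hR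
  exact isUnit_and_eq_of_mul_eq_neg (commute_cmul_diag μ K) h1 h2

/-- The resolvent set in terms of the inverse. -/
theorem exists_isResolventAt_iff (h : HasBddInverse A K) (μ : ℂ) :
    (∃ R, IsResolventAt A μ R) ↔ IsUnit (1 - cmul X μ * diag K) := by
  constructor
  · rintro ⟨R, hR⟩
    exact (h.isUnit_of_isResolventAt hR).1
  · intro hu
    refine ⟨Ring.inverse (1 - cmul X μ * diag K) * -diag K, ?_⟩
    rw [h.isResolventAt_iff]
    intro p q
    have e1 := Ring.mul_inverse_cancel _ hu
    have e2 := Ring.inverse_mul_cancel _ hu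
    set U := 1 - cmul X μ * diag K
    constructor
    · rintro rfl
      exact congrArg (fun f : X × X →L[ℝ] X × X => f (-diag K p)) e1
    · intro hq
      have := congrArg (fun f : X × X →L[ℝ] X × X => f q) e2
      simp only [clm_mul_apply, one_apply_eq_self, hq] at this
      exact this

end HasBddInverse

/-- The resolvent at 0 is -A⁻¹ acting on both components; its values on real vectors are real by
uniqueness. -/
theorem exists_hasBddInverse {A : X →ₗ.[ℝ] X} {R : X × X →L[ℝ] X × X}
    (hR : IsResolventAt A 0 R) :
    HasBddInverse A (-((ContinuousLinearMap.fst ℝ X X).comp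
      (R.comp (ContinuousLinearMap.inl ℝ X X)))) := by
  intro x y
  have h := hR
  unfold IsResolventAt at h
  simp only [Complex.zero_re, Complex.zero_im, zero_smul, sub_zero, zero_sub, add_zero] at h
  have e : (-((ContinuousLinearMap.fst ℝ X X).comp
      (R.comp (ContinuousLinearMap.inl ℝ X X)))) x = -(R (x, 0)).1 := rfl
  rw [e]
  constructor
  · intro hy
    obtain ⟨h1, h2, h3⟩ := (h (x, 0) _).1 rfl
    have h4 : y ∈ A.domain := by
      rw [← hy]
      exact A.domain.neg_mem h1
    refine ⟨h4, ?_⟩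
    have h5 := (Prod.ext_iff.1 h3).1
    simp only at h5
    rw [← A.map_neg] at h5
    rw [← h5]
    congr 1
    exact Subtype.ext hy.symm
  · rintro ⟨h1, h2⟩
    have h3 : R (x, 0) = (-y, 0) := by
      refine (h _ _).2 ⟨A.domain.neg_mem h1, A.domain.zero_mem, ?_⟩
      have e1 : A ⟨-y, A.domain.neg_mem h1⟩ = -A ⟨y, h1⟩ := A.map_neg ⟨y, h1⟩
      have e2 : A ⟨0, A.domain.zero_mem⟩ = 0 := A.map_zero
      rw [e1, e2, h2]
      simp
    rw [h3, neg_neg]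

end Complexification

/-! ### The semigroup generated by the negative of a positive sectorial operator -/

section AnalyticSemigroup

variable {X : Type*} [NormedAddCommGroup X] [NormedSpace ℝ X]

theorem exists_inverse_of_positive {A : X →ₗ.[ℝ] X} (hpos : IsPositiveOp A) :
    ∃ (R : X × X →L[ℝ] X × X) (K : X →L[ℝ] X), IsResolventAt A 0 R ∧ HasBddInverse A K ∧
      K = -((ContinuousLinearMap.fst ℝ X X).comp (R.comp (ContinuousLinearMap.inl ℝ X X))) := by
  have h0 : (0 : ℂ) ∉ spec A := fun h => by simpa using hpos 0 h
  obtain ⟨R, hR⟩ := not_not.1 h0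
  exact ⟨R, _, hR, exists_hasBddInverse hR, rfl⟩

variable {A : X →ₗ.[ℝ] X} {K : X →L[ℝ] X}

theorem IsPositiveOp.isUnit (hpos : IsPositiveOp A) (hK : HasBddInverse A K) {μ : ℂ}
    (hμ : μ.re ≤ 0) : IsUnit (1 - cmul X μ * diag K) := by
  rw [← hK.exists_isResolventAt_iff]
  by_contra h
  exact absurd (hpos μ h) (not_lt.2 hμ)

/-- Inside the open cone |arg z| < θ the real part is at least |z| cos θ; this places distant points
of the left half-plane in the resolvent sector. -/
theorem le_abs_arg_of_re_le {z : ℂ} {θ r : ℝ} (hθ0 : 0 < θ) (hθ : θ < Real.pi / 2)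
    (hre : z.re ≤ r) (hz : r < ‖z‖ * Real.cos θ) : θ ≤ |Complex.arg z| := by
  by_contra! h
  have h1 : Real.cos θ ≤ Real.cos |Complex.arg z| :=
    Real.cos_le_cos_of_nonneg_of_le_pi (abs_nonneg _) (by linarith [Real.pi_pos]) h.le
  rw [Real.cos_abs] at h1
  have h2 := Complex.norm_mul_cos_arg z
  have h3 := mul_le_mul_of_nonneg_left h1 (norm_nonneg z)
  linarith

/-- The resolvent bound on the closed left half plane. -/
theorem IsSectorial.exists_resolvent_bound [CompleteSpace X] (hsec : IsSectorial A)
    (hpos : IsPositiveOp A) (hK : HasBddInverse A K) :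
    ∃ M, ∀ μ : ℂ, μ.re ≤ 0 →
      (1 + ‖μ‖) * ‖diag K * Ring.inverse (1 - cmul X μ * diag K)‖ ≤ M := by
  obtain ⟨-, θ, ⟨hθ0, hθ⟩, M, hM1, a, hres⟩ := hsec
  have hcos : 0 < Real.cos θ := Real.cos_pos_of_mem_Ioo ⟨by linarith, hθ⟩
  -- For |μ| ≥ ρ the point μ - a lies outside the cone, since |μ - a| cos θ > |a| ≥ Re (μ - a), and
  -- 1 + |μ| ≤ 4 |μ - a|. The rest of the half-plane is compact, and positivity keeps it in the
  -- resolvent set.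
  set ρ := 2 * |a| + 1 + (|a| + 1) / Real.cos θ with hρ
  have hρ1 : 2 * |a| + 1 ≤ ρ := by rw [hρ]; linarith [show 0 ≤ (|a| + 1) / Real.cos θ by positivity]
  have hlarge : ∀ μ : ℂ, μ.re ≤ 0 → ρ ≤ ‖μ‖ →
      (1 + ‖μ‖) * ‖diag K * Ring.inverse (1 - cmul X μ * diag K)‖ ≤ 4 * M := by
    intro μ hμ hn
    have h1 : ‖μ‖ - |a| ≤ ‖μ - a‖ := by
      have := norm_sub_norm_le μ (a : ℂ)
      rwa [Complex.norm_real, Real.norm_eq_abs] at this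
    have ha := abs_nonneg a
    have hpos' : 0 < ‖μ - a‖ := by linarith
    have h2 : |a| < ‖μ - a‖ * Real.cos θ := by
      have : (|a| + 1) / Real.cos θ ≤ ‖μ - a‖ := by linarith
      rw [div_le_iff₀ hcos] at this
      linarith
    have h3 : (μ - a).re ≤ |a| := by
      simp only [Complex.sub_re, Complex.ofReal_re]
      linarith [neg_le_abs a]
    obtain ⟨R, hR, hRn⟩ := hres μ (sub_ne_zero.1 (norm_pos_iff.1 hpos'))
      (le_abs_arg_of_re_le hθ0 hθ h3 h2)
    have h4 := (hK.isUnit_of_isResolventAt hR).2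
    have h5 : ‖diag K * Ring.inverse (1 - cmul X μ * diag K)‖ = ‖R‖ := by
      rw [h4]
      exact (norm_neg _).symm
    rw [h5]
    calc (1 + ‖μ‖) * ‖R‖ ≤ (1 + ‖μ‖) * (M / ‖μ - a‖) := by gcongr
      _ ≤ 4 * M := by
        rw [mul_div_assoc', div_le_iff₀ hpos']
        nlinarith
  have hcont : ContinuousOn (fun μ : ℂ =>
      (1 + ‖μ‖) * ‖diag K * Ring.inverse (1 - cmul X μ * diag K)‖)
      ({μ : ℂ | μ.re ≤ 0} ∩ Metric.closedBall 0 ρ) := by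
    intro μ hμ
    obtain ⟨u, hu⟩ := hpos.isUnit hK hμ.1
    have h1 : Continuous fun μ : ℂ => 1 - cmul X μ * diag K := by
      have : Continuous fun μ : ℂ => cmul X μ :=
        (cmul X).toLinearMap.continuous_of_finiteDimensional
      fun_prop
    have h2 : ContinuousAt Ring.inverse (1 - cmul X μ * diag K) :=
      hu ▸ NormedRing.inverse_continuousAt u
    have h3 : ContinuousAt (fun μ : ℂ => Ring.inverse (1 - cmul X μ * diag K)) μ :=
      ContinuousAt.comp (f := fun μ : ℂ => 1 - cmul X μ * diag K) h2 h1.continuousAt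
    have h4 : ContinuousAt (fun μ : ℂ => diag K * Ring.inverse (1 - cmul X μ * diag K)) μ :=
      continuousAt_const.mul h3
    exact ((continuousAt_const.add continuousAt_id.norm).mul h4.norm).continuousWithinAt
  have hcomp : IsCompact ({μ : ℂ | μ.re ≤ 0} ∩ Metric.closedBall 0 ρ) :=
    (isCompact_closedBall (0 : ℂ) ρ).inter_left
      (isClosed_le Complex.continuous_re continuous_const)
  obtain ⟨M', hM'⟩ := hcomp.exists_bound_of_continuousOn hcont
  refine ⟨max (4 * M) M', fun μ hμ => ?_⟩
  rcases le_total ρ ‖μ‖ with h | h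
  · exact (hlarge μ hμ h).trans (le_max_left _ _)
  · exact ((le_abs_self _).trans (hM' μ ⟨hμ, by simpa using h⟩)).trans (le_max_right _ _)

theorem smul_ringInverse_smul {R : Type*} [Ring R] [Algebra ℝ R] {a : R} (ha : IsUnit a) {t : ℝ}
    (ht : t ≠ 0) : IsUnit (t • a) ∧ Ring.inverse (t • a) = t⁻¹ • Ring.inverse a := by
  obtain ⟨u, rfl⟩ := ha
  have : t • (u : R) = ((Units.mk0 t ht • u : Rˣ) : R) := rfl
  rw [this]
  refine ⟨Units.isUnit _, ?_⟩
  rw [Ring.inverse_unit, Ring.inverse_unit]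
  rfl

theorem mul_add_algebraMap {R : Type*} [Ring R] [Algebra ℝ R] (j k : R) {t : ℝ} (ht : t ≠ 0) :
    j * k + algebraMap ℝ R t = t • (1 - -(t⁻¹ • j) * k) := by
  rw [Algebra.algebraMap_eq_smul_one, neg_mul, smul_mul_assoc, sub_neg_eq_add,
    smul_add, smul_smul, mul_inv_cancel₀ ht, one_smul, add_comm]

/-- Scaling: νK + t = t (1 - μK) with μ = -ν / t in the left half-plane. The bound M / (1 + |μ|)
becomes M / (t + |ν|), which contains both required estimates. -/
theorem IsSectorial.exists_sectorData [CompleteSpace X] (hsec : IsSectorial A)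
    (hpos : IsPositiveOp A) (hK : HasBddInverse A K) :
    ∃ M, SectorData (cmul X) (diag K) 2 M := by
  obtain ⟨M, hM⟩ := hsec.exists_resolvent_bound hpos hK
  have e : ∀ t : ℝ, 0 < t → ∀ s, cmul X (line s) * diag K + algebraMap ℝ _ t =
      t • (1 - cmul X (-((t⁻¹ : ℝ) • line s)) * diag K) := by
    intro t ht s
    rw [map_neg, map_smul]
    exact mul_add_algebraMap _ _ ht.ne'
  have hre : ∀ t : ℝ, 0 < t → ∀ s, (-((t⁻¹ : ℝ) • line s)).re ≤ 0 := by
    intro t ht s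
    simp [line_re, ht.le]
  have hn : ∀ t : ℝ, 0 < t → ∀ s, (t + ‖line s‖) *
      ‖diag K * Ring.inverse (cmul X (line s) * diag K + algebraMap ℝ _ t)‖ ≤ M := by
    intro t ht s
    have h1 := hM _ (hre t ht s)
    rw [e t ht s, (smul_ringInverse_smul (hpos.isUnit hK (hre t ht s)) ht.ne').2,
      mul_smul_comm, norm_smul]
    rw [norm_neg, norm_smul, norm_inv, Real.norm_eq_abs, abs_of_pos ht] at h1
    refine le_trans (le_of_eq ?_) h1
    rw [norm_inv, Real.norm_eq_abs, abs_of_pos ht]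
    field_simp
  refine ⟨M, fun z => commute_cmul_diag z K, norm_cmul_le, fun t ht s => ?_, fun t ht s => ?_,
    fun t ht s => ?_⟩
  · rw [e t ht s]
    exact (smul_ringInverse_smul (hpos.isUnit hK (hre t ht s)) ht.ne').1
  · rw [le_div_iff₀ (norm_line_pos s), mul_comm]
    refine le_trans ?_ (hn t ht s)
    gcongr
    linarith
  · rw [le_div_iff₀ ht, mul_comm]
    refine le_trans ?_ (hn t ht s)
    gcongr
    linarith [norm_line_pos s]

/-- A bounded family `T(t)`, `t > 0`, with `T' = -A T`, where `K = A⁻¹`, and `T(0+) = I`. -/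
structure IsExpFamily (K : X →L[ℝ] X) (T : ℝ → X →L[ℝ] X) (C : ℝ) : Prop where
  injective : Function.Injective K
  deriv : ∀ t, 0 < t → ∃ T', HasDerivAt T T' t ∧ K * T' = -T t
  commute : ∀ t, 0 < t → Commute K (T t)
  bound : ∀ t, 0 < t → ‖T t‖ ≤ C
  bound' : ∀ t, 0 < t → ‖T t‖ ≤ C / t
  tendsto : ∀ x, Tendsto (fun t => T t x) (𝓝[>] 0) (𝓝 x)

theorem IsSectorial.exists_isExpFamily [CompleteSpace X] (hsec : IsSectorial A)
    (hpos : IsPositiveOp A) (hK : HasBddInverse A K) :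
    ∃ T C, IsExpFamily K T C := by
  obtain ⟨M, h⟩ := hsec.exists_sectorData hpos hK
  have hM := h.M_nonneg
  -- Real part of the action on real vectors. The complexified K acts componentwise, so this
  -- compression keeps all relations with K, and it need not be known that the complex family
  -- preserves real vectors.
  let ι : (X × X →L[ℝ] X × X) →L[ℝ] (X →L[ℝ] X) :=
    ((ContinuousLinearMap.compL ℝ X (X × X) X) (ContinuousLinearMap.fst ℝ X X)).comp
      ((ContinuousLinearMap.compL ℝ X (X × X) (X × X)).flip (ContinuousLinearMap.inl ℝ X X))
  have hι : ∀ F x, ι F x = (F (x, 0)).1 := fun F x => rfl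
  have hιn : ∀ F, ‖ι F‖ ≤ ‖F‖ := by
    intro F
    refine ContinuousLinearMap.opNorm_le_bound _ (norm_nonneg _) fun x => ?_
    rw [hι]
    refine (norm_fst_le _).trans ((F.le_opNorm _).trans_eq ?_)
    simp
  have hdense : DenseRange K := by
    have : range K = (A.domain : Set X) := by
      ext x
      exact (hK.mem_iff x).symm
    rw [DenseRange, this]
    exact hsec.1
  set D := max (2 * Real.exp 1 * M ^ 2) (2 * Real.exp 1 * M ^ 3) with hD
  refine ⟨fun t => ι (lineSemigroup (cmul X) (diag K) t), D, hK.injective, fun t ht => ?_,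
    fun t ht => ?_, fun t ht => ?_, fun t ht => ?_, fun x => ?_⟩
  · obtain ⟨T', h1, h2⟩ := h.exists_hasDerivAt_lineSemigroup ht
    refine ⟨ι T', (ι.hasFDerivAt).comp_hasDerivAt t h1, ?_⟩
    ext x
    have := congrArg (fun F : X × X →L[ℝ] X × X => (F (x, 0)).1) h2
    exact this
  · ext x
    have := congrArg (fun F : X × X →L[ℝ] X × X => (F (x, 0)).1) (h.commute_lineSemigroup ht).eq
    have e : diag K (x, 0) = (K x, 0) := by simp [diag_apply]
    simp only [clm_mul_apply, e] at this
    exact this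
  · exact (hιn _).trans ((h.norm_lineSemigroup_le ht).trans (le_max_left _ _))
  · refine (hιn _).trans ((h.norm_lineSemigroup_le' ht).trans ?_)
    gcongr
    exact le_max_right _ _
  · have h1 := h.tendsto_lineSemigroup (k := diag K) (hdense.prodMap hdense) (x, 0)
    exact (continuous_fst.tendsto _).comp h1

namespace IsExpFamily

variable {T : ℝ → X →L[ℝ] X} {C : ℝ}

theorem C_nonneg (h : IsExpFamily K T C) : 0 ≤ C :=
  (norm_nonneg _).trans (h.bound 1 one_pos)

theorem continuousAt (h : IsExpFamily K T C) {t : ℝ} (ht : 0 < t) : ContinuousAt T t := by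
  obtain ⟨T', h1, -⟩ := h.deriv t ht
  exact h1.continuousAt

theorem commute_apply (h : IsExpFamily K T C) {t : ℝ} (ht : 0 < t) (x : X) :
    T t (K x) = K (T t x) := congrArg (fun F : X →L[ℝ] X => F x) (h.commute t ht).eq.symm

/-- T and K commute, so differentiating T K instead of K T gives the relation with K on the right.
-/
theorem deriv' (h : IsExpFamily K T C) {t : ℝ} (ht : 0 < t) :
    ∃ T', HasDerivAt T T' t ∧ ∀ x, T' (K x) = -T t x := by
  obtain ⟨T', h1, h2⟩ := h.deriv t ht
  have e : (fun s => K * T s) =ᶠ[𝓝 t] fun s => T s * K := by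
    filter_upwards [Ioi_mem_nhds ht] with s hs
    exact (h.commute s hs).eq
  have h3 := (h1.mul_const K).unique ((h1.const_mul K).congr_of_eventuallyEq e.symm)
  refine ⟨T', h1, fun x => ?_⟩
  have := congrArg (fun F : X →L[ℝ] X => F x) (h3.trans h2)
  exact this

theorem hasDerivAt_K (h : IsExpFamily K T C) {t : ℝ} (ht : 0 < t) (x : X) :
    HasDerivAt (fun t => K (T t x)) (-T t x) t := by
  obtain ⟨T', h1, h2⟩ := h.deriv t ht
  have h3 : HasDerivAt (fun t => T t x) (T' x) t := by
    simpa using h1.clm_apply (hasDerivAt_const t x)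
  have h4 := (K.hasFDerivAt).comp_hasDerivAt t h3
  refine h4.congr_deriv ?_
  exact congrArg (fun F : X →L[ℝ] X => F x) h2

/-- Uniqueness for `u' = -A u`. -/
theorem eq_apply (h : IsExpFamily K T C) {u : ℝ → X} (hu : ContinuousOn u (Ici 0))
    (hd : ∀ s, 0 ≤ s → HasDerivWithinAt (fun s => K (u s)) (-u s) (Ici s) s) {t : ℝ}
    (ht : 0 < t) : u t = T t (u 0) := by
  -- The function s ↦ T(t - s) K u(s) has zero right derivative. Nothing is known about T(0), so the
  -- value at s = t is prescribed as the limit K u(t).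
  set g : ℝ → X := fun s => if s < t then T (t - s) (K (u s)) else K (u t) with hg
  have hgt : ∀ s, s < t → g s = T (t - s) (K (u s)) := fun s hs => if_pos hs
  have hgd : ∀ s ∈ Ico 0 t, HasDerivWithinAt g 0 (Ici s) s := by
    intro s hs
    have hts : 0 < t - s := sub_pos.2 hs.2
    obtain ⟨T', h1, h2⟩ := h.deriv' hts
    have h3 : HasDerivAt (fun s => T (t - s)) (-T') s := by
      have := HasDerivAt.scomp s h1 ((hasDerivAt_id s).const_sub t)
      simpa [Function.comp_def] using this
    have h4 := h3.hasDerivWithinAt.clm_apply (hd s hs.1)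
    have h5 : (-T') (K (u s)) + T (t - s) (-u s) = 0 := by
      rw [neg_apply, h2, map_neg, neg_neg, add_neg_cancel]
    rw [h5] at h4
    refine h4.congr_of_eventuallyEq ?_ (hgt s hs.2)
    filter_upwards [mem_nhdsWithin_of_mem_nhds (Iio_mem_nhds hs.2)] with r hr
    exact hgt r hr
  have hgc : ContinuousOn g (Icc 0 t) := by
    intro s hs
    have hus : ContinuousWithinAt u (Icc 0 t) s := (hu s hs.1).mono Icc_subset_Ici_self
    rcases hs.2.lt_or_eq with hst | hst
    · have h1 : ContinuousAt (fun s => T (t - s)) s :=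
        ContinuousAt.comp (f := fun s => t - s) (h.continuousAt (sub_pos.2 hst)) (by fun_prop)
      have h2 : ContinuousWithinAt (fun s => T (t - s) (K (u s))) (Icc 0 t) s :=
        h1.continuousWithinAt.clm_apply (K.continuous.continuousAt.comp_continuousWithinAt hus)
      refine h2.congr_of_eventuallyEq ?_ (hgt s hst)
      filter_upwards [mem_nhdsWithin_of_mem_nhds (Iio_mem_nhds hst)] with r hr
      exact hgt r hr
    · rw [hst] at hus ⊢
      have hgtt : g t = K (u t) := if_neg (lt_irrefl t)
      rw [ContinuousWithinAt, hgtt, tendsto_iff_norm_sub_tendsto_zero]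
      have hKu : Tendsto (fun s => ‖K (u s) - K (u t)‖) (𝓝[Icc 0 t] t) (𝓝 0) :=
        tendsto_iff_norm_sub_tendsto_zero.1 ((K.continuous.tendsto _).comp hus)
      have hT : Tendsto (fun s => if s < t then ‖T (t - s) (K (u t)) - K (u t)‖ else 0)
          (𝓝 t) (𝓝 0) := by
        refine Tendsto.if ?_ (tendsto_const_nhds)
        have h1 := tendsto_iff_norm_sub_tendsto_zero.1 (h.tendsto (K (u t)))
        have h2 : Tendsto (fun s => t - s) (𝓝 t ⊓ 𝓟 {s | s < t}) (𝓝[>] 0) := by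
          refine tendsto_nhdsWithin_iff.2 ⟨?_, ?_⟩
          · have : Tendsto (fun s => t - s) (𝓝 t) (𝓝 (t - t)) :=
              (continuous_const.sub continuous_id).tendsto t
            rw [sub_self] at this
            exact this.mono_left inf_le_left
          · exact (eventually_principal.2 fun (s : ℝ) (hs : s < t) =>
              mem_Ioi.2 (sub_pos.2 hs)).filter_mono inf_le_right
        exact h1.comp h2
      have hsum := (hKu.const_mul C).add (hKu.add (hT.mono_left nhdsWithin_le_nhds))
      simp only [mul_zero, add_zero] at hsum
      refine squeeze_zero (fun _ => norm_nonneg _) (fun r => ?_) hsum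
      have hCn := mul_nonneg h.C_nonneg (norm_nonneg (K (u r) - K (u t)))
      by_cases hr : r < t
      · rw [hgt r hr, if_pos hr]
        have e : T (t - r) (K (u r)) - K (u t) = T (t - r) (K (u r) - K (u t)) +
            (T (t - r) (K (u t)) - K (u t)) := by
          rw [map_sub]; abel
        rw [e]
        refine (norm_add_le _ _).trans (add_le_add ?_ ?_)
        · exact (T (t - r)).le_of_opNorm_le (h.bound _ (sub_pos.2 hr)) _
        · linarith [norm_nonneg (K (u r) - K (u t))]
      · have : g r = K (u t) := if_neg hr
        rw [this, sub_self, norm_zero, if_neg hr]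
        linarith [norm_nonneg (K (u r) - K (u t))]
  have := constant_of_has_deriv_right_zero hgc hgd t (right_mem_Icc.2 ht.le)
  rw [hgt 0 ht, sub_zero, h.commute_apply ht] at this
  have hgtt : g t = K (u t) := if_neg (lt_irrefl t)
  rw [hgtt] at this
  exact h.injective this

theorem continuousOn_orbit (h : IsExpFamily K T C) (x : X) :
    ContinuousOn (fun t => if 0 < t then T t x else x) (Ici 0) := by
  intro t ht
  rcases (mem_Ici.1 ht).lt_or_eq with h0 | h0
  · have h1 : ContinuousAt (fun t => T t x) t := (h.continuousAt h0).clm_apply continuousAt_const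
    refine (h1.congr_of_eventuallyEq ?_).continuousWithinAt
    filter_upwards [Ioi_mem_nhds h0] with s hs
    exact if_pos hs
  · rw [← h0, ContinuousWithinAt, if_neg (lt_irrefl _)]
    have : (Ici (0 : ℝ)) = insert 0 (Ioi 0) := by ext; simp [le_iff_eq_or_lt, eq_comm]
    rw [this, nhdsWithin_insert]
    refine tendsto_sup.2 ⟨?_, ?_⟩
    · have h9 := tendsto_pure_nhds (fun t : ℝ => if 0 < t then T t x else x) 0
      simp only [lt_irrefl, if_false] at h9
      exact h9
    · refine (h.tendsto x).congr' ?_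
      filter_upwards [self_mem_nhdsWithin] with s hs
      exact (if_pos hs).symm

theorem hasDerivWithinAt_orbit (h : IsExpFamily K T C) (x : X) {t : ℝ} (ht : 0 ≤ t) :
    HasDerivWithinAt (fun t => K (if 0 < t then T t x else x)) (-if 0 < t then T t x else x)
      (Ici t) t := by
  rcases ht.lt_or_eq with h0 | h0
  · rw [if_pos h0]
    refine ((h.hasDerivAt_K h0 x).congr_of_eventuallyEq ?_).hasDerivWithinAt
    filter_upwards [Ioi_mem_nhds h0] with s hs
    rw [if_pos (mem_Ioi.1 hs)]
  · rw [← h0, if_neg (lt_irrefl _)]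
    have hd : ∀ s, 0 < s → HasDerivAt (fun t => K (if 0 < t then T t x else x)) (-T s x) s := by
      intro s hs
      refine (h.hasDerivAt_K hs x).congr_of_eventuallyEq ?_
      filter_upwards [Ioi_mem_nhds hs] with r hr
      rw [if_pos (mem_Ioi.1 hr)]
    -- The one-sided derivative at 0 is the limit of the derivatives -T(s) x at positive times.
    refine hasDerivWithinAt_Ici_of_tendsto_deriv (s := Ioi 0)
      (fun s hs => (hd s hs).differentiableAt.differentiableWithinAt) ?_ self_mem_nhdsWithin ?_
    · exact (K.continuous.continuousAt.comp_continuousWithinAt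
        (h.continuousOn_orbit x 0 self_mem_Ici)).mono Ioi_subset_Ici_self
    · refine (h.tendsto x).neg.congr' ?_
      filter_upwards [self_mem_nhdsWithin] with s hs
      exact (hd s hs).deriv.symm

/-- The `C₀` semigroup given by the family. -/
noncomputable def semigroup (h : IsExpFamily K T C) : C0Semigroup X where
  toFun t := if 0 < t then T t else ContinuousLinearMap.id ℝ X
  map_zero' := if_neg (lt_irrefl _)
  map_add' s t hs ht := by
    rcases hs.lt_or_eq with hs | rfl
    · rcases ht.lt_or_eq with ht | rfl
      · rw [if_pos hs, if_pos ht, if_pos (add_pos hs ht)]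
        ext x
        have hu : ∀ r, 0 ≤ r → (if 0 < r + t then T (r + t) x else x) = T (r + t) x :=
          fun r hr => if_pos (by linarith)
        -- The semigroup law follows from uniqueness for the shifted orbit.
        have := h.eq_apply (u := fun r => T (r + t) x) ?_ ?_ hs
        · simpa using this
        · refine ((h.continuousOn_orbit x).comp (f := fun r => r + t) (by fun_prop)
            fun r hr => ?_).congr fun r hr => (hu r hr).symm
          exact mem_Ici.2 (by linarith [mem_Ici.1 hr])
        · intro r hr
          have h1 := (h.hasDerivAt_K (add_pos_of_nonneg_of_pos hr ht) x).comp_add_const r t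
          exact h1.hasDerivWithinAt
      · simp [hs]
    · simp
  continuousOn' x := by
    refine (h.continuousOn_orbit x).congr fun t _ => ?_
    dsimp only
    split_ifs <;> rfl

theorem semigroup_apply (h : IsExpFamily K T C) (t : ℝ) (x : X) :
    h.semigroup.toFun t x = if 0 < t then T t x else x := by
  change (if 0 < t then T t else ContinuousLinearMap.id ℝ X) x = _
  split_ifs <;> rfl

theorem semigroup_hasGen (h : IsExpFamily K T C) (x : X) : h.semigroup.HasGen (K x) (-x) := by
  have h1 := h.hasDerivWithinAt_orbit x le_rfl
  rw [← hasDerivWithinAt_Ioi_iff_Ici, hasDerivWithinAt_iff_tendsto_slope'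
    (by simp : (0 : ℝ) ∉ Ioi 0), if_neg (lt_irrefl _)] at h1
  refine h1.congr' ?_
  filter_upwards [self_mem_nhdsWithin] with t ht
  have ht : 0 < t := ht
  rw [h.semigroup_apply, if_pos ht, h.commute_apply ht]
  simp [slope, ht]

/-- If the difference quotients at x tend to y, applying K gives those at K x, whose limit is -x;
hence K y = -x. -/
theorem semigroup_hasGen_iff (h : IsExpFamily K T C) (x y : X) :
    h.semigroup.HasGen x y ↔ K (-y) = x := by
  constructor
  · intro hxy
    have h1 := (K.continuous.tendsto y).comp hxy
    have h2 := tendsto_nhds_unique (h1.congr' ?_) (h.semigroup_hasGen x)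
    · rw [map_neg, h2, neg_neg]
    filter_upwards [self_mem_nhdsWithin] with t ht
    have ht : 0 < t := ht
    simp only [Function.comp, map_smul, map_sub, h.semigroup_apply, if_pos ht,
      h.commute_apply ht]
  · rintro rfl
    simpa using h.semigroup_hasGen (-y)

theorem semigroup_isGeneratedBy (h : IsExpFamily K T C) (hK : HasBddInverse A K) :
    h.semigroup.IsGeneratedBy (-A) := by
  intro x y
  refine Iff.trans ?_ (h.semigroup_hasGen_iff x y).symm
  rw [hK, LinearPMap.mem_graph_iff]
  constructor
  · rintro ⟨z, rfl, hz⟩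
    refine ⟨z.2, ?_⟩
    have hz' : -(A ⟨z, z.2⟩) = y := hz
    rw [← hz', neg_neg]
  · rintro ⟨hx, e⟩
    refine ⟨⟨x, hx⟩, rfl, ?_⟩
    rw [LinearPMap.neg_apply, e, neg_neg]

/-- `-A` generates only one semigroup. -/
theorem semigroupOf_eq (h : IsExpFamily K T C) (hK : HasBddInverse A K) {t : ℝ} (ht : 0 < t) :
    (semigroupOf (-A)).toFun t = T t := by
  have hex : ∃ S : C0Semigroup X, S.IsGeneratedBy (-A) := ⟨_, h.semigroup_isGeneratedBy hK⟩
  have hgen : ∀ x, (semigroupOf (-A)).HasGen (K x) (-x) := fun x => by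
    rw [semigroupOf_hasGen_iff hex, h.semigroup_isGeneratedBy hK (K x) (-x)]
    exact h.semigroup_hasGen x
  have hiff : ∀ x y, (semigroupOf (-A)).HasGen x y → K (-y) = x := fun x y hxy => by
    rw [semigroupOf_hasGen_iff hex, h.semigroup_isGeneratedBy hK x y] at hxy
    exact (h.semigroup_hasGen_iff x y).1 hxy
  have hcomm : ∀ s, 0 ≤ s → ∀ x, (semigroupOf (-A)).toFun s (K x) =
      K ((semigroupOf (-A)).toFun s x) := fun s hs x => by
    have := hiff _ _ ((hgen x).apply hs)
    rw [← this, map_neg, map_neg, map_neg, neg_neg]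
  ext x
  have := h.eq_apply (u := fun s => (semigroupOf (-A)).toFun s x)
    ((semigroupOf (-A)).continuousOn' x) (fun s hs => ?_) ht
  · simpa [C0Semigroup.apply_zero] using this
  · have h1 := (hgen x).hasDerivWithinAt hs
    rw [map_neg] at h1
    exact h1.congr (fun r hr => (hcomm r (hs.trans hr) x).symm) (hcomm s hs x).symm

end IsExpFamily

end AnalyticSemigroup

/-! ### Fractional powers and the space X^α -/

section FractionalPowers

theorem integral_rpow_mul_sub_rpow {α : ℝ} (h0 : 0 < α) (h1 : α < 1) {x : ℝ} (hx : 0 < x) :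
    ∫ t in (0 : ℝ)..x, t ^ (α - 1) * (x - t) ^ (1 - α - 1) =
      Real.Gamma α * Real.Gamma (1 - α) := by
  have h2 : 0 < 1 - α := sub_pos.2 h1
  have hs := Complex.betaIntegral_scaled (α : ℂ) ((1 - α : ℝ) : ℂ) hx
  have hg := Complex.Gamma_mul_Gamma_eq_betaIntegral (s := (α : ℂ)) (t := ((1 - α : ℝ) : ℂ))
    (by simpa using h0) (by simpa using h2)
  have e : (α : ℂ) + ((1 - α : ℝ) : ℂ) = 1 := by push_cast; ring
  rw [e, Complex.Gamma_one, one_mul] at hg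
  rw [e, sub_self, Complex.cpow_zero, one_mul, ← hg] at hs
  have key : ((∫ t in (0 : ℝ)..x, t ^ (α - 1) * (x - t) ^ (1 - α - 1) : ℝ) : ℂ) =
      ((Real.Gamma α * Real.Gamma (1 - α) : ℝ) : ℂ) := by
    rw [← intervalIntegral.integral_ofReal]
    push_cast
    rw [← Complex.Gamma_ofReal, ← Complex.Gamma_ofReal, ← hs]
    refine intervalIntegral.integral_congr fun t ht => ?_
    rw [uIcc_of_le hx.le] at ht
    rw [Complex.ofReal_cpow ht.1, Complex.ofReal_cpow (sub_nonneg.2 ht.2)]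
    push_cast
    rfl
  exact_mod_cast key

variable {X : Type*} [NormedAddCommGroup X] [NormedSpace ℝ X] {K : X →L[ℝ] X}
  {T : ℝ → X →L[ℝ] X} {C : ℝ}

namespace IsExpFamily

theorem continuousOn (h : IsExpFamily K T C) : ContinuousOn T (Ioi 0) :=
  fun _ ht => (h.continuousAt ht).continuousWithinAt

/-- The bound C suffices on (0, 1] because α > 0, and the bound C / t beyond 1 because α < 1. -/
theorem integrableOn_rpow_smul [CompleteSpace X] (h : IsExpFamily K T C) {α : ℝ} (h0 : 0 < α) (h1 : α < 1) :
    IntegrableOn (fun t => t ^ (α - 1) • T t) (Ioi 0) := by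
  have hc : ContinuousOn (fun t : ℝ => t ^ (α - 1) • T t) (Ioi 0) :=
    ContinuousOn.smul (fun t ht => (Real.continuousAt_rpow_const _ _
      (Or.inl (ne_of_gt ht))).continuousWithinAt) h.continuousOn
  rw [← Ioc_union_Ioi_eq_Ioi zero_le_one]
  refine IntegrableOn.union ?_ ?_
  · have hb : IntegrableOn (fun t : ℝ => t ^ (α - 1) * C) (Ioc 0 1) := by
      have := intervalIntegral.intervalIntegrable_rpow' (a := 0) (b := 1) (r := α - 1)
        (by linarith)
      exact ((intervalIntegrable_iff_integrableOn_Ioc_of_le zero_le_one).1 this).mul_const C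
    refine hb.mono' ((hc.mono Ioc_subset_Ioi_self).aestronglyMeasurable measurableSet_Ioc) ?_
    filter_upwards [ae_restrict_mem measurableSet_Ioc] with t ht
    have hp := Real.rpow_nonneg ht.1.le (α - 1)
    rw [norm_smul, Real.norm_eq_abs, abs_of_nonneg hp]
    gcongr
    exact h.bound t ht.1
  · have hb : IntegrableOn (fun t : ℝ => t ^ (α - 2) * C) (Ioi 1) :=
      (integrableOn_Ioi_rpow_of_lt (by linarith) one_pos).mul_const C
    refine hb.mono' ((hc.mono (Ioi_subset_Ioi zero_le_one)).aestronglyMeasurable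
      measurableSet_Ioi) ?_
    filter_upwards [ae_restrict_mem measurableSet_Ioi] with t ht
    have ht0 : 0 < t := zero_lt_one.trans ht
    have hp := Real.rpow_nonneg ht0.le (α - 1)
    rw [norm_smul, Real.norm_eq_abs, abs_of_nonneg hp]
    calc t ^ (α - 1) * ‖T t‖ ≤ t ^ (α - 1) * (C / t) := by
          gcongr
          exact h.bound' t ht0
      _ = t ^ (α - 2) * C := by
          rw [show α - 1 = α - 2 + 1 by ring, Real.rpow_add_one ht0.ne']
          field_simp

theorem mul_apply (h : IsExpFamily K T C) {s t : ℝ} (hs : 0 < s) (ht : 0 < t) :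
    T s * T t = T (s + t) := by
  ext x
  have := h.semigroup.apply_add hs.le ht.le x
  simp only [h.semigroup_apply, if_pos hs, if_pos ht, if_pos (add_pos hs ht)] at this
  exact this.symm

/-- By the semigroup law T(t) T(x - t) = T(x) leaves the integral, and what remains is the Beta
integral B(α, 1 - α). -/
theorem integral_convolution_eq [CompleteSpace X] (h : IsExpFamily K T C) {α : ℝ} (h0 : 0 < α)
    (h1 : α < 1) {x : ℝ} (hx : 0 < x) :
    ∫ t in (0 : ℝ)..x, ContinuousLinearMap.mul ℝ (X →L[ℝ] X) (t ^ (α - 1) • T t)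
      ((x - t) ^ (1 - α - 1) • T (x - t)) = (Real.Gamma α * Real.Gamma (1 - α)) • T x := by
  rw [← integral_rpow_mul_sub_rpow h0 h1 hx]
  refine Eq.trans ?_ (intervalIntegral.integral_smul_const (𝕜 := ℝ)
    (fun t => t ^ (α - 1) * (x - t) ^ (1 - α - 1)) (T x))
  rw [intervalIntegral.integral_of_le hx.le, intervalIntegral.integral_of_le hx.le,
    integral_Ioc_eq_integral_Ioo, integral_Ioc_eq_integral_Ioo]
  refine setIntegral_congr_fun measurableSet_Ioo fun t ht => ?_
  simp only [ContinuousLinearMap.mul_apply']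
  rw [smul_mul_smul_comm, h.mul_apply ht.1 (sub_pos.2 ht.2), add_sub_cancel]

/-- The bound C / t alone is not integrable at infinity. Instead T is, up to a nonzero constant, the
convolution of two integrable functions, taken with α = 1/2. -/
theorem integrableOn [CompleteSpace X] (h : IsExpFamily K T C) : IntegrableOn T (Ioi 0) := by
  have h0 : (0 : ℝ) < 1 / 2 := by norm_num
  have h1 : (1 / 2 : ℝ) < 1 := by norm_num
  have hi := integrable_posConvolution (h.integrableOn_rpow_smul h0 h1)
    (h.integrableOn_rpow_smul (sub_pos.2 h1) (sub_lt_self _ h0))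
    (ContinuousLinearMap.mul ℝ (X →L[ℝ] X))
  rw [posConvolution, integrable_indicator_iff measurableSet_Ioi] at hi
  have hG : Real.Gamma (1 / 2) * Real.Gamma (1 - 1 / 2) ≠ 0 :=
    (mul_pos (Real.Gamma_pos_of_pos h0) (Real.Gamma_pos_of_pos (sub_pos.2 h1))).ne'
  have h2 : IntegrableOn (fun x => (Real.Gamma (1 / 2) * Real.Gamma (1 - 1 / 2)) • T x)
      (Ioi 0) :=
    hi.congr_fun (fun x hx => h.integral_convolution_eq h0 h1 hx) measurableSet_Ioi
  exact (integrable_smul_iff hG _).1 h2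

/-- The function -K T(t) x is an antiderivative of T(t) x, running from -K x at 0 to 0 at infinity.
-/
theorem integral_eq [CompleteSpace X] (h : IsExpFamily K T C) : ∫ t in Ioi 0, T t = K := by
  ext x
  rw [ContinuousLinearMap.integral_apply h.integrableOn]
  have hc : ContinuousWithinAt (fun t => -K (if 0 < t then T t x else x)) (Ici 0) 0 :=
    (K.continuous.continuousAt.comp_continuousWithinAt (h.continuousOn_orbit x 0 self_mem_Ici)).neg
  have hd : ∀ t ∈ Ioi (0 : ℝ), HasDerivAt (fun t => -K (if 0 < t then T t x else x)) (T t x) t := by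
    intro t ht
    refine ((h.hasDerivAt_K ht x).neg.congr_deriv (neg_neg _)).congr_of_eventuallyEq ?_
    filter_upwards [Ioi_mem_nhds ht] with r hr
    rw [if_pos (mem_Ioi.1 hr)]
    rfl
  have hlim : Tendsto (fun t => -K (if 0 < t then T t x else x)) atTop (𝓝 0) := by
    have h1 : Tendsto (fun t : ℝ => ‖K‖ * (C * ‖x‖) * t⁻¹) atTop (𝓝 0) := by
      simpa using tendsto_inv_atTop_zero.const_mul (‖K‖ * (C * ‖x‖))
    refine squeeze_zero_norm' ?_ h1
    filter_upwards [eventually_gt_atTop 0] with t ht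
    rw [if_pos ht, norm_neg, mul_assoc]
    refine K.le_opNorm_of_le (((T t).le_of_opNorm_le (h.bound' t ht) x).trans_eq ?_)
    ring
  rw [integral_Ioi_of_hasDerivAt_of_tendsto hc hd (h.integrableOn.apply_continuousLinearMap x)
    hlim]
  simp

/-- `A^{-α} A^{-(1-α)} = A⁻¹`. -/
theorem negPow_mul_negPow [CompleteSpace X] (h : IsExpFamily K T C) {A : X →ₗ.[ℝ] X}
    (hK : HasBddInverse A K) {α : ℝ} (h0 : 0 < α) (h1 : α < 1) :
    negPow A α * negPow A (1 - α) = K := by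
  have e : ∀ β : ℝ, negPow A β = (Real.Gamma β)⁻¹ • ∫ t in Ioi (0 : ℝ), t ^ (β - 1) • T t := by
    intro β
    rw [negPow]
    congr 1
    refine setIntegral_congr_fun measurableSet_Ioi fun t ht => ?_
    simp only [h.semigroupOf_eq hK (mem_Ioi.1 ht)]
  have hG := (Real.Gamma_pos_of_pos h0).ne'
  have hG1 := (Real.Gamma_pos_of_pos (sub_pos.2 h1)).ne'
  have hconv := integral_posConvolution (h.integrableOn_rpow_smul h0 h1)
    (h.integrableOn_rpow_smul (sub_pos.2 h1) (sub_lt_self _ h0))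
    (ContinuousLinearMap.mul ℝ (X →L[ℝ] X))
  rw [setIntegral_congr_fun measurableSet_Ioi
    (fun x hx => h.integral_convolution_eq h0 h1 (mem_Ioi.1 hx)), integral_smul,
    h.integral_eq, ContinuousLinearMap.mul_apply'] at hconv
  rw [e, e, smul_mul_smul_comm, ← hconv, smul_smul]
  have : (Real.Gamma α)⁻¹ * (Real.Gamma (1 - α))⁻¹ * (Real.Gamma α * Real.Gamma (1 - α)) = 1 := by
    field_simp
  rw [this, one_smul]

end IsExpFamily

variable (A : X →ₗ.[ℝ] X) (α : ℝ)

theorem FracSpace.incl_injective : Function.Injective (FracSpace.incl A α) :=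
  Subtype.val_injective

theorem FracSpace.norm_incl_le (x : FracSpace A α) :
    ‖FracSpace.incl A α x‖ ≤ ‖negPow A α‖ * ‖x‖ := by
  refine le_of_forall_pos_le_add fun ε hε => ?_
  -- The norm of X^α is a quotient norm, so a nearly minimal representative is taken; the slack
  -- absorbs the factor ‖A^{-α}‖.
  obtain ⟨v, hv, hvn⟩ := Submodule.Quotient.norm_mk_lt (FracSpace.pow A α x)
    (show 0 < ε / (‖negPow A α‖ + 1) by positivity)
  have hx : x = (FracSpace.pow A α).symm (Submodule.Quotient.mk v) := by
    rw [hv, LinearEquiv.symm_apply_apply]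
  have hi : FracSpace.incl A α x = negPow A α v := by
    rw [hx]
    rfl
  have hn : ‖FracSpace.pow A α x‖ = ‖x‖ := rfl
  rw [hn] at hvn
  rw [hi]
  calc ‖negPow A α v‖ ≤ ‖negPow A α‖ * (‖x‖ + ε / (‖negPow A α‖ + 1)) :=
        (negPow A α).le_opNorm_of_le hvn.le
    _ = ‖negPow A α‖ * ‖x‖ + ‖negPow A α‖ / (‖negPow A α‖ + 1) * ε := by ring
    _ ≤ ‖negPow A α‖ * ‖x‖ + 1 * ε := by
        gcongr
        rw [div_le_one (by positivity)]
        linarith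
    _ = _ := by rw [one_mul]

/-- The continuous inclusion `X^α → X`. -/
noncomputable def FracSpace.inclL : FracSpace A α →L[ℝ] X :=
  (FracSpace.incl A α).mkContinuous ‖negPow A α‖ (FracSpace.norm_incl_le A α)

/-- `A⁻¹` is bounded from `X` to `X^α`. -/
theorem IsExpFamily.exists_inverse_into_fracSpace [CompleteSpace X] {A : X →ₗ.[ℝ] X}
    (h : IsExpFamily K T C) (hK : HasBddInverse A K) {α : ℝ} (h0 : 0 < α) (h1 : α < 1) :
    ∃ L : X →L[ℝ] FracSpace A α, ∀ x, FracSpace.incl A α (L x) = K x := by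
  let L : X →ₗ[ℝ] FracSpace A α :=
    ((negPow A α : X →ₗ[ℝ] X).rangeRestrict).comp (negPow A (1 - α) : X →ₗ[ℝ] X)
  refine ⟨L.mkContinuous ‖negPow A (1 - α)‖ fun x => ?_, fun x => ?_⟩
  · have e : FracSpace.pow A α (L x) = Submodule.Quotient.mk (negPow A (1 - α) x) := by
      rw [← LinearEquiv.eq_symm_apply]
      rfl
    change ‖FracSpace.pow A α (L x)‖ ≤ _
    rw [e]
    exact (Submodule.Quotient.norm_mk_le _ _).trans (ContinuousLinearMap.le_opNorm _ _)
  · rw [← h.negPow_mul_negPow hK h0 h1]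
    rfl

end FractionalPowers

/-! ### Generation of the semigroup on the phase space -/

section WaveSemigroup

variable {E E' : Type*} [NormedAddCommGroup E] [NormedSpace ℝ E] [NormedAddCommGroup E']
  [NormedSpace ℝ E']

/-- The conjugate of a `C₀` semigroup by an isomorphism. -/
def C0Semigroup.conj (S : C0Semigroup E') (Ψ : E ≃L[ℝ] E') : C0Semigroup E where
  toFun t := (Ψ.symm : E' →L[ℝ] E).comp ((S.toFun t).comp (Ψ : E →L[ℝ] E'))
  map_zero' := by
    ext z
    simp [S.apply_zero]
  map_add' s t hs ht := by
    ext z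
    simp [S.apply_add hs ht]
  continuousOn' z := Ψ.symm.continuous.comp_continuousOn (S.continuousOn' (Ψ z))

theorem C0Semigroup.conj_hasGen_iff (S : C0Semigroup E') (Ψ : E ≃L[ℝ] E') (z w : E) :
    (S.conj Ψ).HasGen z w ↔ S.HasGen (Ψ z) (Ψ w) := by
  have e : ∀ h : ℝ, h⁻¹ • ((S.conj Ψ).toFun h z - z) =
      Ψ.symm (h⁻¹ • (S.toFun h (Ψ z) - Ψ z)) := by
    intro h
    simp [conj]
  unfold HasGen
  simp only [e]
  constructor
  · intro h
    simpa [Function.comp_def] using (Ψ.continuous.tendsto _).comp h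
  · intro h
    simpa [Function.comp_def] using (Ψ.symm.continuous.tendsto _).comp h

/-- The `C₀` semigroup `(p, v) ↦ (p, S(c t) v)`. -/
def C0Semigroup.idProd (S : C0Semigroup E') (E : Type*) [NormedAddCommGroup E] [NormedSpace ℝ E]
    {c : ℝ} (hc : 0 < c) : C0Semigroup (E × E') where
  toFun t := (ContinuousLinearMap.id ℝ E).prodMap (S.toFun (c * t))
  map_zero' := by
    ext z <;> simp [S.apply_zero]
  map_add' s t hs ht := by
    ext z <;> simp [mul_add, S.apply_add (mul_nonneg hc.le hs) (mul_nonneg hc.le ht)]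
  continuousOn' z := by
    refine continuousOn_const.prodMk ((S.continuousOn' z.2).comp (f := fun t => c * t)
      (by fun_prop) fun t ht => mul_nonneg hc.le ht)

theorem C0Semigroup.idProd_apply (S : C0Semigroup E') {c : ℝ} (hc : 0 < c) (t : ℝ) (z : E × E') :
    (S.idProd E hc).toFun t z = (z.1, S.toFun (c * t) z.2) := rfl

theorem C0Semigroup.norm_idProd_le (S : C0Semigroup E') {c : ℝ} (hc : 0 < c) {M : ℝ}
    (hM : ∀ t, 0 ≤ t → ‖S.toFun t‖ ≤ M) {t : ℝ} (ht : 0 ≤ t) :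
    ‖(S.idProd E hc).toFun t‖ ≤ max 1 M := by
  refine ContinuousLinearMap.opNorm_le_bound _ (by positivity) fun z => ?_
  rw [S.idProd_apply]
  refine max_le ?_ ?_
  · calc ‖z.1‖ ≤ 1 * ‖z‖ := by rw [one_mul]; exact norm_fst_le z
      _ ≤ _ := by gcongr; exact le_max_left _ _
  · refine ((S.toFun (c * t)).le_of_opNorm_le (hM _ (mul_nonneg hc.le ht)) z.2).trans ?_
    gcongr
    · exact le_max_right _ _
    · exact norm_snd_le z

theorem C0Semigroup.idProd_hasGen_iff (S : C0Semigroup E') {c : ℝ} (hc : 0 < c) (z w : E × E') :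
    (S.idProd E hc).HasGen z w ↔ w.1 = 0 ∧ S.HasGen z.2 (c⁻¹ • w.2) := by
  have e : ∀ h : ℝ, h⁻¹ • ((S.idProd E hc).toFun h z - z) =
      (0, c • ((c * h)⁻¹ • (S.toFun (c * h) z.2 - z.2))) := by
    intro h
    rw [S.idProd_apply, smul_smul, mul_inv, mul_inv_cancel_left₀ hc.ne']
    ext <;> simp
  have hm : Tendsto (fun h : ℝ => c * h) (𝓝[>] 0) (𝓝[>] 0) := by
    refine tendsto_nhdsWithin_iff.2 ⟨?_, ?_⟩
    · have : Tendsto (fun h : ℝ => c * h) (𝓝 0) (𝓝 (c * 0)) :=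
        (continuous_const.mul continuous_id).tendsto 0
      rw [mul_zero] at this
      exact this.mono_left nhdsWithin_le_nhds
    · filter_upwards [self_mem_nhdsWithin] with h hh
      exact mul_pos hc hh
  have hm' : Tendsto (fun h : ℝ => c⁻¹ * h) (𝓝[>] 0) (𝓝[>] 0) := by
    refine tendsto_nhdsWithin_iff.2 ⟨?_, ?_⟩
    · have : Tendsto (fun h : ℝ => c⁻¹ * h) (𝓝 0) (𝓝 (c⁻¹ * 0)) :=
        (continuous_const.mul continuous_id).tendsto 0
      rw [mul_zero] at this
      exact this.mono_left nhdsWithin_le_nhds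
    · filter_upwards [self_mem_nhdsWithin] with h hh
      exact mul_pos (inv_pos.2 hc) hh
  unfold HasGen
  simp only [e]
  rw [Prod.tendsto_iff]
  refine and_congr ⟨fun h => tendsto_nhds_unique h tendsto_const_nhds, fun h => ?_⟩
    ⟨fun h => ?_, fun h => ?_⟩
  · rw [h]
    exact tendsto_const_nhds
  · have h1 := (h.comp hm').const_smul c⁻¹
    simpa [Function.comp_def, smul_smul, hc.ne', mul_inv_cancel_left₀ hc.ne'] using h1
  · have h1 := (h.comp hm).const_smul c
    simpa [Function.comp_def, smul_smul, hc.ne'] using h1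

variable {X : Type*} [NormedAddCommGroup X] [NormedSpace ℝ X]
  {K : X →L[ℝ] X} {T : ℝ → X →L[ℝ] X} {C : ℝ}

theorem IsExpFamily.norm_semigroup_le (h : IsExpFamily K T C) (t : ℝ) :
    ‖h.semigroup.toFun t‖ ≤ max 1 C := by
  refine ContinuousLinearMap.opNorm_le_bound _ (by positivity) fun x => ?_
  rw [h.semigroup_apply]
  split_ifs with h0
  · refine ((T t).le_of_opNorm_le (h.bound t h0) x).trans ?_
    gcongr
    exact le_max_right _ _
  · calc ‖x‖ = 1 * ‖x‖ := (one_mul _).symm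
      _ ≤ _ := by gcongr; exact le_max_left _ _

variable {A : X →ₗ.[ℝ] X} {α : ℝ}

/-- Both domain conditions are absorbed: y is in X^α because it equals the first component of the
value, and x + c y is in D(A) because it is a value of K. -/
theorem mem_graph_neg_waveOp_iff (hK : HasBddInverse A K) {c : ℝ} (lam : ℝ)
    (z w : Phase A α) :
    (z, w) ∈ (-(waveOp A α c lam)).graph ↔ FracSpace.incl A α w.1 = z.2 ∧
      K (lam • FracSpace.incl A α z.1 - w.2) = FracSpace.incl A α z.1 + c • z.2 := by
  rw [LinearPMap.mem_graph_iff]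
  constructor
  · rintro ⟨y, hy, hw⟩
    have hw1 : -(waveOp A α c lam ⟨y, y.2⟩) = w := hw
    have hw2 : -(-(waveSnd A α c ⟨y, y.2⟩), A (waveSum A α c ⟨y, y.2⟩) -
      lam • FracSpace.incl A α (y : Phase A α).1) = w := hw1
    have hy : (y : Phase A α) = z := hy
    subst hw2
    subst hy
    simp only [Prod.neg_mk, neg_neg, incl_waveSnd, true_and]
    rw [neg_sub, sub_sub_cancel, hK.inv_apply, coe_waveSum]
  · rintro ⟨h1, h2⟩
    rw [hK] at h2
    obtain ⟨h3, h4⟩ := h2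
    have hz : z ∈ waveDomain A α c := by
      refine ⟨?_, h3⟩
      change z.2 ∈ LinearMap.range _
      rw [← h1]
      exact w.1.2
    refine ⟨⟨z, hz⟩, rfl, ?_⟩
    change -(-(waveSnd A α c ⟨z, hz⟩), A (waveSum A α c ⟨z, hz⟩) -
      lam • FracSpace.incl A α z.1) = w
    refine Prod.ext ?_ ?_
    · rw [Prod.fst_neg, neg_neg]
      exact FracSpace.incl_injective A α h1.symm
    · have e : A (waveSum A α c ⟨z, hz⟩) = lam • FracSpace.incl A α z.1 - w.2 := h4
      rw [Prod.snd_neg, e]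
      simp

/-- The coordinates `(x + c⁻² A⁻¹ (x + c y), x + c y)` on the phase space. -/
noncomputable def phaseCoord (L : X →L[ℝ] FracSpace A α) {c : ℝ} (hc : c ≠ 0) :
    Phase A α ≃L[ℝ] Phase A α :=
  let f1 := ContinuousLinearMap.fst ℝ (FracSpace A α) X
  let f2 := ContinuousLinearMap.snd ℝ (FracSpace A α) X
  let ι := FracSpace.inclL A α
  let v := ι.comp f1 + c • f2
  let u := f1 - (c⁻¹ * c⁻¹) • L.comp f2
  ContinuousLinearEquiv.equivOfInverse ((f1 + (c⁻¹ * c⁻¹) • L.comp v).prod v)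
    (u.prod (c⁻¹ • (f2 - ι.comp u)))
    (fun z => by ext1 <;> simp [f1, f2, v, u, hc])
    (fun z => by ext1 <;> (simp [f1, f2, v, u, hc]; try module))

theorem phaseCoord_apply (L : X →L[ℝ] FracSpace A α) {c : ℝ} (hc : c ≠ 0) (z : Phase A α) :
    phaseCoord L hc z = (z.1 + (c⁻¹ * c⁻¹) • L (FracSpace.incl A α z.1 + c • z.2),
      FracSpace.incl A α z.1 + c • z.2) := rfl

/-- The bounded part of `-𝐀` in the coordinates `phaseCoord`. -/
noncomputable def phasePerturbation (L : X →L[ℝ] FracSpace A α) (c lam : ℝ) :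
    Phase A α →L[ℝ] Phase A α :=
  let f1 := ContinuousLinearMap.fst ℝ (FracSpace A α) X
  let f2 := ContinuousLinearMap.snd ℝ (FracSpace A α) X
  let ι := FracSpace.inclL A α
  let u := f1 - (c⁻¹ * c⁻¹) • L.comp f2
  let w := c⁻¹ • (f2 - ι.comp u) + (c * lam) • ι.comp u
  (-(c⁻¹ • u) + (c⁻¹ * c⁻¹) • L.comp w).prod w

theorem phasePerturbation_phaseCoord (L : X →L[ℝ] FracSpace A α) {c : ℝ} (hc : c ≠ 0) (lam : ℝ)
    (z : Phase A α) : phasePerturbation L c lam (phaseCoord L hc z) =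
      (-(c⁻¹ • z.1) + (c⁻¹ * c⁻¹) • L (z.2 + (c * lam) • FracSpace.incl A α z.1),
        z.2 + (c * lam) • FracSpace.incl A α z.1) := by
  have hι : ∀ x, FracSpace.inclL A α x = FracSpace.incl A α x := fun x => rfl
  rw [phaseCoord_apply]
  ext1 <;> simp [phasePerturbation, hι, hc]

/-- `-𝐀` generates a `C₀` semigroup on the phase space. -/
theorem exists_isGeneratedBy_neg_waveOp [CompleteSpace X] (h : IsExpFamily K T C) (hK : HasBddInverse A K)
    (h0 : 0 < α) (h1 : α < 1) {c : ℝ} (hc : 0 < c) (lam : ℝ) :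
    ∃ S : C0Semigroup (Phase A α), S.IsGeneratedBy (-(waveOp A α c lam)) := by
  obtain ⟨L, hL⟩ := h.exists_inverse_into_fracSpace hK h0 h1
  -- With v = x + c y one has v' = -cA v + y + c lam x and x' = (v - x) / c. The term v / c is not
  -- in X^α; the correction c⁻² A⁻¹ v of the first coordinate cancels it, which leaves a bounded
  -- operator added to diag(0, -cA).
  obtain ⟨V, hV⟩ := (h.semigroup.idProd (FracSpace A α) hc).exists_perturbation
    (phasePerturbation L c lam) (M := max 1 (max 1 C))
    fun t ht => h.semigroup.norm_idProd_le hc (fun t _ => h.norm_semigroup_le t) ht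
  refine ⟨V.conj (phaseCoord L hc.ne'), fun z w => ?_⟩
  refine Iff.trans ?_ (V.conj_hasGen_iff (phaseCoord L hc.ne') z w).symm
  rw [hV, C0Semigroup.idProd_hasGen_iff, h.semigroup_hasGen_iff, phasePerturbation_phaseCoord,
    mem_graph_neg_waveOp_iff hK, phaseCoord_apply, phaseCoord_apply]
  simp only [Prod.fst_sub, Prod.snd_sub]
  set ιz := FracSpace.incl A α z.1 with hιz
  set ιw := FracSpace.incl A α w.1 with hιw
  set q := ιw + c • w.2 - (z.2 + (c * lam) • ιz) with hq
  have e1 : w.1 + (c⁻¹ * c⁻¹) • L (ιw + c • w.2) -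
      (-(c⁻¹ • z.1) + (c⁻¹ * c⁻¹) • L (z.2 + (c * lam) • ιz)) =
      w.1 + (c⁻¹ * c⁻¹) • L q + c⁻¹ • z.1 := by
    rw [hq, map_sub, smul_sub]
    abel
  have e2 : w.1 + (c⁻¹ * c⁻¹) • L q + c⁻¹ • z.1 = 0 ↔
      ιw = c⁻¹ • (K (-(c⁻¹ • q)) - ιz) := by
    rw [← (FracSpace.incl_injective A α).eq_iff, map_add, map_add, map_smul, map_smul, hL,
      map_zero, ← hιz, ← hιw, add_assoc, add_eq_zero_iff_eq_neg, map_neg, map_smul, smul_sub,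
      smul_neg, smul_smul, neg_add']
  rw [e1, e2]
  have hcc : c⁻¹ • c • z.2 = z.2 := by rw [smul_smul, inv_mul_cancel₀ hc.ne', one_smul]
  -- Once the first graph equation holds, the conditions in the two coordinate systems agree term by
  -- term.
  have e3 : ιw = z.2 → -(c⁻¹ • q) = lam • ιz - w.2 := by
    intro hw
    rw [hq, hw]
    simp only [smul_sub, smul_add, smul_smul, inv_mul_cancel₀ hc.ne', inv_mul_cancel_left₀ hc.ne',
      one_smul]
    abel
  constructor
  · rintro ⟨hw, hz⟩
    rw [e3 hw, hz]
    exact ⟨by rw [hw, add_sub_cancel_left, hcc], rfl⟩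
  · rintro ⟨hw, hz⟩
    rw [hz, add_sub_cancel_left, hcc] at hw
    rw [e3 hw] at hz
    exact ⟨hw, hz⟩

end WaveSemigroup

/-! ### The spectral projection onto the eigenspace -/

section SpectralProjection

theorem cmul_eq_zero {X : Type*} [NormedAddCommGroup X] [NormedSpace ℝ X] {z : ℂ} (hz : z ≠ 0)
    {p : X × X} (h : cmul X z p = 0) : p = 0 := by
  have h1 : cmul X z⁻¹ (cmul X z p) = p := by
    rw [← clm_mul_apply, ← map_mul, inv_mul_cancel₀ hz, map_one]
    rfl
  rw [← h1, h, map_zero]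

variable {X H : Type*} [NormedAddCommGroup X] [NormedSpace ℝ X]
  [NormedAddCommGroup H] [InnerProductSpace ℝ H] {A : X →ₗ.[ℝ] X} {K : X →L[ℝ] X}

theorem HasBddInverse.mem_eigenKer_iff (hK : HasBddInverse A K) {lam : ℝ} (x : X) :
    x ∈ eigenKer A lam ↔ lam • K x = x := by
  rw [← map_smul, hK]
  rfl

/-- A self-adjoint extension makes A symmetric for the H-inner product; substituting K x and K y
moves the symmetry to the inverse. -/
theorem inner_symm_of_selfAdjoint [CompleteSpace H] {i : X →L[ℝ] H} {Ahat : H →ₗ.[ℝ] H}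
    (hsa : IsSelfAdjoint Ahat) (hext : ∀ x : A.domain, (i x, i (A x)) ∈ Ahat.graph)
    (hK : HasBddInverse A K) (x y : X) : inner ℝ (i (K x)) (i y) = inner ℝ (i x) (i (K y)) := by
  have hF : Ahat.IsFormalAdjoint Ahat := by
    have h1 := Ahat.adjoint_isFormalAdjoint hsa.dense_domain
    rwa [LinearPMap.isSelfAdjoint_def.1 hsa] at h1
  have hx := hext ⟨K x, hK.apply_mem x⟩
  have hy := hext ⟨K y, hK.apply_mem y⟩
  rw [hK.apply_apply, LinearPMap.mem_graph_iff] at hx hy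
  obtain ⟨u, hu1, hu2⟩ := hx
  obtain ⟨v, hv1, hv2⟩ := hy
  have := hF u v
  simp only at hu1 hu2 hv1 hv2
  rw [hu2, hv1, hu1, hv2] at this
  exact this.symm

/-- The compact operator lam K is the identity on this closed subspace, so its unit ball is
relatively compact. -/
theorem finiteDimensional_eigenKer (hK : HasBddInverse A K) (hcomp : IsCompactOperator K)
    (lam : ℝ) : FiniteDimensional ℝ (eigenKer A lam) := by
  have hclosed : IsClosed (eigenKer A lam : Set X) := by
    have : (eigenKer A lam : Set X) = {x | lam • K x = x} := by
      ext x
      exact hK.mem_eigenKer_iff x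
    rw [this]
    exact isClosed_eq (by fun_prop) continuous_id
  have hmap : ∀ v ∈ eigenKer A lam, ((lam • K : X →L[ℝ] X) : X →ₗ[ℝ] X) v ∈ eigenKer A lam := by
    intro v hv
    have : lam • K v = v := (hK.mem_eigenKer_iff v).1 hv
    change lam • K v ∈ _
    rwa [this]
  have h1 : IsCompactOperator ((lam • K : X →L[ℝ] X) : X →ₗ[ℝ] X) := hcomp.smul lam
  have h2 := h1.restrict hmap hclosed
  refine FiniteDimensional.of_isCompactOperator_id (𝕜 := ℝ) ?_
  convert! h2 using 1
  ext x
  exact ((hK.mem_eigenKer_iff (x : X)).1 x.2).symm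

/-- The `H`-orthogonal projection of `X` onto a finite-dimensional subspace. -/
theorem exists_orthogonal_projection {i : X →L[ℝ] H} (hi : Function.Injective i)
    (V : Submodule ℝ X) [FiniteDimensional ℝ V] :
    ∃ P : X →L[ℝ] X, (∀ x, P x ∈ V) ∧ (∀ x ∈ V, P x = x) ∧
      ∀ x, ∀ e ∈ V, inner ℝ (i (P x)) (i e) = inner ℝ (i x) (i e) := by
  let W : Submodule ℝ H := V.map (i : X →ₗ[ℝ] H)
  let e : V ≃ₗ[ℝ] W := Submodule.equivMapOfInjective (i : X →ₗ[ℝ] H) hi V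
  have : FiniteDimensional ℝ W := Module.Finite.equiv e
  let e' : W →L[ℝ] V := LinearMap.toContinuousLinearMap (e.symm : W →ₗ[ℝ] V)
  let P : X →L[ℝ] X := V.subtypeL.comp (e'.comp (W.orthogonalProjectionOnto.comp i))
  have hP : ∀ x, i (P x) = W.orthogonalProjectionOnto (i x) := by
    intro x
    have h1 : e (e.symm (W.orthogonalProjectionOnto (i x))) = W.orthogonalProjectionOnto (i x) :=
      e.apply_symm_apply _
    have h2 : ∀ v : V, ((e v : W) : H) = i v := fun v => rfl
    rw [← h1, h2]
    rfl
  have hmem : ∀ x ∈ V, i x ∈ W := fun x hx => ⟨x, hx, rfl⟩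
  refine ⟨P, fun x => Subtype.mem _, fun x hx => ?_, fun x y hy => ?_⟩
  · apply hi
    rw [hP]
    exact Submodule.starProjection_eq_self_iff.2 (hmem x hx)
  · rw [hP]
    have h0 := Submodule.starProjection_inner_eq_zero (K := W) (i x) (i y) (hmem y hy)
    rw [inner_sub_left, sub_eq_zero] at h0
    exact h0.symm

/-- A projection onto `ker (lam I - A)` that reduces `A`. -/
structure IsReducing (K : X →L[ℝ] X) (V : Submodule ℝ X) (lam : ℝ) (P : X →L[ℝ] X) : Prop where
  mem : ∀ x, P x ∈ V
  apply_of_mem : ∀ x ∈ V, P x = x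
  apply_K : ∀ x, P (K x) = lam⁻¹ • P x

/-- For the H-orthogonal projection, P K x - lam⁻¹ P x lies in the eigenspace and, by symmetry of K,
is H-orthogonal to it. -/
theorem exists_isReducing [CompleteSpace H] {i : X →L[ℝ] H} (hi : Function.Injective i)
    {Ahat : H →ₗ.[ℝ] H} (hsa : IsSelfAdjoint Ahat)
    (hext : ∀ x : A.domain, (i x, i (A x)) ∈ Ahat.graph) (hK : HasBddInverse A K)
    (hcomp : IsCompactOperator K) {lam : ℝ} (hlam : lam ≠ 0) :
    ∃ P, IsReducing K (eigenKer A lam) lam P := by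
  have := finiteDimensional_eigenKer hK hcomp lam
  obtain ⟨P, h1, h2, h3⟩ := exists_orthogonal_projection hi (eigenKer A lam)
  refine ⟨P, h1, h2, fun x => ?_⟩
  have hmem : P (K x) - lam⁻¹ • P x ∈ eigenKer A lam :=
    Submodule.sub_mem _ (h1 _) (Submodule.smul_mem _ _ (h1 _))
  have horth : ∀ e ∈ eigenKer A lam, inner ℝ (i (P (K x) - lam⁻¹ • P x)) (i e) = 0 := by
    intro e he
    have hKe : K e = lam⁻¹ • e := by
      rw [eq_inv_smul_iff₀ hlam]
      exact (hK.mem_eigenKer_iff e).1 he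
    rw [map_sub, map_smul, inner_sub_left, inner_smul_left, h3 _ e he, h3 _ e he,
      inner_symm_of_selfAdjoint hsa hext hK, hKe, map_smul, inner_smul_right]
    simp
  have h4 := inner_self_eq_zero.1 (horth _ hmem)
  exact sub_eq_zero.1 (hi (h4.trans (map_zero i).symm))

variable {lam : ℝ} {P : X →L[ℝ] X}

theorem IsReducing.K_apply (h : IsReducing K (eigenKer A lam) lam P) (hK : HasBddInverse A K)
    (hlam : lam ≠ 0) (x : X) : K (P x) = lam⁻¹ • P x := by
  rw [eq_inv_smul_iff₀ hlam]
  exact (hK.mem_eigenKer_iff _).1 (h.mem x)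

/-- The restriction of `K` to `ker P`. -/
def IsReducing.restrictKer {V : Submodule ℝ X} (h : IsReducing K V lam P) :
    LinearMap.ker (P : X →ₗ[ℝ] X) →L[ℝ] LinearMap.ker (P : X →ₗ[ℝ] X) :=
  (K.comp (LinearMap.ker (P : X →ₗ[ℝ] X)).subtypeL).codRestrict _ fun x => by
    have hx : P x = 0 := x.2
    change P (K x) = 0
    rw [h.apply_K, hx, smul_zero]

theorem IsReducing.hasBddInverse_partIn {V : Submodule ℝ X} (h : IsReducing K V lam P)
    (hK : HasBddInverse A K) :
    HasBddInverse (partIn A (LinearMap.ker (P : X →ₗ[ℝ] X))) h.restrictKer := by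
  intro x y
  have h1 := hK (x : X) (y : X)
  constructor
  · intro hxy
    obtain ⟨hy, e⟩ := h1.1 (congrArg Subtype.val hxy)
    exact ⟨⟨hy, by rw [e]; exact x.2⟩, Subtype.ext e⟩
  · rintro ⟨hy, e⟩
    exact Subtype.ext (h1.2 ⟨hy.1, congrArg Subtype.val e⟩)


/-- Fredholm alternative for the compact operator K (1 - P). An eigenvector for lam⁻¹ would lie both
in ker P and in the eigenspace, hence vanish; so lam⁻¹ - K (1 - P) is onto. -/
theorem IsReducing.exists_sub_smul_eq [CompleteSpace X] (h : IsReducing K (eigenKer A lam) lam P)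
    (hK : HasBddInverse A K) (hcomp : IsCompactOperator K) (hlam : lam ≠ 0) {q : X}
    (hq : P q = 0) : ∃ p, P p = 0 ∧ p - lam • K p = q := by
  have hPP : ∀ x, P (P x) = P x := fun x => h.apply_of_mem _ (h.mem x)
  let N : X →L[ℝ] X := K.comp (ContinuousLinearMap.id ℝ X - P)
  have hN : ∀ x, N x = K (x - P x) := fun x => rfl
  have hNc : IsCompactOperator N := hcomp.comp_clm _
  have hPN : ∀ x, P (N x) = 0 := fun x => by
    rw [hN, h.apply_K, map_sub, hPP, sub_self, smul_zero]
  rcases hNc.hasEigenvalue_or_mem_resolventSet (inv_ne_zero hlam) with he | hr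
  · exfalso
    obtain ⟨v, hv⟩ := he.exists_hasEigenvector
    have hv1 : N v = lam⁻¹ • v := hv.apply_eq_smul
    have hPv : P v = 0 := by
      have := hPN v
      rw [hv1, map_smul] at this
      exact (smul_eq_zero.1 this).resolve_left (inv_ne_zero hlam)
    rw [hN, hPv, sub_zero, eq_inv_smul_iff₀ hlam] at hv1
    have hmem := (hK.mem_eigenKer_iff v).2 hv1
    rw [h.apply_of_mem v hmem] at hPv
    exact hv.2 hPv
  · obtain ⟨u, hu⟩ := hr
    have hsol : ∀ y, ∃ x, lam⁻¹ • x - N x = y := fun y => by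
      refine ⟨u.inv y, ?_⟩
      have e : ((u : X →L[ℝ] X) * u.inv) y = y := by rw [u.val_inv]; rfl
      rw [hu] at e
      rwa [Algebra.algebraMap_eq_smul_one] at e
    obtain ⟨x, hx⟩ := hsol (lam⁻¹ • q)
    have hPx : P x = 0 := by
      have := congrArg P hx
      rw [map_sub, hPN, sub_zero, map_smul, map_smul, hq, smul_zero] at this
      exact (smul_eq_zero.1 this).resolve_left (inv_ne_zero hlam)
    refine ⟨x, hPx, ?_⟩
    rw [hN, hPx, sub_zero, eq_inv_smul_iff₀ hlam, smul_sub, smul_smul, mul_inv_cancel₀ hlam,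
      one_smul] at hx
    exact hx

/-- By the bounded inverse theorem, membership in the resolvent set is bijectivity of 1 - μK, which
can be tested separately on the eigenspace and on ker P. -/
theorem HasBddInverse.mem_spec_iff [CompleteSpace X] (hK : HasBddInverse A K) (μ : ℂ) :
    μ ∈ spec A ↔ ¬ Function.Bijective fun p : X × X => p - cmul X μ (diag K p) := by
  have h1 : (μ ∈ spec A) = ¬ ∃ R, IsResolventAt A μ R := rfl
  rw [h1, hK.exists_isResolventAt_iff, ContinuousLinearMap.isUnit_iff_bijective]
  rfl

/-- On the eigenspace 1 - μK acts as the scalar 1 - μ / lam, nonzero for μ ≠ lam; kernel and range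
questions then take place in ker P. -/
theorem IsReducing.diag_sub (h : IsReducing K (eigenKer A lam) lam P) (μ : ℂ) (p : X × X) :
    diag P (p - cmul X μ (diag K p)) = cmul X (1 - μ * (lam⁻¹ : ℝ)) (diag P p) := by
  have c := congrArg (fun F : X × X →L[ℝ] X × X => F (diag K p)) (commute_cmul_diag μ P).eq
  simp only [clm_mul_apply] at c
  have e : diag P (diag K p) = cmul X (lam⁻¹ : ℝ) (diag P p) := by
    rw [diag_apply, diag_apply, cmul_apply]
    simp [h.apply_K, diag_apply]
  rw [map_sub, ← c, e, map_sub, map_mul, map_one]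
  rfl

theorem one_sub_mul_inv_ne_zero {lam : ℝ} (hlam : lam ≠ 0) {μ : ℂ} (hμ : μ ≠ lam) :
    1 - μ * ((lam⁻¹ : ℝ) : ℂ) ≠ 0 := by
  intro h
  apply hμ
  have h0 : (lam : ℂ) ≠ 0 := by exact_mod_cast hlam
  rw [sub_eq_zero, Complex.ofReal_inv] at h
  field_simp at h
  exact h.symm

/-- The part of `A` in the complement of the eigenspace has spectrum `σ(A) \ {lam}`. -/
theorem IsReducing.spec_partIn [CompleteSpace X] (h : IsReducing K (eigenKer A lam) lam P)
    (hK : HasBddInverse A K) (hcomp : IsCompactOperator K) (hlam : lam ≠ 0)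
    {y₀ : X} (hy₀ : y₀ ∈ eigenKer A lam) (hne : y₀ ≠ 0) :
    spec (partIn A (LinearMap.ker (P : X →ₗ[ℝ] X))) = spec A \ {(lam : ℂ)} := by
  set V := LinearMap.ker (P : X →ₗ[ℝ] X) with hV
  have hVc : IsClosed (V : Set X) := P.isClosed_ker
  have : CompleteSpace V := hVc.completeSpace_coe
  have hPP : ∀ x, P (P x) = P x := fun x => h.apply_of_mem _ (h.mem x)
  have hKV := h.hasBddInverse_partIn hK
  set KV := h.restrictKer with hKVd
  let j : V × V → X × X := fun p => (p.1, p.2)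
  have hj : Function.Injective j := fun p q hpq => by
    have h1 := Prod.ext_iff.1 hpq
    exact Prod.ext (Subtype.ext h1.1) (Subtype.ext h1.2)
  have hjU : ∀ (μ : ℂ) (p : V × V), j (p - cmul V μ (diag KV p)) =
      j p - cmul X μ (diag K (j p)) := by
    intro μ p
    rw [cmul_apply, cmul_apply]
    rfl
  have hjP : ∀ p, diag P (j p) = 0 := fun p => Prod.ext p.1.2 p.2.2
  have hjs : ∀ q, diag P q = 0 → ∃ p, j p = q := fun q hq =>
    ⟨(⟨q.1, (Prod.ext_iff.1 hq).1⟩, ⟨q.2, (Prod.ext_iff.1 hq).2⟩), rfl⟩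
  have hlamspec : (lam : ℂ) ∈ spec A := by
    rw [hK.mem_spec_iff]
    intro hb
    have h1 : (fun p : X × X => p - cmul X lam (diag K p)) (y₀, 0) =
        (fun p : X × X => p - cmul X lam (diag K p)) 0 := by
      simp only [cmul_apply, diag_apply]
      simp [(hK.mem_eigenKer_iff y₀).1 hy₀]
      rfl
    exact hne (Prod.ext_iff.1 (hb.1 h1)).1
  ext μ
  rw [Set.mem_sdiff, mem_singleton_iff, hKV.mem_spec_iff, hK.mem_spec_iff, ← not_or, not_iff_not]
  constructor
  · rintro ⟨hinj, hsurj⟩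
    by_cases hμ : μ = lam
    · exact Or.inr hμ
    have hz := one_sub_mul_inv_ne_zero hlam hμ
    refine Or.inl ⟨?_, fun q => ?_⟩
    · let U : X × X →L[ℝ] X × X := 1 - cmul X μ * diag K
      refine (injective_iff_map_eq_zero U).2 fun p hp => ?_
      have hp : p - cmul X μ (diag K p) = 0 := hp
      have h1 := h.diag_sub μ p
      rw [hp, map_zero] at h1
      obtain ⟨r, rfl⟩ := hjs p (cmul_eq_zero hz h1.symm)
      rw [← hjU] at hp
      have h2 : (fun p : V × V => p - cmul V μ (diag KV p)) r =
          (fun p : V × V => p - cmul V μ (diag KV p)) 0 := by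
        apply hj
        simp only [map_zero, sub_zero]
        exact hp
      rw [hinj h2]
      rfl
    -- The right-hand side is split: its ker P part is solved by hypothesis, its eigenspace part by
    -- dividing by 1 - μ / lam.
    · have hq : diag P (q - diag P q) = 0 := by
        simp [diag_apply, hPP]
      obtain ⟨r, hr⟩ := hjs _ hq
      obtain ⟨p, hp⟩ := hsurj r
      set z := 1 - μ * ((lam⁻¹ : ℝ) : ℂ) with hzd
      refine ⟨j p + cmul X z⁻¹ (diag P q), ?_⟩
      have e1 : j p - cmul X μ (diag K (j p)) = q - diag P q := by
        rw [← hjU, ← hr]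
        exact congrArg j hp
      have e2 : cmul X z⁻¹ (diag P q) - cmul X μ (diag K (cmul X z⁻¹ (diag P q))) =
          diag P q := by
        have c := congrArg (fun F : X × X →L[ℝ] X × X => F (diag P q))
          (commute_cmul_diag z⁻¹ K).eq
        simp only [clm_mul_apply] at c
        have e : diag K (diag P q) = cmul X (lam⁻¹ : ℝ) (diag P q) := by
          rw [diag_apply, diag_apply, cmul_apply]
          simp [h.K_apply hK hlam]
        rw [← c, e]
        have e3 : cmul X z⁻¹ - cmul X μ * (cmul X z⁻¹ * cmul X (lam⁻¹ : ℝ)) = 1 := by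
          rw [← map_mul, ← map_mul, ← map_sub, ← map_one (cmul X)]
          congr 1
          rw [show z⁻¹ - μ * (z⁻¹ * ((lam⁻¹ : ℝ) : ℂ)) = z⁻¹ * z by rw [hzd]; ring]
          exact inv_mul_cancel₀ hz
        exact congrArg (fun F : X × X →L[ℝ] X × X => F (diag P q)) e3
      dsimp only
      rw [map_add, map_add, add_sub_add_comm, e1, e2, sub_add_cancel]
  · rintro (⟨hinj, hsurj⟩ | rfl)
    · have hμ : μ ≠ lam := by
        rintro rfl
        exact (hK.mem_spec_iff _).1 hlamspec ⟨hinj, hsurj⟩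
      refine ⟨fun p r hpr => hj (hinj ?_), fun q => ?_⟩
      · simp only [← hjU]
        exact congrArg j hpr
      · obtain ⟨p, hp⟩ := hsurj (j q)
        have h1 := h.diag_sub μ p
        dsimp only at hp
        rw [hp, hjP] at h1
        obtain ⟨r, rfl⟩ := hjs p (cmul_eq_zero (one_sub_mul_inv_ne_zero hlam hμ) h1.symm)
        refine ⟨r, hj ?_⟩
        rw [hjU]
        exact hp
    -- At μ = lam the scalar is real, so the map splits into two copies of 1 - lam K on ker P; this
    -- is injective since ker P meets the eigenspace only in 0, and onto by the Fredholm
    -- alternative.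
    · have hU : ∀ p : V × V, p - cmul V lam (diag KV p) =
          (p.1 - lam • KV p.1, p.2 - lam • KV p.2) := by
        intro p
        rw [cmul_apply]
        simp [diag_apply]
        rfl
      have hinjV : ∀ v : V, v - lam • KV v = 0 → v = 0 := by
        intro v hv
        have h1 : (v : X) - lam • K v = 0 := congrArg Subtype.val hv
        have h2 : (v : X) ∈ eigenKer A lam :=
          (hK.mem_eigenKer_iff _).2 (sub_eq_zero.1 h1).symm
        have h3 : P v = 0 := v.2
        rw [h.apply_of_mem _ h2] at h3
        exact Subtype.ext h3
      have hsurjV : ∀ v : V, ∃ w : V, w - lam • KV w = v := by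
        intro v
        obtain ⟨p, hp1, hp2⟩ := h.exists_sub_smul_eq hK hcomp hlam (q := v) v.2
        exact ⟨⟨p, hp1⟩, Subtype.ext hp2⟩
      refine ⟨?_, fun q => ?_⟩
      · let U : V × V →L[ℝ] V × V := 1 - cmul V lam * diag KV
        refine (injective_iff_map_eq_zero U).2 fun p hp => ?_
        have hp : p - cmul V lam (diag KV p) = 0 := hp
        rw [hU] at hp
        exact Prod.ext (hinjV _ (Prod.ext_iff.1 hp).1) (hinjV _ (Prod.ext_iff.1 hp).2)
      · obtain ⟨p1, hp1⟩ := hsurjV q.1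
        obtain ⟨p2, hp2⟩ := hsurjV q.2
        refine ⟨(p1, p2), ?_⟩
        dsimp only
        rw [hU, hp1, hp2]

theorem isCompactOperator_inverse {R : X × X →L[ℝ] X × X} (hR : IsCompactOperator R) :
    IsCompactOperator (-((ContinuousLinearMap.fst ℝ X X).comp
      (R.comp (ContinuousLinearMap.inl ℝ X X)))) :=
  ((hR.comp_clm (ContinuousLinearMap.inl ℝ X X)).clm_comp (ContinuousLinearMap.fst ℝ X X)).neg

theorem IsReducing.isSpectralProjection [CompleteSpace X]
    (h : IsReducing K (eigenKer A lam) lam P) (hK : HasBddInverse A K)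
    (hcomp : IsCompactOperator K) (hlam : lam ≠ 0) {y₀ : X} (hy₀ : y₀ ∈ eigenKer A lam)
    (hne : y₀ ≠ 0) : IsSpectralProjection A lam P where
  mem_ker := h.mem
  apply_of_mem := h.apply_of_mem
  invariant v hv := by
    have h1 := h.apply_K (A v)
    rw [hK.inv_apply, hv] at h1
    exact (smul_eq_zero.1 h1.symm).resolve_left (inv_ne_zero hlam)
  spec_part := h.spec_partIn hK hcomp hlam hy₀ hne

end SpectralProjection

/-! ### Linear observables of Duhamel solutions -/

section Dynamics

variable {E F : Type*} [NormedAddCommGroup E] [NormedSpace ℝ E]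
  [NormedAddCommGroup F] [NormedSpace ℝ F] (S : C0Semigroup E) {φ : E →L[ℝ] F}

/-- The solution of `w' = G w + f` with `w(0) = z`. -/
noncomputable def C0Semigroup.duhamelSolution (z f : E) (t : ℝ) : E :=
  S.toFun t z + ∫ s in (0 : ℝ)..t, S.toFun (max s 0) f

theorem C0Semigroup.duhamelSolution_zero (z f : E) : S.duhamelSolution z f 0 = z := by
  simp [duhamelSolution, S.apply_zero]

theorem C0Semigroup.continuousOn_duhamelSolution (z f : E) :
    ContinuousOn (S.duhamelSolution z f) (Ici 0) :=
  (S.continuousOn' z).add (intervalIntegral.continuous_primitive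
    (fun _ _ => (S.continuous_max f).intervalIntegrable _ _) 0).continuousOn

theorem C0Semigroup.integral_sub_eq (f : E) (t' t : ℝ) :
    ∫ τ in t'..t, S.toFun (t - τ) f = ∫ s in (0 : ℝ)..t - t', S.toFun s f := by
  rw [intervalIntegral.integral_comp_sub_left (fun s => S.toFun s f) t, sub_self]

variable [CompleteSpace E] [CompleteSpace F]

/-- The time integral of an orbit lies in the domain of the generator for every initial value, so no
density or regularity argument is needed. -/
theorem C0Semigroup.apply_sub_eq_integral {κ : ℝ} (hφ : ∀ x y, S.HasGen x y → φ y = -(κ • φ x))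
    (z : E) {t : ℝ} (ht : 0 ≤ t) :
    φ (S.toFun t z) - φ z = -(κ • ∫ s in (0 : ℝ)..t, φ (S.toFun s z)) := by
  rw [ContinuousLinearMap.intervalIntegral_comp_comm φ (S.intervalIntegrable z le_rfl ht),
    ← hφ _ _ (S.hasGen_integral z ht), map_sub]

/-- If `φ ∘ G = -κ φ` on the domain of the generator `G`, then `φ ∘ S(t) = exp (-κ t) φ`. -/
theorem C0Semigroup.apply_eq_exp_smul {κ : ℝ} (hφ : ∀ x y, S.HasGen x y → φ y = -(κ • φ x))
    (z : E) {t : ℝ} (ht : 0 ≤ t) : φ (S.toFun t z) = Real.exp (-κ * t) • φ z := by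
  have hc : Continuous fun s : ℝ => φ (S.toFun (max s 0) z) :=
    φ.continuous.comp (S.continuous_max z)
  -- The integral form supplies a function that is differentiable on all of ℝ and agrees with φ
  -- (S(t) z) for t ≥ 0; multiplied by exp (κ t) it is constant on [0, t].
  let v : ℝ → F := fun t => φ z - κ • ∫ s in (0 : ℝ)..t, φ (S.toFun (max s 0) z)
  have hv : ∀ t, 0 ≤ t → v t = φ (S.toFun t z) := by
    intro t ht
    have e : ∫ s in (0 : ℝ)..t, φ (S.toFun (max s 0) z) = ∫ s in (0 : ℝ)..t, φ (S.toFun s z) := by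
      refine intervalIntegral.integral_congr fun s hs => ?_
      rw [uIcc_of_le ht] at hs
      rw [max_eq_left hs.1]
    have := S.apply_sub_eq_integral hφ z ht
    simp only [v, e]
    rw [sub_eq_iff_eq_add] at this
    rw [this]
    abel
  have hvd : ∀ t, HasDerivAt v (-(κ • φ (S.toFun (max t 0) z))) t := fun t =>
    ((hc.integral_hasStrictDerivAt 0 t).hasDerivAt.const_smul κ).const_sub _
  have hg : ∀ s, HasDerivAt (fun s => Real.exp (κ * s) • v s)
      (Real.exp (κ * s) • -(κ • φ (S.toFun (max s 0) z)) + (Real.exp (κ * s) * κ) • v s) s := by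
    intro s
    have h1 : HasDerivAt (fun s => Real.exp (κ * s)) (Real.exp (κ * s) * κ) s := by
      simpa using ((hasDerivAt_id s).const_mul κ).exp
    exact h1.smul (hvd s)
  have hconst := constant_of_has_deriv_right_zero (f := fun s => Real.exp (κ * s) • v s)
    (a := 0) (b := t) (fun s _ => (hg s).continuousAt.continuousWithinAt) (fun s hs => by
      have h1 := (hg s).hasDerivWithinAt (s := Ici s)
      rw [max_eq_left hs.1, ← hv s hs.1, smul_neg, smul_smul, neg_add_cancel] at h1
      exact h1) t (right_mem_Icc.2 ht)
  rw [hv t ht, hv 0 le_rfl, S.apply_zero, mul_zero, Real.exp_zero, one_smul] at hconst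
  rw [← hconst, smul_smul, ← Real.exp_add]
  simp

theorem C0Semigroup.duhamelSolution_eq (z f : E) {t' t : ℝ} (ht' : 0 ≤ t') (ht : t' ≤ t) :
    S.duhamelSolution z f t = S.toFun (t - t') (S.duhamelSolution z f t') +
      ∫ τ in t'..t, S.toFun (t - τ) f := by
  have h0 : 0 ≤ t - t' := sub_nonneg.2 ht
  have hadj := intervalIntegral.integral_add_adjacent_intervals
    (S.intervalIntegrable f (le_refl (0 : ℝ)) h0) (S.intervalIntegrable f h0 (ht'.trans ht))
  rw [S.integral_sub_eq, duhamelSolution, duhamelSolution,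
    S.integral_max f le_rfl (ht'.trans ht), S.integral_max f le_rfl ht', map_add,
    S.apply_integral f h0 ht', ← S.apply_add h0 ht', sub_add_cancel, add_sub_cancel, ← hadj]
  abel

theorem C0Semigroup.apply_duhamelSolution {κ : ℝ} (hφ : ∀ x y, S.HasGen x y → φ y = -(κ • φ x))
    (z f : E) {t : ℝ} (ht : 0 ≤ t) : φ (S.duhamelSolution z f t) =
      Real.exp (-κ * t) • φ z + (∫ s in (0 : ℝ)..t, Real.exp (-κ * s)) • φ f := by
  rw [duhamelSolution, S.integral_max f le_rfl ht, map_add, S.apply_eq_exp_smul hφ z ht,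
    ← ContinuousLinearMap.intervalIntegral_comp_comm φ (S.intervalIntegrable f le_rfl ht),
    ← intervalIntegral.integral_smul_const]
  congr 1
  refine intervalIntegral.integral_congr fun s hs => ?_
  rw [uIcc_of_le ht] at hs
  exact S.apply_eq_exp_smul hφ f hs.1

theorem integral_exp_neg_mul_le {κ : ℝ} (hκ : 0 < κ) {t : ℝ} (ht : 0 ≤ t) :
    0 ≤ ∫ s in (0 : ℝ)..t, Real.exp (-κ * s) ∧ ∫ s in (0 : ℝ)..t, Real.exp (-κ * s) ≤ κ⁻¹ := by
  refine ⟨intervalIntegral.integral_nonneg ht fun s _ => (Real.exp_pos _).le, ?_⟩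
  have hd : ∀ s ∈ uIcc 0 t, HasDerivAt (fun s => -(κ⁻¹ * Real.exp (-κ * s)))
      (Real.exp (-κ * s)) s := by
    intro s _
    have h1 : HasDerivAt (fun s => Real.exp (-κ * s)) (Real.exp (-κ * s) * -κ) s := by
      simpa using ((hasDerivAt_id s).const_mul (-κ)).exp
    refine ((h1.const_mul κ⁻¹).neg).congr_deriv ?_
    field_simp
  rw [intervalIntegral.integral_eq_sub_of_hasDerivAt hd
    (Continuous.intervalIntegrable (by fun_prop) _ _)]
  have : 0 ≤ κ⁻¹ * Real.exp (-κ * t) := by positivity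
  simp only [mul_zero, Real.exp_zero, mul_one]
  linarith

end Dynamics

/-! ### Projected dynamics of the damped wave equation -/

section Wave

variable {X : Type*} [NormedAddCommGroup X] [NormedSpace ℝ X]
  {A : X →ₗ.[ℝ] X} {K : X →L[ℝ] X} {α c lam : ℝ} {P : X →L[ℝ] X} {y₀ : X}

theorem isAdmissibleNonlinearity_const (y₀ : X) :
    IsAdmissibleNonlinearity fun _ : FracSpace A α => y₀ where
  locallyLipschitz x := ⟨univ, isOpen_univ, mem_univ x, 1, one_pos, fun x₁ _ x₂ _ => by
    rw [sub_self, norm_zero, one_mul]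
    exact norm_nonneg _⟩
  compact V _ := isCompact_singleton.closure_of_subset (image_subset_iff.2 fun _ _ => rfl)
  bounded := ⟨‖y₀‖ + 1, by positivity, fun _ => by linarith⟩

/-- `(x, y) ↦ P y`. -/
noncomputable def velocityProj (A : X →ₗ.[ℝ] X) (α : ℝ) (P : X →L[ℝ] X) : Phase A α →L[ℝ] X :=
  P.comp (ContinuousLinearMap.snd ℝ (FracSpace A α) X)

/-- `(x, y) ↦ c lam P x + P y`. -/
noncomputable def conservedProj (A : X →ₗ.[ℝ] X) (α c lam : ℝ) (P : X →L[ℝ] X) :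
    Phase A α →L[ℝ] X :=
  (c * lam) • P.comp ((FracSpace.inclL A α).comp
    (ContinuousLinearMap.fst ℝ (FracSpace A α) X)) + velocityProj A α P

theorem velocityProj_apply (z : Phase A α) : velocityProj A α P z = P z.2 := rfl

theorem conservedProj_apply (z : Phase A α) : conservedProj A α c lam P z =
    (c * lam) • P (FracSpace.incl A α z.1) + P z.2 := rfl

/-- Applying P to K (lam x - w₂) = x + c y and using P K = lam⁻¹ P, the two copies of P x cancel:
this is the resonance, and only the damping remains. -/
theorem velocityProj_of_hasGen
    (hP : IsReducing K (eigenKer A lam) lam P) (hK : HasBddInverse A K) (hlam : lam ≠ 0)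
    (hgen : ∃ S : C0Semigroup (Phase A α), S.IsGeneratedBy (-(waveOp A α c lam)))
    (z w : Phase A α)
    (h : (semigroupOf (-(waveOp A α c lam))).HasGen z w) :
    velocityProj A α P w = -((c * lam) • velocityProj A α P z) := by
  rw [semigroupOf_hasGen_iff hgen, mem_graph_neg_waveOp_iff hK] at h
  have h1 := congrArg P h.2
  rw [hP.apply_K, map_sub, map_smul, map_add, map_smul, smul_sub, smul_smul,
    inv_mul_cancel₀ hlam, one_smul, sub_eq_add_neg, add_right_inj, ← smul_neg,
    inv_smul_eq_iff₀ hlam, smul_smul, neg_eq_iff_eq_neg, mul_comm] at h1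
  exact h1

/-- The first component of the generator contributes c lam P y, the second -c lam P y. The result is
written with rate 0 to fit the general observable lemma. -/
theorem conservedProj_of_hasGen
    (hP : IsReducing K (eigenKer A lam) lam P) (hK : HasBddInverse A K) (hlam : lam ≠ 0)
    (hgen : ∃ S : C0Semigroup (Phase A α), S.IsGeneratedBy (-(waveOp A α c lam)))
    (z w : Phase A α)
    (h : (semigroupOf (-(waveOp A α c lam))).HasGen z w) :
    conservedProj A α c lam P w = -((0 : ℝ) • conservedProj A α c lam P z) := by
  have h1 := velocityProj_of_hasGen hP hK hlam hgen z w h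
  rw [semigroupOf_hasGen_iff hgen, mem_graph_neg_waveOp_iff hK] at h
  rw [velocityProj_apply, velocityProj_apply] at h1
  rw [conservedProj_apply, h.1, h1, add_neg_cancel, zero_smul, neg_zero]

variable [CompleteSpace X]

/-- The forcing does not depend on the solution, so the mild equation from time 0 is an explicit
formula; it settles existence as well. -/
theorem isMildSolution_iff {w : ℝ → Phase A α} :
    IsMildSolution c lam (fun _ : FracSpace A α => y₀) (Ici 0) w ↔
      EqOn w ((semigroupOf (-(waveOp A α c lam))).duhamelSolution (w 0) (0, y₀)) (Ici 0) := by
  set S := semigroupOf (-(waveOp A α c lam)) with hS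
  constructor
  · intro h t ht
    rcases (mem_Ici.1 ht).lt_or_eq with h0 | h0
    · have := h.variation_of_constants 0 self_mem_Ici t ht h0
      rw [S.duhamelSolution_eq _ _ le_rfl h0.le, S.duhamelSolution_zero]
      exact this
    · rw [← h0, S.duhamelSolution_zero]
  · intro h
    refine ⟨(S.continuousOn_duhamelSolution _ _).congr h, fun t' ht' t ht htt => ?_⟩
    rw [h ht, h ht']
    exact S.duhamelSolution_eq _ _ ht' htt.le

theorem conservedProj_mildSolution
    (hP : IsReducing K (eigenKer A lam) lam P) (hK : HasBddInverse A K) (hlam : lam ≠ 0)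
    (hgen : ∃ S : C0Semigroup (Phase A α), S.IsGeneratedBy (-(waveOp A α c lam)))
    (hy₀ : y₀ ∈ eigenKer A lam) {w : ℝ → Phase A α}
    (hw : IsMildSolution c lam (fun _ : FracSpace A α => y₀) (Ici 0) w) {t : ℝ} (ht : 0 ≤ t) :
    conservedProj A α c lam P (w t) = conservedProj A α c lam P (w 0) + t • y₀ := by
  rw [isMildSolution_iff.1 hw ht, C0Semigroup.apply_duhamelSolution _
    (conservedProj_of_hasGen hP hK hlam hgen) _ _ ht]
  simp [conservedProj_apply, hP.apply_of_mem y₀ hy₀]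

theorem norm_velocityProj_mildSolution_le
    (hP : IsReducing K (eigenKer A lam) lam P) (hK : HasBddInverse A K) (hlam : lam ≠ 0)
    (hgen : ∃ S : C0Semigroup (Phase A α), S.IsGeneratedBy (-(waveOp A α c lam)))
    (hc : 0 < c) (hlam0 : 0 < lam)
    (hy₀ : y₀ ∈ eigenKer A lam) {w : ℝ → Phase A α}
    (hw : IsMildSolution c lam (fun _ : FracSpace A α => y₀) (Ici 0) w) {t : ℝ} (ht : 0 ≤ t) :
    ‖velocityProj A α P (w t)‖ ≤ ‖velocityProj A α P (w 0)‖ + (c * lam)⁻¹ * ‖y₀‖ := by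
  have hκ : 0 < c * lam := mul_pos hc hlam0
  obtain ⟨h0, h1⟩ := integral_exp_neg_mul_le hκ ht
  have e : velocityProj A α P ((0, y₀) : Phase A α) = y₀ := hP.apply_of_mem y₀ hy₀
  rw [isMildSolution_iff.1 hw ht, C0Semigroup.apply_duhamelSolution _
    (velocityProj_of_hasGen hP hK hlam hgen) _ _ ht, e]
  refine (norm_add_le _ _).trans (add_le_add ?_ ?_)
  · rw [norm_smul, Real.norm_eq_abs, abs_of_pos (Real.exp_pos _)]
    refine mul_le_of_le_one_left (norm_nonneg _) ?_
    rw [Real.exp_le_one_iff]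
    nlinarith
  · rw [norm_smul, Real.norm_eq_abs, abs_of_nonneg h0]
    gcongr

theorem not_exists_isBoundedOrbit
    (hP : IsReducing K (eigenKer A lam) lam P) (hK : HasBddInverse A K) (hlam : lam ≠ 0)
    (hgen : ∃ S : C0Semigroup (Phase A α), S.IsGeneratedBy (-(waveOp A α c lam)))
    (hy₀ : y₀ ∈ eigenKer A lam) (hne : y₀ ≠ 0) :
    ¬ ∃ w, IsBoundedOrbit c lam (fun _ : FracSpace A α => y₀) w := by
  rintro ⟨w, hw, hb⟩
  have hw0 : IsMildSolution c lam (fun _ : FracSpace A α => y₀) (Ici 0) w :=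
    ⟨hw.continuousOn.mono (subset_univ _), fun t' _ t _ h =>
      hw.variation_of_constants t' (mem_univ _) t (mem_univ _) h⟩
  obtain ⟨B, hB⟩ := hb.exists_norm_le
  have hB' : ∀ t, ‖w t‖ ≤ B := fun t => hB _ (mem_range_self t)
  set Q := conservedProj A α c lam P
  have hB0 : 0 ≤ B := (norm_nonneg _).trans (hB' 0)
  have hy : 0 < ‖y₀‖ := norm_pos_iff.2 hne
  have key : ∀ t, 0 ≤ t → t * ‖y₀‖ ≤ 2 * (‖Q‖ * B) := by
    intro t ht
    have h1 := conservedProj_mildSolution hP hK hlam hgen hy₀ hw0 ht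
    have h2 : t • y₀ = Q (w t) - Q (w 0) := by rw [h1, add_sub_cancel_left]
    have h3 : ‖t • y₀‖ ≤ ‖Q (w t)‖ + ‖Q (w 0)‖ := h2 ▸ norm_sub_le _ _
    rw [norm_smul, Real.norm_eq_abs, abs_of_nonneg ht] at h3
    linarith [Q.le_opNorm_of_le (hB' t), Q.le_opNorm_of_le (hB' 0)]
  -- A time at which the linear growth exceeds the bound 2 ‖Q‖ B by 1.
  have h4 := key ((2 * (‖Q‖ * B) + 1) / ‖y₀‖) (by positivity)
  rw [div_mul_cancel₀ _ hy.ne'] at h4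
  linarith

end Wave

/-! ### Linear growth of the projected solution -/

section Growth

variable {X H : Type*} [NormedAddCommGroup X] [NormedSpace ℝ X]
  [NormedAddCommGroup H] [InnerProductSpace ℝ H] {i : X →L[ℝ] H}

theorem pairInner_le (p q : X × X) : pairInner i p q ≤ pairNorm i p * pairNorm i q := by
  rw [pairInner, pairNorm, pairNorm, ← Real.sqrt_mul (by positivity)]
  refine Real.le_sqrt_of_sq_le ?_
  have h1 := abs_le.1 (abs_real_inner_le_norm (i p.1) (i q.1))
  have h2 := abs_le.1 (abs_real_inner_le_norm (i p.2) (i q.2))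
  calc (inner ℝ (i p.1) (i q.1) + inner ℝ (i p.2) (i q.2)) ^ 2
      ≤ (‖i p.1‖ * ‖i q.1‖ + ‖i p.2‖ * ‖i q.2‖) ^ 2 :=
        sq_le_sq' (by linarith [h1.1, h2.1]) (by linarith [h1.2, h2.2])
    _ ≤ (‖i p.1‖ ^ 2 + ‖i p.2‖ ^ 2) * (‖i q.1‖ ^ 2 + ‖i q.2‖ ^ 2) := by
        nlinarith [sq_nonneg (‖i p.1‖ * ‖i q.2‖ - ‖i p.2‖ * ‖i q.1‖)]

theorem pairNorm_le (p : X × X) : pairNorm i p ≤ ‖i‖ * (‖p.1‖ + ‖p.2‖) := by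
  rw [pairNorm, Real.sqrt_le_left (by positivity)]
  have h1 := i.le_opNorm p.1
  have h2 := i.le_opNorm p.2
  have h3 : ‖i p.1‖ ^ 2 + ‖i p.2‖ ^ 2 ≤ (‖i p.1‖ + ‖i p.2‖) ^ 2 := by
    nlinarith [mul_nonneg (norm_nonneg (i p.1)) (norm_nonneg (i p.2))]
  refine h3.trans (pow_le_pow_left₀ (by positivity) ?_ 2)
  linarith

variable {A : X →ₗ.[ℝ] X} {α c lam : ℝ} {P : X →L[ℝ] X} {y₀ : X}

/-- Moving the factor c lam to the other side of the inner product explains the test vector (c lam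
y₀, y₀): pairing with it reads off the linearly growing quantity. -/
theorem pairInner_phaseProj (z : Phase A α) :
    pairInner i (phaseProj A α P z) ((c * lam) • y₀, y₀) =
      inner ℝ (i (conservedProj A α c lam P z)) (i y₀) := by
  rw [conservedProj_apply, pairInner, phaseProj]
  simp [inner_add_left, inner_smul_left, inner_smul_right]

theorem exists_linear_growth (hi : Function.Injective i) (hne : y₀ ≠ 0) (hc : 0 < c)
    (hlam : 0 < lam) {w : ℝ → Phase A α} {B : ℝ}
    (h1 : ∀ t, 0 ≤ t → conservedProj A α c lam P (w t) =
      conservedProj A α c lam P (w 0) + t • y₀)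
    (h2 : ∀ t, 0 ≤ t → ‖velocityProj A α P (w t)‖ ≤ B) :
    ∃ a b C : ℝ, 0 < a ∧ ∀ t : ℝ, 0 ≤ t →
      a * t - b ≤ pairNorm i (phaseProj A α P (w t)) ∧
      pairNorm i (phaseProj A α P (w t)) ≤ C * t + b := by
  have hκ : 0 < c * lam := mul_pos hc hlam
  have hiy : 0 < ‖i y₀‖ := norm_pos_iff.2 fun h => hne (hi (h.trans (map_zero i).symm))
  set Q := conservedProj A α c lam P
  set N := pairNorm i ((c * lam) • y₀, y₀) with hN
  have hN0 : 0 < N := by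
    rw [hN, pairNorm]
    exact Real.sqrt_pos.2 (by positivity)
  set I := inner ℝ (i (Q (w 0))) (i y₀) with hI
  set D := ‖i‖ * ((c * lam)⁻¹ * (‖Q (w 0)‖ + B) + B) with hD
  -- Lower bound: Cauchy-Schwarz against the test vector of norm N. Upper bound: P u is recovered
  -- from the growing quantity and the bounded velocity. One b serves both, as the maximum of the
  -- two offsets.
  refine ⟨‖i y₀‖ ^ 2 / N, max (-(I / N)) D, ‖i‖ * ((c * lam)⁻¹ * ‖y₀‖), by positivity,
    fun t ht => ⟨?_, ?_⟩⟩
  · have h3 := pairInner_le (i := i) (phaseProj A α P (w t)) ((c * lam) • y₀, y₀)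
    rw [pairInner_phaseProj, h1 t ht, map_add, map_smul, inner_add_left, inner_smul_left,
      real_inner_self_eq_norm_sq] at h3
    simp only [conj_trivial] at h3
    rw [← div_le_iff₀ hN0, add_div] at h3
    have h4 := le_max_left (-(I / N)) D
    have h5 : t * ‖i y₀‖ ^ 2 / N = ‖i y₀‖ ^ 2 / N * t := by ring
    linarith
  · have h3 : ‖P (w t).2‖ ≤ B := h2 t ht
    have h4 : P (FracSpace.incl A α (w t).1) =
        (c * lam)⁻¹ • (Q (w 0) + t • y₀ - P (w t).2) := by
      rw [eq_inv_smul_iff₀ hκ.ne', ← h1 t ht]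
      exact (add_sub_cancel_right _ _).symm
    have h5 : ‖P (FracSpace.incl A α (w t).1)‖ ≤
        (c * lam)⁻¹ * (‖Q (w 0)‖ + t * ‖y₀‖ + B) := by
      rw [h4, norm_smul, norm_inv, Real.norm_eq_abs, abs_of_pos hκ]
      gcongr
      refine (norm_sub_le _ _).trans (add_le_add ((norm_add_le _ _).trans_eq ?_) h3)
      rw [norm_smul, Real.norm_eq_abs, abs_of_nonneg ht]
    calc pairNorm i (phaseProj A α P (w t)) ≤
          ‖i‖ * (‖P (FracSpace.incl A α (w t).1)‖ + ‖P (w t).2‖) := pairNorm_le _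
      _ ≤ ‖i‖ * ((c * lam)⁻¹ * (‖Q (w 0)‖ + t * ‖y₀‖ + B) + B) := by gcongr
      _ = ‖i‖ * ((c * lam)⁻¹ * ‖y₀‖) * t + D := by rw [hD]; ring
      _ ≤ _ := by gcongr; exact le_max_right _ _

end Growth

end DampedWave

theorem mainTheorem8 {X H : Type*}
    [NormedAddCommGroup X] [NormedSpace ℝ X] [CompleteSpace X]
    [NormedAddCommGroup H] [InnerProductSpace ℝ H] [CompleteSpace H]
    (A : X →ₗ.[ℝ] X) (hsec : DampedWave.IsSectorial A) (hpos : DampedWave.IsPositiveOp A)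
    (hcomp : DampedWave.HasCompactResolvents A)
    (i : X →L[ℝ] H) (hi : Function.Injective i)
    (Ahat : H →ₗ.[ℝ] H) (hsa : IsSelfAdjoint Ahat)
    (hext : ∀ x : A.domain, (i x, i (A x)) ∈ Ahat.graph)
    (α : ℝ) (hα0 : 0 < α) (hα1 : α < 1) (c : ℝ) (hc : 0 < c) (lam : ℝ)
    (y₀ : X) (hy₀ : y₀ ∈ DampedWave.eigenKer A lam) (hne : y₀ ≠ 0) :
    DampedWave.IsAdmissibleNonlinearity (fun _ : DampedWave.FracSpace A α => y₀) ∧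
    (∀ z : DampedWave.Phase A α,
      ∃ w, DampedWave.IsMildSolution c lam (fun _ : DampedWave.FracSpace A α => y₀) (Set.Ici 0) w ∧
        w 0 = z) ∧
    (¬ ∃ w, DampedWave.IsBoundedOrbit c lam (fun _ : DampedWave.FracSpace A α => y₀) w) ∧
    ∃ P : X →L[ℝ] X, DampedWave.IsSpectralProjection A lam P ∧
      ∀ w, DampedWave.IsMildSolution c lam (fun _ : DampedWave.FracSpace A α => y₀) (Set.Ici 0) w →
        (∀ t : ℝ, 0 ≤ t →
          DampedWave.pairInner i (DampedWave.phaseProj A α P (w t)) ((c * lam) • y₀, y₀) =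
            DampedWave.pairInner i (DampedWave.phaseProj A α P (w 0)) ((c * lam) • y₀, y₀) +
              t * ‖i y₀‖ ^ 2) ∧
        ∃ a b C : ℝ, 0 < a ∧ ∀ t : ℝ, 0 ≤ t →
          a * t - b ≤ DampedWave.pairNorm i (DampedWave.phaseProj A α P (w t)) ∧
          DampedWave.pairNorm i (DampedWave.phaseProj A α P (w t)) ≤ C * t + b := by
  obtain ⟨R, K, hR, hK, hKR⟩ := DampedWave.exists_inverse_of_positive hpos
  have hKc : IsCompactOperator K := by
    rw [hKR]
    exact DampedWave.isCompactOperator_inverse (hcomp 0 R hR)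
  obtain ⟨T, C, hT⟩ := hsec.exists_isExpFamily hpos hK
  have hgen := DampedWave.exists_isGeneratedBy_neg_waveOp hT hK hα0 hα1 hc lam
  -- Otherwise `lam` is in the resolvent set by positivity, so 1 - lam K is injective, although it
  -- annihilates the eigenvector.
  have hlam : 0 < lam := by
    by_contra h
    have hu := hpos.isUnit hK (μ := (lam : ℂ)) (by simpa using h)
    rw [ContinuousLinearMap.isUnit_iff_bijective] at hu
    have h0 : (1 - DampedWave.cmul X lam * DampedWave.diag K) (y₀, 0) = 0 := by
      change (y₀, (0 : X)) - DampedWave.cmul X lam (DampedWave.diag K (y₀, 0)) = 0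
      rw [DampedWave.cmul_apply, DampedWave.diag_apply]
      simp [(hK.mem_eigenKer_iff y₀).1 hy₀]
    have h1 := hu.1 (h0.trans (map_zero _).symm)
    exact hne (Prod.ext_iff.1 h1).1
  obtain ⟨P, hP⟩ := DampedWave.exists_isReducing hi hsa hext hK hKc hlam.ne'
  refine ⟨DampedWave.isAdmissibleNonlinearity_const y₀, fun z => ?_,
    DampedWave.not_exists_isBoundedOrbit hP hK hlam.ne' hgen hy₀ hne, P,
    hP.isSpectralProjection hK hKc hlam.ne' hy₀ hne, fun w hw => ⟨fun t ht => ?_, ?_⟩⟩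
  · refine ⟨_, DampedWave.isMildSolution_iff.2 ?_, DampedWave.C0Semigroup.duhamelSolution_zero
      (DampedWave.semigroupOf (-(DampedWave.waveOp A α c lam))) z (0, y₀)⟩
    rw [DampedWave.C0Semigroup.duhamelSolution_zero]
    exact fun t _ => rfl
  · rw [DampedWave.pairInner_phaseProj, DampedWave.pairInner_phaseProj,
      DampedWave.conservedProj_mildSolution hP hK hlam.ne' hgen hy₀ hw ht, map_add, map_smul,
      inner_add_left, inner_smul_left, real_inner_self_eq_norm_sq]
    rfl
  · exact DampedWave.exists_linear_growth hi hne hc hlam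
      (fun t ht => DampedWave.conservedProj_mildSolution hP hK hlam.ne' hgen hy₀ hw ht)
      (fun t ht => DampedWave.norm_velocityProj_mildSolution_le hP hK hlam.ne' hgen hc hlam hy₀
        hw ht)
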